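/- Let $q:\mathbb R\to\mathbb R$ be locally absolutely continuous (for instance continuous and piecewise continuously differentiable), with $q^2$ and $q'$ in $\mathcal L_{1,1}(\mathbb R)$, where $f\in\mathcal L_{1,1}(\mathbb R)$ means that $f$ is measurable and $\int_{-\infty}^{\infty}(1+|x|)\,|f(x)|\,dx<\infty$. (1) For every $\rho\in\mathbb C$ with $\operatorname{Im}\rho\ge 0$ the Zakharov–Shabat system $$n_1'+i\rho n_1=q\,n_2,\qquad n_2'-i\rho n_2=-q\,n_1$$ has unique Jost solutions $\varphi=(\varphi_1,\varphi_2)$ and $\psi=(\psi_1,\psi_2)$ with $e^{i\rho x}\varphi(\rho,x)\to(1,0)$ as $x\to-\infty$ and $e^{-i\rho x}\psi(\rho,x)\to(0,1)$ as $x\to+\infty$. (2) Let $q_1:=-iq'-q^2$. The Schrödinger equation $-y''+q_1y=\rho^2y$ has, for $\operatorname{Im}\rho\ge0$, Jost solutions $e(\rho,x)\sim e^{i\rho x}$ ($x\to+\infty$) and $g(\rho,x)\sim e^{-i\rho x}$ ($x\to-\infty$), and there are kernels $A$, $B$ with $A(x,\cdot)\in L_1(x,\infty)\cap L_2(x,\infty)$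 and $B(x,\cdot)\in L_1(-\infty,x)\cap L_2(-\infty,x)$ for every $x\in\mathbb R$ such that, for all $x\in\mathbb R$ and $\operatorname{Im}\rho\ge0$, $$e(\rho,x)=e^{i\rho x}+\int_x^\infty A(x,t)e^{i\rho t}\,dt,\qquad g(\rho,x)=e^{-i\rho x}+\int_{-\infty}^x B(x,t)e^{-i\rho t}\,dt .$$ (3) For any such kernels, let $L_n$ be the Laguerre polynomials and let $$a_n(x)=\int_x^\infty A(x,t)L_n(t-x)e^{-(t-x)/2}\,dt,\qquad b_n(x)=\int_{-\infty}^x B(x,t)L_n(x-t)e^{-(x-t)/2}\,dt$$ be their Fourier–Laguerre coefficients. Put $z=z(\rho)=\dfrac{\frac12+i\rho}{\frac12-i\rho}$, which maps $\operatorname{Im}\rho>0$ onto $|z|<1$. Then for every $x\in\mathbb R$: (a) the series $\sum_{n}|\operatorname{Re}a_n(x)|^2$, $\sum_{n}|\operatorname{Im}a_n(x)|^2$, $\sum_{n}|\operatorname{Re}b_n(x)|^2$, $\sum_{n}|\operatorname{Im}b_n(x)|^2$ converge; (b) the four power series in $z$ below converge for all $|z|<1$, and $$\varphi_1(\rho,x)=e^{-i\rho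 x}\Bigl(1+(z+1)\sum_{n=0}^\infty(-1)^nz^n\operatorname{Re}b_n(x)\Bigr),\qquad \varphi_2(\rho,x)=e^{-i\rho x}(z+1)\sum_{n=0}^\infty(-1)^nz^n\operatorname{Im}b_n(x),$$ $$\psi_1(\rho,x)=-e^{i\rho x}(z+1)\sum_{n=0}^\infty(-1)^nz^n\operatorname{Im}a_n(x),\qquad \psi_2(\rho,x)=e^{i\rho x}\Bigl(1+(z+1)\sum_{n=0}^\infty(-1)^nz^n\operatorname{Re}a_n(x)\Bigr)$$ for all $\rho$ with $\operatorname{Im}\rho>0$; for every real $\rho$ (where $|z|=1$) these formulas hold with each sum $\sum_{n}(-1)^nz^nc_n$ understood as its radial boundary value $\lim_{r\to1^-}\sum_{n}(-1)^n(rz)^nc_n$; (c) the functions $e^{i\rho x}\varphi_1(\rho,x)$, $e^{i\rho x}\varphi_2(\rho,x)$, $e^{-i\rho x}\psi_1(\rho,x)$, $e^{-i\rho x}\psi_2(\rho,x)$, as functions of $z$ (that is, with $\rho=\frac{i(1-z)}{2(1+z)}$), belong to the Hardy space $H^2$ of the unit disk. -/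

import Mathlib

open Complex MeasureTheory Set Filter Topology

noncomputable section

namespace ZakharovShabat

/-- The class `L_{1,1}(ℝ)`: measurable functions with `∫ (1 + |x|) |f x| dx < ∞`. -/
def MemL11 (f : ℝ → ℂ) : Prop :=
  Integrable (fun x : ℝ => ((1 + |x| : ℝ) : ℂ) * f x) volume

/-- `(n₁, n₂)` solves `n₁' + iρ n₁ = q n₂`, `n₂' - iρ n₂ = -q n₁` on the real line. -/
def IsZSSolution (q : ℝ → ℝ) (ρ : ℂ) (n₁ n₂ : ℝ → ℂ) : Prop :=
  ∀ x : ℝ, HasDerivAt n₁ (-(I * ρ * n₁ x) + (q x : ℂ) * n₂ x) x ∧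
    HasDerivAt n₂ (I * ρ * n₂ x - (q x : ℂ) * n₁ x) x

/-- The left Jost solution of the Zakharov-Shabat system: `φ ∼ (1, 0) e^{-iρx}` as `x → -∞`. -/
def IsZSJostLeft (q : ℝ → ℝ) (ρ : ℂ) (φ₁ φ₂ : ℝ → ℂ) : Prop :=
  IsZSSolution q ρ φ₁ φ₂ ∧
    Tendsto (fun x : ℝ => exp (I * ρ * x) * φ₁ x) atBot (𝓝 1) ∧
    Tendsto (fun x : ℝ => exp (I * ρ * x) * φ₂ x) atBot (𝓝 0)

/-- The right Jost solution of the Zakharov-Shabat system: `ψ ∼ (0, 1) e^{iρx}` as `x → ∞`. -/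
def IsZSJostRight (q : ℝ → ℝ) (ρ : ℂ) (ψ₁ ψ₂ : ℝ → ℂ) : Prop :=
  IsZSSolution q ρ ψ₁ ψ₂ ∧
    Tendsto (fun x : ℝ => exp (-(I * ρ * x)) * ψ₁ x) atTop (𝓝 0) ∧
    Tendsto (fun x : ℝ => exp (-(I * ρ * x)) * ψ₂ x) atTop (𝓝 1)

/-- `y` solves `-y'' + Q y = ρ² y` in the Carathéodory sense: `y` is differentiable and `y'` is
locally absolutely continuous with `y'' = (Q - ρ²) y` almost everywhere, written in the
equivalent integrated form. -/
def IsSchrodingerSolution (Q : ℝ → ℂ) (ρ : ℂ) (y : ℝ → ℂ) : Prop :=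
  ∃ y' : ℝ → ℂ, (∀ x : ℝ, HasDerivAt y (y' x) x) ∧
    ∀ a b : ℝ, IntervalIntegrable (fun t => (Q t - ρ ^ 2) * y t) volume a b ∧
      y' b - y' a = ∫ t in a..b, (Q t - ρ ^ 2) * y t

/-- The Jost solution `e(ρ, x) ∼ e^{iρx}`, `x → ∞`, of the Schrödinger equation. -/
def IsSchrodingerJostRight (Q : ℝ → ℂ) (ρ : ℂ) (e : ℝ → ℂ) : Prop :=
  IsSchrodingerSolution Q ρ e ∧
    Tendsto (fun x : ℝ => exp (-(I * ρ * x)) * e x) atTop (𝓝 1)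

/-- The Jost solution `g(ρ, x) ∼ e^{-iρx}`, `x → -∞`, of the Schrödinger equation. -/
def IsSchrodingerJostLeft (Q : ℝ → ℂ) (ρ : ℂ) (g : ℝ → ℂ) : Prop :=
  IsSchrodingerSolution Q ρ g ∧
    Tendsto (fun x : ℝ => exp (I * ρ * x) * g x) atBot (𝓝 1)

/-- `A` is the kernel of the Levin representation
`e(ρ, x) = e^{iρx} + ∫_x^∞ A(x, t) e^{iρt} dt`, `Im ρ ≥ 0`, with `A(x, ·)` in
`L₁(x, ∞) ∩ L₂(x, ∞)`; it is determined up to null sets in `t`. -/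
def IsRightJostKernel (Q : ℝ → ℂ) (A : ℝ → ℝ → ℂ) : Prop :=
  (∀ x : ℝ, IntegrableOn (A x) (Ioi x) volume ∧ MemLp (A x) 2 (volume.restrict (Ioi x))) ∧
    ∃ e : ℂ → ℝ → ℂ, ∀ ρ : ℂ, 0 ≤ ρ.im →
      IsSchrodingerJostRight Q ρ (e ρ) ∧
        ∀ x : ℝ, e ρ x = exp (I * ρ * x) + ∫ t in Ioi x, A x t * exp (I * ρ * t)

/-- `B` is the kernel of the Levin representation
`g(ρ, x) = e^{-iρx} + ∫_{-∞}^x B(x, t) e^{-iρt} dt`, `Im ρ ≥ 0`, with `B(x, ·)` in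
`L₁(-∞, x) ∩ L₂(-∞, x)`; it is determined up to null sets in `t`. -/
def IsLeftJostKernel (Q : ℝ → ℂ) (B : ℝ → ℝ → ℂ) : Prop :=
  (∀ x : ℝ, IntegrableOn (B x) (Iio x) volume ∧ MemLp (B x) 2 (volume.restrict (Iio x))) ∧
    ∃ g : ℂ → ℝ → ℂ, ∀ ρ : ℂ, 0 ≤ ρ.im →
      IsSchrodingerJostLeft Q ρ (g ρ) ∧
        ∀ x : ℝ, g ρ x = exp (-(I * ρ * x)) + ∫ t in Iio x, B x t * exp (-(I * ρ * t))

/-- The Laguerre polynomial `L_n`. -/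
def laguerre (n : ℕ) (s : ℝ) : ℝ :=
  ∑ k ∈ Finset.range (n + 1), (-1) ^ k * (n.choose k : ℝ) * s ^ k / (k.factorial : ℝ)

/-- The Fourier-Laguerre coefficient `a_n(x)` in `A(x, t) = ∑ a_n(x) L_n(t - x) e^{(x - t)/2}`. -/
def coeffA (A : ℝ → ℝ → ℂ) (n : ℕ) (x : ℝ) : ℂ :=
  ∫ t in Ioi x, A x t * ((laguerre n (t - x) * Real.exp (-(t - x) / 2) : ℝ) : ℂ)

/-- The Fourier-Laguerre coefficient `b_n(x)` in `B(x, t) = ∑ b_n(x) L_n(x - t) e^{-(x - t)/2}`. -/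
def coeffB (B : ℝ → ℝ → ℂ) (n : ℕ) (x : ℝ) : ℂ :=
  ∫ t in Iio x, B x t * ((laguerre n (x - t) * Real.exp (-(x - t) / 2) : ℝ) : ℂ)

/-- The Schrödinger potential `q₁ = -i q' - q²`. -/
def schrodingerPotential (q : ℝ → ℝ) (x : ℝ) : ℂ :=
  -I * ((deriv q x : ℝ) : ℂ) - ((q x : ℝ) : ℂ) ^ 2

/-- The Möbius-mapped spectral parameter `z = (1/2 + iρ) / (1/2 - iρ)`. -/
def zOf (ρ : ℂ) : ℂ := (1 / 2 + I * ρ) / (1 / 2 - I * ρ)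

/-- The inverse map `ρ = i (1 - z) / (2 (1 + z))`, from the open unit disk onto `Im ρ > 0`. -/
def rhoOf (z : ℂ) : ℂ := I * (1 - z) / (2 * (1 + z))

/-- The terms `(-1)ⁿ zⁿ cₙ` of the power series. -/
def seriesTerm (c : ℕ → ℝ) (z : ℂ) (n : ℕ) : ℂ := (-1) ^ n * z ^ n * ((c n : ℝ) : ℂ)

/-- The Hardy space `H²` of the unit disk. -/
def MemHardy2 (f : ℂ → ℂ) : Prop :=
  DifferentiableOn ℂ f (Metric.ball 0 1) ∧
    ∃ C : ℝ, ∀ r : ℝ, 0 ≤ r → r < 1 →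
      ∫ θ in (0 : ℝ)..(2 * Real.pi), ‖f (circleMap 0 r θ)‖ ^ 2 ≤ C

/-- `f(ρ) = E(ρ) (c + (z + 1) ∑ (-1)ⁿ zⁿ cₙ)` for all `ρ` with `Im ρ ≥ 0`, where `z = z(ρ)`.
For `Im ρ > 0`, that is `|z| < 1`, the sum is that of the power series; for real `ρ`, that is
`|z| = 1`, `z ≠ -1`, it is its radial boundary value. -/
def HasSPPS (f E : ℂ → ℂ) (c : ℂ) (coef : ℕ → ℝ) : Prop :=
  (∀ ρ : ℂ, 0 < ρ.im →
    f ρ = E ρ * (c + (zOf ρ + 1) * ∑' n, seriesTerm coef (zOf ρ) n)) ∧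
  (∀ ρ : ℝ, Tendsto
    (fun r : ℝ => E ρ * (c + (zOf ρ + 1) * ∑' n, seriesTerm coef ((r : ℂ) * zOf ρ) n))
    (𝓝[<] 1) (𝓝 (f ρ)))

end ZakharovShabat

end

noncomputable section

namespace ZakharovShabat

/-! ### Laguerre functions -/

/-! The bridge is the combination `y = n₂ - i n₁`: if `(n₁, n₂)` solves the Zakharov–Shabat system,
then `y` solves the Schrödinger equation with potential `-iq' - q²`. Conversely, for `ρ ≠ 0`, `y`
determines the pair through `n₂ + i n₁ = (y' + iqy)/(iρ)`. Hence `e = ψ₂ - iψ₁`, and a Levin kernel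
gives `e^{-iρx}(ψ₂ - iψ₁) = 1 + ∫₀^∞ A(x, x+s) e^{iρs} ds`. Since `q` is real, conjugation together
with `ρ ↦ -ρ̄` fixes the Jost solution but replaces `A` by its conjugate. Adding and subtracting the
two identities assigns `Re A` to `ψ₂` and `-Im A` to `ψ₁` (`IsRightJostKernel.representation`).

The statement concerns arbitrary kernels, so the function `e` that comes with one must be
identified. For `Im ρ > 0` a solution with `e^{-iρx}(n₂ - i n₁) → 0` at `+∞` vanishes
(`IsZSSolution.eq_zero_of_tendsto_sub`); real `ρ`, including `0`, follows by continuity in `ρ`.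

The Laguerre generating function at `w = -z` expands `e^{iρs}` in Laguerre functions, so a half-line
Fourier transform becomes `(z+1) ∑ (-1)ⁿ zⁿ cₙ` (`halfFourier_eq_tsum`). Square summability is
Bessel's inequality. For an integrable kernel the transform is bounded and continuous on `Im ρ ≥ 0`,
which yields the Hardy class and the radial limits.

Existence rests on a positive decreasing integrable majorant `σ` of `|q|` (`exists_isMajorant`).
With the weight `σ(x+s/2) e^{2∫_x^∞ σ}` the integral equations for the real kernels `K₁`, `K₂`
become a contraction with constant `1/2` (`IsMajorant.exists_isKernelPair`). Their transforms solve
the system, and `K₂ - iK₁` is a Levin kernel. The left end is the right end for `q(-x)`. -/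

lemma integrableOn_pow_mul_exp_neg (k : ℕ) :
    IntegrableOn (fun s : ℝ => s ^ k * Real.exp (-s)) (Ioi 0) := by
  have h := Real.GammaIntegral_convergent (s := k + 1) (by positivity)
  refine h.congr_fun (fun s hs => ?_) measurableSet_Ioi
  simp only [add_sub_cancel_right, Real.rpow_natCast, mul_comm]

lemma integral_pow_mul_exp_neg (k : ℕ) :
    ∫ s in Ioi (0 : ℝ), s ^ k * Real.exp (-s) = k.factorial := by
  rw [← Real.Gamma_nat_eq_factorial, Real.Gamma_eq_integral (by positivity)]
  refine setIntegral_congr_fun measurableSet_Ioi (fun s hs => ?_)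
  simp only [add_sub_cancel_right, Real.rpow_natCast, mul_comm]

/-- Each difference lowers the lower index of the binomial coefficient by one. After `j` of them the
constant 1 is left, and any further difference kills it, in agreement with `j.choose n = 0` for `n >
j`. -/
lemma fwdDiff_iter_choose_apply (n j : ℕ) :
    (fwdDiff 1)^[n] (fun x ↦ (x.choose j : ℤ) : ℕ → ℤ) j = j.choose n := by
  rcases le_or_gt n j with h | h
  · obtain ⟨i, rfl⟩ := Nat.exists_eq_add_of_le h
    rw [fwdDiff_iter_choose, Nat.choose_symm_add]
  · obtain ⟨i, rfl⟩ := Nat.exists_eq_add_of_lt h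
    have h1 := fwdDiff_iter_choose 0 j
    rw [add_zero] at h1
    rw [show j + i + 1 = i + 1 + j by ring, Function.iterate_add_apply, h1,
      Function.iterate_succ_apply]
    simp [fwdDiff_iter_eq_sum_shift, Nat.choose_eq_zero_of_lt (show j < i + 1 + j by omega)]

lemma neg_one_pow_sub_eq {n k : ℕ} (h : k ≤ n) : (-1 : ℝ) ^ (n - k) = (-1) ^ n * (-1) ^ k := by
  obtain ⟨i, rfl⟩ := Nat.exists_eq_add_of_le h
  rw [Nat.add_sub_cancel_left, pow_add, mul_right_comm, ← pow_add, ← two_mul, pow_mul]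
  simp

/-- Newton's alternating sum for the `n`-th forward difference of `x ↦ x.choose j` at `j`. It is the
inner sum in the product of two Laguerre polynomials, once `∫ s^{j+k} e^{-s} = (j+k)!` has turned
the factorials into `(j + k).choose k`. -/
lemma sum_neg_one_pow_choose_mul_choose (n j : ℕ) :
    ∑ k ∈ Finset.range (n + 1), (-1 : ℝ) ^ k * n.choose k * (j + k).choose k =
      (-1) ^ n * j.choose n := by
  have h := fwdDiff_iter_choose_apply n j
  rw [fwdDiff_iter_eq_sum_shift] at h
  have h' := congrArg (fun m : ℤ => (-1 : ℝ) ^ n * (m : ℝ)) h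
  simp only [Int.cast_sum, Finset.mul_sum, Int.cast_natCast] at h'
  rw [← h']
  refine Finset.sum_congr rfl fun k hk => ?_
  have hk' : k ≤ n := Nat.lt_succ_iff.mp (Finset.mem_range.mp hk)
  have h2 : (-1 : ℝ) ^ n * (-1) ^ n = 1 := by rw [← mul_pow]; simp
  simp only [smul_eq_mul, mul_one, Int.cast_mul, Int.cast_pow, Int.cast_neg, Int.cast_one,
    Int.cast_natCast, neg_one_pow_sub_eq hk', Nat.choose_symm_add (a := j) (b := k)]
  linear_combination (-(-1 : ℝ) ^ k * n.choose k * (j + k).choose k) * h2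

/-- The same Newton sum at base point 0; it evaluates the outer sum and produces the Kronecker
delta. -/
lemma sum_neg_one_pow_choose_mul_choose_self (m n : ℕ) :
    ∑ j ∈ Finset.range (m + 1), (-1 : ℝ) ^ j * m.choose j * j.choose n =
      if m = n then (-1) ^ n else 0 := by
  have h := fwdDiff_iter_choose_zero n m
  rw [fwdDiff_iter_eq_sum_shift] at h
  have h' := congrArg (fun l : ℤ => (-1 : ℝ) ^ m * (l : ℝ)) h
  simp only [Int.cast_sum, Finset.mul_sum] at h'
  have h3 : (-1 : ℝ) ^ m * ((if m = n then (1 : ℤ) else 0 : ℤ) : ℝ) =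
      if m = n then (-1) ^ n else 0 := by
    split_ifs with hmn <;> simp [hmn]
  rw [← h3, ← h']
  refine Finset.sum_congr rfl fun k hk => ?_
  have hk' : k ≤ m := Nat.lt_succ_iff.mp (Finset.mem_range.mp hk)
  have h2 : (-1 : ℝ) ^ m * (-1) ^ m = 1 := by rw [← mul_pow]; simp
  simp only [smul_eq_mul, mul_one, Int.cast_mul, Int.cast_pow, Int.cast_neg, Int.cast_one,
    Int.cast_natCast, zero_add, neg_one_pow_sub_eq hk']
  linear_combination (-(-1 : ℝ) ^ k * m.choose k * k.choose n) * h2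

lemma laguerre_mul_laguerre (m n : ℕ) (s : ℝ) :
    laguerre m s * laguerre n s * Real.exp (-s) =
      ∑ j ∈ Finset.range (m + 1), ∑ k ∈ Finset.range (n + 1),
        ((-1) ^ j * (m.choose j : ℝ) / (j.factorial : ℝ)) *
          ((-1) ^ k * (n.choose k : ℝ) / (k.factorial : ℝ)) * (s ^ (j + k) * Real.exp (-s)) := by
  rw [laguerre, laguerre, Finset.sum_mul_sum]
  simp only [Finset.sum_mul]
  refine Finset.sum_congr rfl fun j _ => Finset.sum_congr rfl fun k _ => ?_
  ring

lemma integrableOn_laguerre_mul_laguerre (m n : ℕ) :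
    IntegrableOn (fun s => laguerre m s * laguerre n s * Real.exp (-s)) (Ioi 0) := by
  simp only [laguerre_mul_laguerre]
  exact integrable_finsetSum _ fun j _ => integrable_finsetSum _ fun k _ =>
    (integrableOn_pow_mul_exp_neg (j + k)).const_mul _

/-- Orthonormality of the Laguerre polynomials with respect to the weight `e^{-s}`. -/
lemma integral_laguerre_mul_laguerre (m n : ℕ) :
    ∫ s in Ioi (0 : ℝ), laguerre m s * laguerre n s * Real.exp (-s) = if m = n then 1 else 0 := by
  simp only [laguerre_mul_laguerre]
  rw [integral_finsetSum _ fun j _ => integrable_finsetSum _ fun k _ =>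
    (integrableOn_pow_mul_exp_neg (j + k)).const_mul _]
  have h1 : ∀ j ∈ Finset.range (m + 1), ∫ s in Ioi (0 : ℝ), ∑ k ∈ Finset.range (n + 1),
      ((-1) ^ j * (m.choose j : ℝ) / (j.factorial : ℝ)) *
        ((-1) ^ k * (n.choose k : ℝ) / (k.factorial : ℝ)) * (s ^ (j + k) * Real.exp (-s)) =
      (-1) ^ n * ((-1 : ℝ) ^ j * m.choose j * j.choose n) := by
    intro j _
    rw [integral_finsetSum _ fun k _ => (integrableOn_pow_mul_exp_neg (j + k)).const_mul _]
    have h2 := sum_neg_one_pow_choose_mul_choose n j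
    calc _ = ∑ k ∈ Finset.range (n + 1), ((-1 : ℝ) ^ j * m.choose j) *
          ((-1 : ℝ) ^ k * n.choose k * (j + k).choose k) := by
          refine Finset.sum_congr rfl fun k _ => ?_
          rw [integral_const_mul, integral_pow_mul_exp_neg]
          have h3 : ((j + k).factorial : ℝ) = (j + k).choose k * j.factorial * k.factorial := by
            have := Nat.add_choose_mul_factorial_mul_factorial j k
            exact_mod_cast this.symm
          rw [h3]
          have := Nat.factorial_ne_zero j
          have := Nat.factorial_ne_zero k
          field_simp
      _ = _ := by rw [← Finset.mul_sum, h2]; ring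
  rw [Finset.sum_congr rfl h1, ← Finset.mul_sum, sum_neg_one_pow_choose_mul_choose_self]
  split_ifs
  · rw [← mul_pow]; simp
  · simp

/-- The Laguerre function `L_n(s) e^{-s/2}`. -/
def laguerreFun (n : ℕ) (s : ℝ) : ℝ := laguerre n s * Real.exp (-s / 2)

lemma continuous_laguerre (n : ℕ) : Continuous (laguerre n) := by
  unfold laguerre; fun_prop

lemma continuous_laguerreFun (n : ℕ) : Continuous (laguerreFun n) := by
  have := continuous_laguerre n
  unfold laguerreFun; fun_prop

lemma laguerreFun_mul_laguerreFun (m n : ℕ) (s : ℝ) :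
    laguerreFun m s * laguerreFun n s = laguerre m s * laguerre n s * Real.exp (-s) := by
  have : Real.exp (-s) = Real.exp (-s / 2) * Real.exp (-s / 2) := by
    rw [← Real.exp_add]; congr 1; ring
  rw [this]; unfold laguerreFun; ring

lemma memLp_laguerreFun (n : ℕ) : MemLp (laguerreFun n) 2 (volume.restrict (Ioi 0)) := by
  rw [memLp_two_iff_integrable_sq (continuous_laguerreFun n).aestronglyMeasurable]
  refine (integrableOn_laguerre_mul_laguerre n n).congr (Eventually.of_forall fun s => ?_)
  simp only [pow_two, laguerreFun_mul_laguerreFun]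

/-- The Laguerre functions as elements of `L²(0, ∞)`. -/
def laguerreLp (n : ℕ) : Lp ℝ 2 (volume.restrict (Ioi (0 : ℝ))) := (memLp_laguerreFun n).toLp

lemma inner_toLp_two {f g : ℝ → ℝ} {μ : Measure ℝ} (hf : MemLp f 2 μ) (hg : MemLp g 2 μ) :
    inner ℝ hf.toLp hg.toLp = ∫ s, f s * g s ∂μ := by
  rw [L2.inner_def]
  refine integral_congr_ae ?_
  filter_upwards [hf.coeFn_toLp, hg.coeFn_toLp] with s h1 h2
  rw [h1, h2]
  simp [mul_comm]

lemma orthonormal_laguerreLp : Orthonormal ℝ laguerreLp := by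
  rw [orthonormal_iff_ite]
  intro m n
  rw [laguerreLp, laguerreLp, inner_toLp_two, ← integral_laguerre_mul_laguerre m n]
  simp only [laguerreFun_mul_laguerreFun]

/-- The real Fourier-Laguerre coefficients on the half line. -/
def laguerreCoeff (α : ℝ → ℝ) (n : ℕ) : ℝ := ∫ s in Ioi (0 : ℝ), α s * laguerreFun n s

/-- Bessel's inequality for Laguerre functions, in qualitative form. -/
lemma summable_sq_laguerreCoeff {α : ℝ → ℝ} (hα : MemLp α 2 (volume.restrict (Ioi 0))) :
    Summable fun n => laguerreCoeff α n ^ 2 := by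
  have h := orthonormal_laguerreLp.inner_products_summable (x := hα.toLp)
  refine h.congr fun n => ?_
  rw [laguerreLp, inner_toLp_two, laguerreCoeff, Real.norm_eq_abs, sq_abs]
  simp only [mul_comm]

lemma integrable_mul_laguerreFun {α : ℝ → ℝ} (hα : MemLp α 2 (volume.restrict (Ioi 0))) (n : ℕ) :
    IntegrableOn (fun s => α s * laguerreFun n s) (Ioi 0) :=
  hα.integrable_mul (memLp_laguerreFun n)

lemma integral_sq_laguerreFun (n : ℕ) : ∫ s in Ioi (0 : ℝ), laguerreFun n s ^ 2 = 1 := by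
  have h := integral_laguerre_mul_laguerre n n
  simpa only [if_true, pow_two, laguerreFun_mul_laguerreFun] using h

/-- From `|ab| ≤ a² + b²` and the unit norm of the Laguerre functions. What matters is uniformity in
`n`: the powers of `z` then supply a geometric majorant. -/
lemma integral_norm_mul_laguerreFun_le {α : ℝ → ℝ} (hα : MemLp α 2 (volume.restrict (Ioi 0)))
    (n : ℕ) : ∫ s in Ioi (0 : ℝ), ‖α s * laguerreFun n s‖ ≤
      (∫ s in Ioi (0 : ℝ), α s ^ 2) + 1 := by
  have hα2 : Integrable (fun s => α s ^ 2) (volume.restrict (Ioi 0)) := hα.integrable_sq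
  have hl2 : Integrable (fun s => laguerreFun n s ^ 2) (volume.restrict (Ioi 0)) :=
    (memLp_laguerreFun n).integrable_sq
  rw [← integral_sq_laguerreFun n, ← integral_add hα2 hl2]
  refine integral_mono (integrable_mul_laguerreFun hα n).norm (hα2.add hl2) fun s => ?_
  simp only [Real.norm_eq_abs, abs_mul]
  nlinarith [sq_abs (α s), sq_abs (laguerreFun n s), sq_nonneg (|α s| - |laguerreFun n s|),
    sq_nonneg (α s), sq_nonneg (laguerreFun n s)]

/-- The generating function of the Laguerre polynomials. -/
lemma hasSum_laguerre (s : ℝ) {w : ℂ} (hw : ‖w‖ < 1) :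
    HasSum (fun n => w ^ n * (laguerre n s : ℂ)) (exp (-(s * w / (1 - w))) / (1 - w)) := by
  have hw1 : (1 : ℂ) - w ≠ 0 := by
    intro h
    rw [sub_eq_zero] at h
    rw [← h] at hw
    simp at hw
  -- the double series, with terms indexed by `(k, i)`, `n = i + k`
  obtain ⟨F, hF⟩ : ∃ F : ℕ × ℕ → ℂ, ∀ k i, F (k, i) =
      ((-s * w) ^ k / (k.factorial : ℂ)) * (((i + k).choose k : ℂ) * w ^ i) :=
    ⟨fun p => ((-s * w) ^ p.1 / (p.1.factorial : ℂ)) *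
      (((p.2 + p.1).choose p.1 : ℂ) * w ^ p.2), fun _ _ => rfl⟩
  have hfib : ∀ k, HasSum (fun i => F (k, i))
      (((-s * w) ^ k / (k.factorial : ℂ)) * (1 / (1 - w) ^ (k + 1))) := fun k => by
    simp only [hF]
    exact (hasSum_choose_mul_geometric_of_norm_lt_one k hw).mul_left _
  have hnorm : ∀ k, HasSum (fun i => ‖F (k, i)‖)
      (((|s| * ‖w‖) ^ k / (k.factorial : ℝ)) * (1 / (1 - ‖w‖) ^ (k + 1))) := fun k => by
    have h := (hasSum_choose_mul_geometric_of_norm_lt_one k (r := ‖w‖) (by simpa using hw)).mul_left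
      ((|s| * ‖w‖) ^ k / (k.factorial : ℝ))
    refine h.congr_fun fun i => ?_
    simp [hF]
  -- The row sums of the norms are the terms of an exponential series in `|s|‖w‖/(1 - ‖w‖)`, up to
  -- the factor `1/(1 - ‖w‖)`.
  have hS : Summable F := by
    rw [← summable_norm_iff, summable_prod_of_nonneg fun _ => norm_nonneg _]
    refine ⟨fun k => (hnorm k).summable, ?_⟩
    simp only [fun k => (hnorm k).tsum_eq]
    have h := (Real.summable_pow_div_factorial (|s| * ‖w‖ / (1 - ‖w‖))).mul_right (1 / (1 - ‖w‖))
    have h0 : 1 - ‖w‖ ≠ 0 := by linarith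
    refine h.congr fun k => ?_
    rw [div_pow, pow_succ]
    field_simp
  -- Summing over `i` first gives `(1 - w)^{-(k+1)}`, and the sum over `k` is then the exponential
  -- series.
  have hsum : HasSum F (exp (-(s * w / (1 - w))) / (1 - w)) := by
    have h1 := hS.hasSum.prod_fiberwise hfib
    have h2 : HasSum (fun k : ℕ => ((-s * w) ^ k / (k.factorial : ℂ)) * (1 / (1 - w) ^ (k + 1)))
        (exp (-(s * w / (1 - w))) / (1 - w)) := by
      have h3 := (NormedSpace.expSeries_div_hasSum_exp (-(s * w / (1 - w)) : ℂ)).mul_right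
        (1 / (1 - w))
      rw [← Complex.exp_eq_exp_ℂ, ← div_eq_mul_one_div] at h3
      refine h3.congr_fun fun k => ?_
      rw [← neg_div, div_pow, pow_succ]
      field_simp
    have h4 := hS.hasSum
    rwa [h1.unique h2] at h4
  -- Regrouping along `i + k = n` collects the coefficient of `w^n`, which is the Laguerre
  -- polynomial.
  have h5 := (Finset.HasAntidiagonal.sigmaAntidiagonalEquivProd.hasSum_iff.2 hsum).sigma
    fun n => hasSum_fintype _
  refine h5.congr_fun fun n => ?_
  rw [Finset.univ_eq_attach, Function.comp_def]
  change _ = ∑ p ∈ (Finset.HasAntidiagonal.antidiagonal n).attach, F p.1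
  rw [Finset.sum_attach (Finset.HasAntidiagonal.antidiagonal n) F,
    Finset.Nat.sum_antidiagonal_eq_sum_range_succ_mk, laguerre]
  push_cast
  rw [Finset.mul_sum]
  refine Finset.sum_congr rfl fun k hk => ?_
  have hk' : k ≤ n := Nat.lt_succ_iff.mp (Finset.mem_range.mp hk)
  simp only [hF, Nat.sub_add_cancel hk']
  have : w ^ n = w ^ k * w ^ (n - k) := by rw [← pow_add, Nat.add_sub_cancel' hk']
  rw [this]
  ring

/-! ### The Möbius map and half-line Fourier transforms -/

/-- The Fourier transform `∫₀^∞ α(s) e^{iρs} ds` of a function on the half line. -/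
def halfFourier (α : ℝ → ℂ) (ρ : ℂ) : ℂ := ∫ s in Ioi (0 : ℝ), α s * exp (I * ρ * s)

lemma norm_exp_I_mul (ρ : ℂ) (s : ℝ) : ‖exp (I * ρ * s)‖ = Real.exp (-(ρ.im * s)) := by
  rw [Complex.norm_exp]
  simp

lemma norm_exp_I_mul_le {ρ : ℂ} (hρ : 0 ≤ ρ.im) {s : ℝ} (hs : 0 ≤ s) :
    ‖exp (I * ρ * s)‖ ≤ 1 := by
  rw [norm_exp_I_mul, Real.exp_le_one_iff, neg_nonpos]
  exact mul_nonneg hρ hs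

lemma norm_mul_exp_le (α : ℝ → ℂ) {ρ : ℂ} (hρ : 0 ≤ ρ.im) :
    ∀ᵐ s ∂(volume.restrict (Ioi (0 : ℝ))), ‖α s * exp (I * ρ * s)‖ ≤ ‖α s‖ := by
  filter_upwards [ae_restrict_mem measurableSet_Ioi] with s hs
  rw [norm_mul]
  exact mul_le_of_le_one_right (norm_nonneg _) (norm_exp_I_mul_le hρ (le_of_lt hs))

lemma integrableOn_mul_exp {α : ℝ → ℂ} (hα : IntegrableOn α (Ioi 0)) {ρ : ℂ} (hρ : 0 ≤ ρ.im) :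
    IntegrableOn (fun s : ℝ => α s * exp (I * ρ * s)) (Ioi 0) := by
  refine Integrable.mono hα (hα.aestronglyMeasurable.mul ?_) (norm_mul_exp_le α hρ)
  exact Continuous.aestronglyMeasurable (by fun_prop)

lemma norm_halfFourier_le {α : ℝ → ℂ} (hα : IntegrableOn α (Ioi 0)) {ρ : ℂ} (hρ : 0 ≤ ρ.im) :
    ‖halfFourier α ρ‖ ≤ ∫ s in Ioi (0 : ℝ), ‖α s‖ :=
  norm_integral_le_of_norm_le hα.norm (norm_mul_exp_le α hρ)

lemma continuousOn_halfFourier {α : ℝ → ℂ} (hα : IntegrableOn α (Ioi 0)) :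
    ContinuousOn (halfFourier α) {ρ | 0 ≤ ρ.im} := by
  intro ρ₀ h₀
  refine continuousWithinAt_of_dominated (bound := fun s => ‖α s‖) ?_ ?_ hα.norm ?_
  · filter_upwards [self_mem_nhdsWithin] with ρ hρ
    exact (integrableOn_mul_exp hα hρ).aestronglyMeasurable
  · filter_upwards [self_mem_nhdsWithin] with ρ hρ
    exact norm_mul_exp_le α hρ
  · refine Eventually.of_forall fun s => Continuous.continuousWithinAt ?_
    fun_prop

lemma half_sub_ne_zero {ρ : ℂ} (hρ : 0 ≤ ρ.im) : (1 / 2 : ℂ) - I * ρ ≠ 0 := by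
  intro h
  have := congrArg Complex.re h
  norm_num at this
  linarith

lemma zOf_add_one {ρ : ℂ} (hρ : 0 ≤ ρ.im) : zOf ρ + 1 = 1 / (1 / 2 - I * ρ) := by
  rw [zOf, div_add_one (half_sub_ne_zero hρ)]
  congr 1
  ring

lemma zOf_add_one_ne_zero {ρ : ℂ} (hρ : 0 ≤ ρ.im) : zOf ρ + 1 ≠ 0 := by
  rw [zOf_add_one hρ]
  exact one_div_ne_zero (half_sub_ne_zero hρ)

lemma norm_zOf_lt_one {ρ : ℂ} (hρ : 0 < ρ.im) : ‖zOf ρ‖ < 1 := by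
  have h := half_sub_ne_zero hρ.le
  rw [zOf, norm_div, div_lt_one (norm_pos_iff.2 h)]
  refine lt_of_pow_lt_pow_left₀ 2 (norm_nonneg _) ?_
  rw [Complex.sq_norm, Complex.sq_norm, Complex.normSq_apply, Complex.normSq_apply]
  norm_num
  nlinarith

lemma norm_zOf_ofReal (ρ : ℝ) : ‖zOf ρ‖ = 1 := by
  have h := half_sub_ne_zero (ρ := (ρ : ℂ)) (by simp)
  rw [zOf, norm_div, div_eq_one_iff_eq (norm_ne_zero_iff.2 h)]
  refine (sq_eq_sq₀ (norm_nonneg _) (norm_nonneg _)).1 ?_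
  rw [Complex.sq_norm, Complex.sq_norm, Complex.normSq_apply, Complex.normSq_apply]
  norm_num

lemma rhoOf_zOf {ρ : ℂ} (hρ : 0 ≤ ρ.im) : rhoOf (zOf ρ) = ρ := by
  have h := half_sub_ne_zero hρ
  have h1 : 1 + zOf ρ ≠ 0 := by rw [add_comm]; exact zOf_add_one_ne_zero hρ
  have h2 : zOf ρ * (1 / 2 - I * ρ) = 1 / 2 + I * ρ := div_mul_cancel₀ _ h
  rw [rhoOf, div_eq_iff (mul_ne_zero two_ne_zero h1)]
  refine mul_right_cancel₀ h ?_
  linear_combination (-I - 2 * ρ) * h2 - 2 * ρ * I_mul_I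

lemma one_add_ne_zero_of_norm_lt {z : ℂ} (hz : ‖z‖ < 1) : 1 + z ≠ 0 := by
  intro h
  have : z = -1 := by linear_combination h
  rw [this] at hz
  simp at hz

lemma rhoOf_im_pos {z : ℂ} (hz : ‖z‖ < 1) : 0 < (rhoOf z).im := by
  have h := one_add_ne_zero_of_norm_lt hz
  have h1 : (rhoOf z).im = (1 - ‖z‖ ^ 2) / (2 * normSq (1 + z)) := by
    have h2 : rhoOf z = ((1 / (2 * normSq (1 + z)) : ℝ) : ℂ) *
        (I * (1 - z) * (starRingEnd ℂ) (1 + z)) := by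
      have h3 : (normSq (1 + z) : ℂ) = (1 + z) * (starRingEnd ℂ) (1 + z) := by
        rw [Complex.mul_conj]
      have h4 : (starRingEnd ℂ) (1 + z) ≠ 0 := (map_ne_zero _).2 h
      rw [rhoOf]
      push_cast
      rw [h3]
      field_simp
    rw [h2, Complex.im_ofReal_mul, Complex.sq_norm,
      Complex.normSq_apply z]
    simp
    ring
  rw [h1]
  have h5 : 0 < normSq (1 + z) := Complex.normSq_pos.2 h
  have h6 : ‖z‖ ^ 2 < 1 := by nlinarith [norm_nonneg z]
  have : 0 < 1 - ‖z‖ ^ 2 := by linarith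
  positivity

lemma zOf_rhoOf {z : ℂ} (hz : ‖z‖ < 1) : zOf (rhoOf z) = z := by
  have h := one_add_ne_zero_of_norm_lt hz
  have h1 : (1 / 2 : ℂ) - I * rhoOf z = 1 / (1 + z) := by
    rw [rhoOf]; field_simp; ring_nf; simp; ring
  have h2 : (1 / 2 : ℂ) + I * rhoOf z = z / (1 + z) := by
    rw [rhoOf]; field_simp; ring_nf; simp; ring
  rw [zOf, h1, h2]
  field_simp

/-! ### Laguerre series of half-line Fourier transforms -/

lemma norm_laguerreCoeff_le {α : ℝ → ℝ} (hα : MemLp α 2 (volume.restrict (Ioi 0))) (n : ℕ) :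
    ‖laguerreCoeff α n‖ ≤ (∫ s in Ioi (0 : ℝ), α s ^ 2) + 1 :=
  (norm_integral_le_integral_norm _).trans (integral_norm_mul_laguerreFun_le hα n)

lemma norm_seriesTerm (c : ℕ → ℝ) (z : ℂ) (n : ℕ) : ‖seriesTerm c z n‖ = ‖z‖ ^ n * ‖c n‖ := by
  simp [seriesTerm]

lemma summable_seriesTerm {c : ℕ → ℝ} {M : ℝ} (hc : ∀ n, ‖c n‖ ≤ M) {z : ℂ} (hz : ‖z‖ < 1) :
    Summable (seriesTerm c z) := by
  refine Summable.of_norm_bounded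
    ((summable_geometric_of_lt_one (norm_nonneg z) hz).mul_right M) fun n => ?_
  rw [norm_seriesTerm]
  exact mul_le_mul_of_nonneg_left (hc n) (by positivity)

lemma differentiableOn_tsum_seriesTerm {c : ℕ → ℝ} {M : ℝ} (hc : ∀ n, ‖c n‖ ≤ M) :
    DifferentiableOn ℂ (fun z => ∑' n, seriesTerm c z n) (Metric.ball 0 1) := by
  intro z hz
  rw [mem_ball_zero_iff] at hz
  obtain ⟨r, hr1, hr2⟩ := exists_between hz
  have hr0 : 0 ≤ r := (norm_nonneg z).trans hr1.le
  have h : DifferentiableOn ℂ (fun z => ∑' n, seriesTerm c z n) (Metric.ball 0 r) := by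
    refine differentiableOn_tsum_of_summable_norm (u := fun n => r ^ n * M)
      ((summable_geometric_of_lt_one hr0 hr2).mul_right M) (fun n => ?_) Metric.isOpen_ball
      fun n w hw => ?_
    · unfold seriesTerm; fun_prop
    · rw [norm_seriesTerm]
      rw [mem_ball_zero_iff] at hw
      have hM : 0 ≤ M := (norm_nonneg _).trans (hc n)
      exact mul_le_mul (pow_le_pow_left₀ (norm_nonneg _) hw.le n) (hc n) (norm_nonneg _)
        (by positivity)
  exact (h.differentiableAt (Metric.isOpen_ball.mem_nhds
    (by rwa [mem_ball_zero_iff]))).differentiableWithinAt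

/-- The generating function at `w = -z`: the factor `z + 1` cancels its denominator, and since
`z/(z+1) = 1/2 + iρ`, the weight `e^{-s/2}` leaves exactly `e^{iρs}`. This is what singles out the
Möbius map `zOf`. -/
lemma hasSum_laguerreFun (s : ℝ) {ρ : ℂ} (hρ : 0 < ρ.im) :
    HasSum (fun n => (zOf ρ + 1) * ((-zOf ρ) ^ n * (laguerreFun n s : ℂ))) (exp (I * ρ * s)) := by
  have hz := norm_zOf_lt_one hρ
  have h := ((hasSum_laguerre s (w := -zOf ρ) (by rwa [norm_neg])).mul_right
    (exp (-s / 2))).mul_left (zOf ρ + 1)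
  have h1 := zOf_add_one_ne_zero hρ.le
  have h2 := half_sub_ne_zero hρ.le
  have h3 : (1 : ℂ) - -zOf ρ = zOf ρ + 1 := by ring
  have h4 : exp (I * ρ * s) = (zOf ρ + 1) * (exp (-(↑s * -zOf ρ / (1 - -zOf ρ))) /
      (1 - -zOf ρ) * exp (-s / 2)) := by
    rw [h3, mul_comm (zOf ρ + 1), div_mul_eq_mul_div, div_mul_cancel₀ _ h1, ← Complex.exp_add]
    congr 1
    have h5 : zOf ρ / (zOf ρ + 1) = 1 / 2 + I * ρ := by
      rw [zOf_add_one hρ.le, zOf, div_div_div_cancel_right₀ h2, div_one]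
    linear_combination -(s : ℂ) * h5
  rw [h4]
  refine h.congr_fun fun n => ?_
  simp only [laguerreFun]
  push_cast
  ring

/-- Termwise integration of the Laguerre expansion of `e^{iρs}`. The `L¹` norms of the terms are
dominated by a geometric series because `|z| < 1`, hence the strict inequality on `Im ρ`. -/
lemma halfFourier_eq_tsum {α : ℝ → ℝ} (hα : MemLp α 2 (volume.restrict (Ioi 0)))
    {ρ : ℂ} (hρ : 0 < ρ.im) :
    halfFourier (fun s => (α s : ℂ)) ρ =
      (zOf ρ + 1) * ∑' n, seriesTerm (laguerreCoeff α) (zOf ρ) n := by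
  have hz := norm_zOf_lt_one hρ
  set F : ℕ → ℝ → ℂ := fun n s =>
    ((zOf ρ + 1) * (-zOf ρ) ^ n) * ((α s * laguerreFun n s : ℝ) : ℂ) with hF
  have hint : ∀ n, Integrable (F n) (volume.restrict (Ioi 0)) := fun n =>
    (integrable_mul_laguerreFun hα n).ofReal.const_mul _
  have hnorm : Summable fun n => ∫ s in Ioi (0 : ℝ), ‖F n s‖ := by
    refine Summable.of_nonneg_of_le (fun n => integral_nonneg fun s => norm_nonneg _) (fun n => ?_)
      (((summable_geometric_of_lt_one (norm_nonneg _) hz).mul_left ‖zOf ρ + 1‖).mul_right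
        ((∫ s in Ioi (0 : ℝ), α s ^ 2) + 1))
    simp only [hF, norm_mul (_ * _), Complex.norm_real, integral_const_mul, norm_mul (zOf ρ + 1),
      norm_pow, norm_neg]
    exact mul_le_mul_of_nonneg_left (integral_norm_mul_laguerreFun_le hα n) (by positivity)
  have h := integral_tsum_of_summable_integral_norm hint hnorm
  have h1 : ∀ s, ∑' n, F n s = (α s : ℂ) * exp (I * ρ * s) := fun s => by
    rw [← (hasSum_laguerreFun s hρ).tsum_eq, ← tsum_mul_left]
    refine tsum_congr fun n => ?_
    simp only [hF]; push_cast; ring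
  have h2 : ∀ n, ∫ s in Ioi (0 : ℝ), F n s =
      (zOf ρ + 1) * seriesTerm (laguerreCoeff α) (zOf ρ) n := fun n => by
    simp only [hF]
    rw [integral_const_mul, integral_complex_ofReal, seriesTerm, laguerreCoeff, neg_pow]
    ring
  simp only [h1, h2] at h
  rw [halfFourier, ← h, tsum_mul_left]

/-- The Laguerre series represents `E(ρ) (c + ∫₀^∞ α(s) e^{iρs} ds)`. -/
lemma hasSPPS_of_halfFourier {α : ℝ → ℝ} (hα1 : IntegrableOn α (Ioi 0))
    (hα : MemLp α 2 (volume.restrict (Ioi 0))) {f E : ℂ → ℂ} {c : ℂ}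
    (hf : ∀ ρ : ℂ, 0 ≤ ρ.im → f ρ = E ρ * (c + halfFourier (fun s => (α s : ℂ)) ρ)) :
    HasSPPS f E c (laguerreCoeff α) := by
  refine ⟨fun ρ hρ => by rw [hf ρ hρ.le, halfFourier_eq_tsum hα hρ], fun ρ => ?_⟩
  have hρ : 0 ≤ (ρ : ℂ).im := by simp
  have hz1 := zOf_add_one_ne_zero hρ
  rw [hf ρ hρ]
  refine Tendsto.const_mul _ (Tendsto.const_add _ ?_)
  have hrz : Tendsto (fun r : ℝ => (r : ℂ) * zOf ρ) (𝓝[<] 1) (𝓝 (zOf ρ)) := by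
    have : Tendsto (fun r : ℝ => (r : ℂ) * zOf ρ) (𝓝 1) (𝓝 (((1 : ℝ) : ℂ) * zOf ρ)) :=
      Continuous.tendsto (by fun_prop) _
    rw [Complex.ofReal_one, one_mul] at this
    exact this.mono_left nhdsWithin_le_nhds
  have hlt : ∀ᶠ r : ℝ in 𝓝[<] 1, ‖(r : ℂ) * zOf ρ‖ < 1 := by
    filter_upwards [self_mem_nhdsWithin, mem_nhdsWithin_of_mem_nhds (lt_mem_nhds one_pos)]
      with r hr hr0
    rw [norm_mul, norm_zOf_ofReal, mul_one, Complex.norm_real, Real.norm_of_nonneg hr0.le]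
    exact hr
  -- A radius in the disk corresponds to an approach to the real point `ρ` from inside the upper
  -- half-plane, where the transform is continuous up to the boundary.
  have hrho : Tendsto (fun r : ℝ => rhoOf ((r : ℂ) * zOf ρ)) (𝓝[<] 1)
      (𝓝[{ρ | 0 ≤ ρ.im}] (ρ : ℂ)) := by
    refine tendsto_nhdsWithin_iff.2 ⟨?_, hlt.mono fun r hr => (rhoOf_im_pos hr).le⟩
    have hc : ContinuousAt rhoOf (zOf ρ) := by
      unfold rhoOf
      refine ContinuousAt.div (by fun_prop) (by fun_prop) ?_
      rw [add_comm]
      exact mul_ne_zero two_ne_zero hz1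
    have := hc.tendsto.comp hrz
    rwa [rhoOf_zOf hρ] at this
  have hG := (continuousOn_halfFourier (α := fun s => (α s : ℂ)) hα1.ofReal ρ hρ).tendsto.comp hrho
  -- The prefactor is frozen at the boundary value `z + 1`, while the transform at the interior
  -- point carries `rz + 1`; their quotient tends to 1.
  have hquot : Tendsto (fun r : ℝ => (zOf ρ + 1) / ((r : ℂ) * zOf ρ + 1)) (𝓝[<] 1) (𝓝 1) := by
    have := (tendsto_const_nhds (x := zOf ρ + 1)).div (hrz.add_const 1) hz1
    rwa [div_self hz1] at this
  have hprod := hquot.mul hG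
  rw [one_mul] at hprod
  refine hprod.congr' ?_
  filter_upwards [hlt] with r hr
  have h1 : (r : ℂ) * zOf ρ + 1 ≠ 0 := by
    rw [add_comm]; exact one_add_ne_zero_of_norm_lt hr
  rw [Function.comp_apply, halfFourier_eq_tsum hα (rhoOf_im_pos hr), zOf_rhoOf hr, ← mul_assoc,
    div_mul_cancel₀ _ h1]

/-- `c + ∫₀^∞ α(s) e^{iρs} ds`, as a function of `z`, is in the Hardy space. -/
lemma memHardy2_of_halfFourier {α : ℝ → ℝ} (hα1 : IntegrableOn α (Ioi 0))
    (hα : MemLp α 2 (volume.restrict (Ioi 0))) {g : ℂ → ℂ} {c : ℂ}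
    (hg : ∀ z : ℂ, ‖z‖ < 1 → g z = c + halfFourier (fun s => (α s : ℂ)) (rhoOf z)) :
    MemHardy2 g := by
  constructor
  · have h := (((differentiable_id.add_const (1 : ℂ)).differentiableOn).mul
      (differentiableOn_tsum_seriesTerm (norm_laguerreCoeff_le hα))).const_add c
    refine h.congr fun z hz => ?_
    rw [mem_ball_zero_iff] at hz
    rw [hg z hz, halfFourier_eq_tsum hα (rhoOf_im_pos hz), zOf_rhoOf hz]
    rfl
  -- The function is bounded on the whole disk by the `L¹` norm of `α` plus `‖c‖`, which bounds
  -- every circular mean.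
  · set M := ‖c‖ + ∫ s in Ioi (0 : ℝ), ‖(α s : ℂ)‖
    refine ⟨M ^ 2 * |2 * Real.pi - 0|, fun r hr0 hr1 => ?_⟩
    refine (le_abs_self _).trans ?_
    rw [← Real.norm_eq_abs]
    refine intervalIntegral.norm_integral_le_of_norm_le_const fun θ _ => ?_
    have hz : ‖circleMap 0 r θ‖ < 1 := by
      rw [norm_circleMap_zero, abs_of_nonneg hr0]; exact hr1
    rw [norm_pow, norm_norm, hg _ hz]
    refine pow_le_pow_left₀ (norm_nonneg _) ((norm_add_le _ _).trans ?_) 2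
    exact add_le_add_right (norm_halfFourier_le hα1.ofReal (rhoOf_im_pos hz).le) _

/-! ### Uniqueness of the Jost solutions -/

lemma hasDerivAt_exp_neg_mul {n : ℝ → ℂ} {v : ℂ} {x : ℝ} (ρ : ℂ) (h : HasDerivAt n v x) :
    HasDerivAt (fun x : ℝ => exp (-(I * ρ * x)) * n x) (exp (-(I * ρ * x)) * (v - I * ρ * n x))
      x := by
  have h1 : HasDerivAt (fun x : ℝ => -(I * ρ * x)) (-(I * ρ)) x :=
    (((Complex.ofRealCLM.hasDerivAt (x := x)).const_mul (I * ρ)).neg).congr_deriv (by simp)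
  exact (h1.cexp.mul h).congr_deriv (by ring)

lemma hasDerivAt_norm_sq {u : ℝ → ℂ} {v : ℂ} {x : ℝ} (h : HasDerivAt u v x) :
    HasDerivAt (fun x => ‖u x‖ ^ 2) (2 * ((u x).re * v.re + (u x).im * v.im)) x := by
  refine h.norm_sq.congr_deriv ?_
  rw [Complex.inner]
  simp
  ring

section ZSSolution

variable {q : ℝ → ℝ} {ρ : ℂ} {n₁ n₂ : ℝ → ℂ}

lemma IsZSSolution.hasDerivAt_fst (h : IsZSSolution q ρ n₁ n₂) (x : ℝ) :
    HasDerivAt (fun x : ℝ => exp (-(I * ρ * x)) * n₁ x)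
      (-(2 * I * ρ * (exp (-(I * ρ * x)) * n₁ x)) + q x * (exp (-(I * ρ * x)) * n₂ x)) x := by
  exact (hasDerivAt_exp_neg_mul ρ (h x).1).congr_deriv (by ring)

lemma IsZSSolution.hasDerivAt_snd (h : IsZSSolution q ρ n₁ n₂) (x : ℝ) :
    HasDerivAt (fun x : ℝ => exp (-(I * ρ * x)) * n₂ x)
      (-(q x * (exp (-(I * ρ * x)) * n₁ x))) x := by
  exact (hasDerivAt_exp_neg_mul ρ (h x).2).congr_deriv (by ring)

/-- The coupling is skew-symmetric because `q` is real, so it cancels from the energy; only the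
diagonal coefficient `-2iρ`, with real part `2 Im ρ`, contributes. -/
lemma IsZSSolution.hasDerivAt_energy (h : IsZSSolution q ρ n₁ n₂) (x : ℝ) :
    HasDerivAt (fun x : ℝ => ‖exp (-(I * ρ * x)) * n₁ x‖ ^ 2 + ‖exp (-(I * ρ * x)) * n₂ x‖ ^ 2)
      (4 * ρ.im * ‖exp (-(I * ρ * x)) * n₁ x‖ ^ 2) x := by
  refine ((hasDerivAt_norm_sq (h.hasDerivAt_fst x)).add
    (hasDerivAt_norm_sq (h.hasDerivAt_snd x))).congr_deriv ?_
  rw [Complex.sq_norm, Complex.normSq_apply]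
  generalize exp (-(I * ρ * x)) * n₁ x = u
  generalize exp (-(I * ρ * x)) * n₂ x = v
  simp
  ring

lemma IsZSSolution.monotone_energy (h : IsZSSolution q ρ n₁ n₂) (hρ : 0 ≤ ρ.im) :
    Monotone fun x : ℝ =>
      ‖exp (-(I * ρ * x)) * n₁ x‖ ^ 2 + ‖exp (-(I * ρ * x)) * n₂ x‖ ^ 2 :=
  monotone_of_hasDerivAt_nonneg h.hasDerivAt_energy fun x => by
    simp only [Pi.zero_apply]; positivity

lemma eq_zero_of_energy_nonpos {x : ℝ}
    (h : ‖exp (-(I * ρ * x)) * n₁ x‖ ^ 2 + ‖exp (-(I * ρ * x)) * n₂ x‖ ^ 2 ≤ 0) :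
    n₁ x = 0 ∧ n₂ x = 0 := by
  have h1 : ‖exp (-(I * ρ * x)) * n₁ x‖ ^ 2 = 0 := by
    nlinarith [sq_nonneg ‖exp (-(I * ρ * x)) * n₁ x‖, sq_nonneg ‖exp (-(I * ρ * x)) * n₂ x‖]
  have h2 : ‖exp (-(I * ρ * x)) * n₂ x‖ ^ 2 = 0 := by
    nlinarith [sq_nonneg ‖exp (-(I * ρ * x)) * n₁ x‖, sq_nonneg ‖exp (-(I * ρ * x)) * n₂ x‖]
  simpa [Complex.exp_ne_zero] using And.intro h1 h2

/-- The energy is nonnegative and nondecreasing, so a zero limit at `+∞` forces it to vanish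
everywhere. -/
lemma IsZSSolution.eq_zero_of_tendsto (h : IsZSSolution q ρ n₁ n₂) (hρ : 0 ≤ ρ.im)
    (h₁ : Tendsto (fun x : ℝ => exp (-(I * ρ * x)) * n₁ x) atTop (𝓝 0))
    (h₂ : Tendsto (fun x : ℝ => exp (-(I * ρ * x)) * n₂ x) atTop (𝓝 0)) (x : ℝ) :
    n₁ x = 0 ∧ n₂ x = 0 := by
  have h3 := (h₁.norm.pow 2).add (h₂.norm.pow 2)
  simp only [norm_zero, ne_eq, OfNat.ofNat_ne_zero, not_false_eq_true, zero_pow, add_zero] at h3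
  exact eq_zero_of_energy_nonpos ((h.monotone_energy hρ).ge_of_tendsto h3 x)

lemma IsZSSolution.sub {m₁ m₂ : ℝ → ℂ} (h : IsZSSolution q ρ n₁ n₂)
    (h' : IsZSSolution q ρ m₁ m₂) :
    IsZSSolution q ρ (fun x => n₁ x - m₁ x) (fun x => n₂ x - m₂ x) := fun x => by
  constructor
  · exact ((h x).1.sub (h' x).1).congr_deriv (by ring)
  · exact ((h x).2.sub (h' x).2).congr_deriv (by ring)

lemma hasDerivAt_conj {n : ℝ → ℂ} {v : ℂ} {x : ℝ} (h : HasDerivAt n v x) :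
    HasDerivAt (fun x => (starRingEnd ℂ) (n x)) ((starRingEnd ℂ) v) x :=
  Complex.conjCLE.toContinuousLinearMap.hasFDerivAt.comp_hasDerivAt x h

/-- The conjugate of `iρ` is `i(-ρ̄)`, and `q` is real. The map `ρ ↦ -ρ̄` preserves the upper
half-plane, so uniqueness of the Jost solution turns this into a symmetry of `ψ`. -/
lemma IsZSSolution.conj (h : IsZSSolution q ρ n₁ n₂) :
    IsZSSolution q (-(starRingEnd ℂ) ρ) (fun x => (starRingEnd ℂ) (n₁ x))
      (fun x => (starRingEnd ℂ) (n₂ x)) := fun x => by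
  constructor
  · exact (hasDerivAt_conj (h x).1).congr_deriv (by simp)
  · exact (hasDerivAt_conj (h x).2).congr_deriv (by simp)

/-- The right Jost solution of the Zakharov-Shabat system is unique. -/
lemma IsZSJostRight.unique {m₁ m₂ : ℝ → ℂ} (hρ : 0 ≤ ρ.im) (h : IsZSJostRight q ρ n₁ n₂)
    (h' : IsZSJostRight q ρ m₁ m₂) (x : ℝ) : n₁ x = m₁ x ∧ n₂ x = m₂ x := by
  have h1 := h.2.1.sub h'.2.1
  have h2 := h.2.2.sub h'.2.2
  simp only [← mul_sub, sub_self] at h1 h2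
  have := (h.1.sub h'.1).eq_zero_of_tendsto hρ h1 h2 x
  exact ⟨sub_eq_zero.1 this.1, sub_eq_zero.1 this.2⟩

lemma IsZSJostRight.conj (h : IsZSJostRight q ρ n₁ n₂) :
    IsZSJostRight q (-(starRingEnd ℂ) ρ) (fun x => (starRingEnd ℂ) (n₁ x))
      (fun x => (starRingEnd ℂ) (n₂ x)) := by
  have hc : ∀ {n : ℝ → ℂ} {l : ℂ}, Tendsto (fun x : ℝ => exp (-(I * ρ * x)) * n x) atTop (𝓝 l) →
      Tendsto (fun x : ℝ => exp (-(I * (-(starRingEnd ℂ) ρ) * x)) * (starRingEnd ℂ) (n x)) atTop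
        (𝓝 ((starRingEnd ℂ) l)) := fun {n l} hn => by
    refine ((Complex.continuous_conj.tendsto l).comp hn).congr fun x => ?_
    rw [Function.comp_apply, map_mul, ← Complex.exp_conj]
    simp
  refine ⟨h.1.conj, ?_, ?_⟩
  · simpa using hc h.2.1
  · simpa using hc h.2.2

/-- If `Im ρ > 0`, the component `n₂ - i n₁` alone detects the zero solution at `+∞`. -/
lemma IsZSSolution.eq_zero_of_tendsto_sub (h : IsZSSolution q ρ n₁ n₂) (hρ : 0 < ρ.im)
    (hqc : Continuous q) (hqi : ∀ a, IntegrableOn q (Ioi a))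
    (h₀ : Tendsto (fun x : ℝ => exp (-(I * ρ * x)) * (n₂ x - I * n₁ x)) atTop (𝓝 0)) (x : ℝ) :
    n₁ x = 0 ∧ n₂ x = 0 := by
  obtain ⟨u, hu⟩ : ∃ u : ℝ → ℂ, ∀ x : ℝ, exp (-(I * ρ * x)) * n₁ x = u x := ⟨_, fun _ => rfl⟩
  obtain ⟨v, hv⟩ : ∃ v : ℝ → ℂ, ∀ x : ℝ, exp (-(I * ρ * x)) * n₂ x = v x := ⟨_, fun _ => rfl⟩
  have hr0 : Tendsto (fun x => ‖v x - I * u x‖) atTop (𝓝 0) := by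
    rw [← norm_zero (E := ℂ)]
    refine (h₀.congr fun x => ?_).norm
    rw [← hu, ← hv]; ring
  have hE := h.hasDerivAt_energy
  have hmono := h.monotone_energy hρ.le
  have hdv := h.hasDerivAt_snd
  refine eq_zero_of_energy_nonpos ?_ (ρ := ρ)
  simp only [hu, hv] at hE hmono hdv ⊢
  by_contra! hpos
  set E₀ := ‖u x‖ ^ 2 + ‖v x‖ ^ 2 with hE₀
  -- With `r = v - iu`, the bound 1 serves the Grönwall estimate for `v`; the two bounds together
  -- give `|r|² ≤ E₀/4`, so that `|u|²` keeps a fixed share of the energy.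
  have hlim : ∀ᶠ y in atTop, ‖v y - I * u y‖ < min 1 (E₀ / 4) :=
    hr0.eventually_lt_const (by positivity)
  obtain ⟨a, ha⟩ := (hlim.and (eventually_ge_atTop x)).exists_forall_of_atTop
  -- `v` stays bounded
  set T : ℝ → ℝ := fun y => ∫ t in a..y, |q t| with hT
  have hTd : ∀ y, HasDerivAt T |q y| y := fun y =>
    (hqc.abs).integral_hasStrictDerivAt a y |>.hasDerivAt
  have hTle : ∀ y, a ≤ y → T y ≤ ∫ t in Ioi a, |q t| := fun y hy => by
    rw [hT]
    simp only
    rw [intervalIntegral.integral_of_le hy]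
    exact setIntegral_mono_set (hqi a).abs (Eventually.of_forall fun t => abs_nonneg _)
      (Eventually.of_forall fun t ht => ht.1)
  have hGd : ∀ y, HasDerivAt (fun y => (1 + ‖v y‖ ^ 2) * Real.exp (-T y))
      (2 * ((v y).re * (-(q y * u y)).re + (v y).im * (-(q y * u y)).im) * Real.exp (-T y) +
        (1 + ‖v y‖ ^ 2) * (Real.exp (-T y) * -|q y|)) y := fun y =>
    ((hasDerivAt_norm_sq (hdv y)).const_add 1).mul (hTd y).neg.exp
  have hanti : AntitoneOn (fun y => (1 + ‖v y‖ ^ 2) * Real.exp (-T y)) (Ici a) := by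
    refine antitoneOn_of_hasDerivWithinAt_nonpos (convex_Ici a)
      (fun y _ => (hGd y).continuousAt.continuousWithinAt) (fun y _ => (hGd y).hasDerivWithinAt)
      fun y hy => ?_
    rw [interior_Ici] at hy
    have hr := ((ha y (le_of_lt hy)).1.trans_le (min_le_left _ _)).le
    -- Substituting `u = -i(v - r)` gives `v' = iq(v - r)`. The term `iqv` does not change `|v|²`
    -- since `q` is real, and what is left is at most `2|q||r||v| ≤ |q|(1 + |v|²)`.
    have hkey : 2 * ((v y).re * (-(q y * u y)).re + (v y).im * (-(q y * u y)).im) ≤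
        |q y| * (1 + ‖v y‖ ^ 2) := by
      set r := v y - I * u y with hr_def
      have hur : u y = -I * (v y - r) := by
        rw [hr_def]; linear_combination (u y) * I_mul_I
      have h1 : 2 * ((v y).re * (-(q y * u y)).re + (v y).im * (-(q y * u y)).im) =
          2 * (q y * (r.im * (v y).re - r.re * (v y).im)) := by
        rw [hur]; simp; ring
      have h2 : |r.im * (v y).re - r.re * (v y).im| ≤ ‖v y‖ := by
        have h3 : r.im * (v y).re - r.re * (v y).im = (r * (starRingEnd ℂ) (v y)).im := by
          simp; ring
        rw [h3]
        refine (Complex.abs_im_le_norm _).trans ?_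
        rw [norm_mul, RCLike.norm_conj]
        exact mul_le_of_le_one_left (norm_nonneg _) hr
      have h4 : q y * (r.im * (v y).re - r.re * (v y).im) ≤ |q y| * ‖v y‖ := by
        refine (le_abs_self _).trans ?_
        rw [abs_mul]
        exact mul_le_mul_of_nonneg_left h2 (abs_nonneg _)
      rw [h1]
      nlinarith [mul_nonneg (abs_nonneg (q y)) (sq_nonneg (1 - ‖v y‖))]
    have := Real.exp_pos (-T y)
    nlinarith
  set M := (1 + ‖v a‖ ^ 2) * Real.exp (∫ t in Ioi a, |q t|) with hM
  have hvM : ∀ y, a ≤ y → 1 + ‖v y‖ ^ 2 ≤ M := fun y hy => by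
    have h1 := hanti self_mem_Ici hy hy
    simp only [hT, intervalIntegral.integral_same, neg_zero, Real.exp_zero, mul_one] at h1
    rw [Real.exp_neg, ← div_eq_mul_inv, div_le_iff₀ (Real.exp_pos _)] at h1
    refine h1.trans (mul_le_mul_of_nonneg_left (Real.exp_le_exp.2 (hTle y hy)) (by positivity))
  have hur : ∀ y, ‖u y‖ ≤ ‖v y‖ + ‖v y - I * u y‖ := fun y => by
    have h1 : I * u y = v y - (v y - I * u y) := by ring
    have h2 : ‖u y‖ = ‖I * u y‖ := by simp
    rw [h2, h1]
    exact (norm_sub_le _ _).trans (by simp)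
  have hvr : ∀ y, ‖v y‖ ≤ ‖u y‖ + ‖v y - I * u y‖ := fun y => by
    have h1 : v y = I * u y + (v y - I * u y) := by ring
    have h2 : ‖u y‖ = ‖I * u y‖ := by simp
    rw [h2]
    nth_rewrite 1 [h1]
    exact norm_add_le _ _
  have hbd : ∀ y, a ≤ y → ‖u y‖ ^ 2 + ‖v y‖ ^ 2 ≤ 3 * M := fun y hy => by
    have h1 := hur y
    have h2 := ((ha y hy).1.trans_le (min_le_left _ _)).le
    have h3 := hvM y hy
    have h4 : ‖u y‖ ^ 2 ≤ (‖v y‖ + 1) ^ 2 :=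
      pow_le_pow_left₀ (norm_nonneg _) (by linarith) 2
    nlinarith [sq_nonneg (‖v y‖ - 1)]
  -- while the energy grows linearly
  have hgrow : MonotoneOn (fun y => ‖u y‖ ^ 2 + ‖v y‖ ^ 2 - ρ.im * E₀ / 3 * y) (Ici a) := by
    have hd : ∀ y, HasDerivAt (fun y => ‖u y‖ ^ 2 + ‖v y‖ ^ 2 - ρ.im * E₀ / 3 * y)
        (4 * ρ.im * ‖u y‖ ^ 2 - ρ.im * E₀ / 3) y := fun y =>
      ((hE y).sub ((hasDerivAt_id y).const_mul (ρ.im * E₀ / 3))).congr_deriv (by simp)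
    refine monotoneOn_of_hasDerivWithinAt_nonneg (convex_Ici a)
      (fun y _ => (hd y).continuousAt.continuousWithinAt) (fun y _ => (hd y).hasDerivWithinAt)
      fun y hy => ?_
    rw [interior_Ici] at hy
    have h1 := ha y (le_of_lt hy)
    have h2 := hmono h1.2
    simp only at h2
    have h3 := h1.1.trans_le (min_le_left _ _)
    have h4 := h1.1.trans_le (min_le_right _ _)
    have h5 : ‖v y‖ ^ 2 ≤ (‖u y‖ + ‖v y - I * u y‖) ^ 2 :=
      pow_le_pow_left₀ (norm_nonneg _) (hvr y) 2
    have h6 : ‖v y - I * u y‖ ^ 2 ≤ E₀ / 4 := by nlinarith [norm_nonneg (v y - I * u y)]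
    -- From `E₀ ≤ |u|² + |v|²` and `|v|² ≤ 2|u|² + 2|r|²`, with room to spare. The energy therefore
    -- grows at rate at least `4 Im ρ · E₀/12`.
    have h7 : E₀ / 12 ≤ ‖u y‖ ^ 2 := by
      nlinarith [sq_nonneg (‖u y‖ - ‖v y - I * u y‖)]
    nlinarith
  have hc : 0 < ρ.im * E₀ / 3 := by positivity
  -- Far enough out for the linear growth to contribute `3M + 1`, beyond the bound `3M` on the
  -- energy.
  set y := a + (3 * M + 1) / (ρ.im * E₀ / 3) with hy
  have hMpos : 0 < M := by positivity
  have hay : a ≤ y := by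
    rw [hy]; exact le_add_of_nonneg_right (by positivity)
  have h1 := hgrow self_mem_Ici hay hay
  simp only at h1
  have h2 := hbd y hay
  have h3 : ρ.im * E₀ / 3 * y = ρ.im * E₀ / 3 * a + (3 * M + 1) := by
    rw [hy, mul_add, mul_div_cancel₀ _ hc.ne']
  nlinarith [sq_nonneg ‖u a‖, sq_nonneg ‖v a‖]

end ZSSolution

/-! ### Zakharov-Shabat and Schrödinger -/

lemma continuous_of_absolutelyContinuous {q : ℝ → ℝ}
    (hq : ∀ a b : ℝ, AbsolutelyContinuousOnInterval q a b) : Continuous q := by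
  refine continuous_iff_continuousAt.2 fun x => ?_
  refine (hq (x - 1) (x + 1)).continuousOn.continuousAt ?_
  rw [uIcc_of_le (by linarith)]
  exact Icc_mem_nhds (by linarith) (by linarith)

lemma hasDerivAt_of_sub_eq_integral {f g : ℝ → ℂ} (hg : Continuous g)
    (h : ∀ a b : ℝ, f b - f a = ∫ t in a..b, g t) (x : ℝ) : HasDerivAt f (g x) x := by
  have h1 : f = fun y => f 0 + ∫ t in (0 : ℝ)..y, g t := by
    ext y; rw [← h 0 y]; ring
  rw [h1]
  exact (hg.integral_hasStrictDerivAt 0 x).hasDerivAt.const_add _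

lemma continuous_of_hasDerivAt {y y' : ℝ → ℂ} (h : ∀ x, HasDerivAt y (y' x) x) : Continuous y :=
  continuous_iff_continuousAt.2 fun x => (h x).continuousAt

lemma integral_deriv_mul_add_real {q u u' : ℝ → ℝ} {a b : ℝ}
    (hq : AbsolutelyContinuousOnInterval q a b) (hu : ∀ x, HasDerivAt u (u' x) x)
    (hu' : Continuous u') :
    ∫ t in a..b, (deriv q t * u t + q t * u' t) = q b * u b - q a * u a := by
  have hderiv : deriv u = u' := funext fun x => (hu x).deriv
  have hcd : ContDiff ℝ 1 u :=
    contDiff_one_iff_deriv.2 ⟨fun x => (hu x).differentiableAt, hderiv ▸ hu'⟩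
  rw [← hq.integral_deriv_mul_eq_sub hcd.contDiffOn.absolutelyContinuousOnInterval, hderiv]

lemma intervalIntegrable_deriv_mul {q : ℝ → ℝ} {y : ℝ → ℂ} {a b : ℝ}
    (hq : AbsolutelyContinuousOnInterval q a b) (hy : Continuous y) :
    IntervalIntegrable (fun t => ((deriv q t : ℝ) : ℂ) * y t) volume a b :=
  IntervalIntegrable.mul_continuousOn (f := fun t => ((deriv q t : ℝ) : ℂ))
    ⟨hq.intervalIntegrable_deriv.1.ofReal, hq.intervalIntegrable_deriv.2.ofReal⟩ hy.continuousOn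

/-- The product rule for `qy` in integrated form, needed because `q` is only absolutely continuous;
real and imaginary parts of `y` reduce it to the real case. -/
lemma integral_deriv_mul_add {q : ℝ → ℝ} {y y' : ℝ → ℂ} {a b : ℝ}
    (hq : AbsolutelyContinuousOnInterval q a b) (hqc : Continuous q)
    (hy : ∀ x, HasDerivAt y (y' x) x) (hy' : Continuous y') :
    ∫ t in a..b, (((deriv q t : ℝ) : ℂ) * y t + q t * y' t) = q b * y b - q a * y a := by
  have hint : IntervalIntegrable (fun t => ((deriv q t : ℝ) : ℂ) * y t + q t * y' t) volume a b :=
    (intervalIntegrable_deriv_mul hq (continuous_of_hasDerivAt hy)).add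
      (Continuous.intervalIntegrable (by fun_prop) a b)
  have hre : ∀ x, HasDerivAt (fun x => (y x).re) (y' x).re x := fun x =>
    Complex.reCLM.hasFDerivAt.comp_hasDerivAt x (hy x)
  have him : ∀ x, HasDerivAt (fun x => (y x).im) (y' x).im x := fun x =>
    Complex.imCLM.hasFDerivAt.comp_hasDerivAt x (hy x)
  refine Complex.ext ?_ ?_
  · have h := Complex.reCLM.intervalIntegral_comp_comm hint
    simp only [Complex.reCLM_apply] at h
    rw [← h]
    simpa using integral_deriv_mul_add_real hq hre (Complex.continuous_re.comp hy')
  · have h := Complex.imCLM.intervalIntegral_comp_comm hint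
    simp only [Complex.imCLM_apply] at h
    rw [← h]
    simpa using integral_deriv_mul_add_real hq him (Complex.continuous_im.comp hy')

/-- A solution of the Schrödinger equation with potential `-iq' - q²` yields a solution of the
Zakharov-Shabat system. -/
lemma IsSchrodingerSolution.exists_isZSSolution {q : ℝ → ℝ}
    (hq : ∀ a b : ℝ, AbsolutelyContinuousOnInterval q a b) {ρ : ℂ} (hρ : ρ ≠ 0) {y : ℝ → ℂ}
    (h : IsSchrodingerSolution (schrodingerPotential q) ρ y) :
    ∃ n₁ n₂ : ℝ → ℂ, IsZSSolution q ρ n₁ n₂ ∧ ∀ x, n₂ x - I * n₁ x = y x := by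
  obtain ⟨y', hy, hint⟩ := h
  have hqc := continuous_of_absolutelyContinuous hq
  have hyc := continuous_of_hasDerivAt hy
  have hy'c : Continuous y' := by
    have h1 : y' = fun x => y' 0 + ∫ t in (0 : ℝ)..x, (schrodingerPotential q t - ρ ^ 2) * y t := by
      ext x; rw [← (hint 0 x).2]; ring
    rw [h1]
    exact continuous_const.add
      (intervalIntegral.continuous_primitive (fun a b => (hint a b).1) 0)
  have hIρ : I * ρ ≠ 0 := mul_ne_zero I_ne_zero hρ
  -- `f` is to be `n₂ + i n₁`. The system would give `y' = iρf - iqy`, and solving for `f` is where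
  -- `ρ ≠ 0` enters.
  obtain ⟨f, hf⟩ : ∃ f : ℝ → ℂ, ∀ x, f x = (y' x + I * q x * y x) / (I * ρ) := ⟨_, fun _ => rfl⟩
  have hf' : ∀ x, y' x = I * ρ * f x - I * q x * y x := fun x => by
    rw [hf, mul_div_cancel₀ _ hIρ]; ring
  have hfc : Continuous f := by
    rw [show f = fun x => (y' x + I * q x * y x) / (I * ρ) from funext hf]
    fun_prop
  -- The term `-iq'y` from the potential cancels against `iq'y` from the product rule, so `f` is the
  -- primitive of a continuous function and differentiable everywhere.
  have hfd : ∀ x, HasDerivAt f (I * ρ * y x + I * q x * f x) x := by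
    refine hasDerivAt_of_sub_eq_integral (by fun_prop) fun a b => ?_
    have h1 := (hint a b).2
    have h2 := integral_deriv_mul_add (hq a b) hqc hy hy'c
    have h3 : f b - f a = (∫ t in a..b, (schrodingerPotential q t - ρ ^ 2) * y t +
        I * (((deriv q t : ℝ) : ℂ) * y t + q t * y' t)) / (I * ρ) := by
      rw [intervalIntegral.integral_add (hint a b).1, intervalIntegral.integral_const_mul, ← h1, h2,
        hf, hf]
      · ring
      · exact ((intervalIntegrable_deriv_mul (hq a b) hyc).add
          (Continuous.intervalIntegrable (by fun_prop) a b)).const_mul I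
    rw [h3, div_eq_iff hIρ, ← intervalIntegral.integral_mul_const]
    refine intervalIntegral.integral_congr fun t _ => ?_
    simp only [hf', schrodingerPotential]
    linear_combination (-(q t ^ 2 * y t) - ρ ^ 2 * y t) * I_mul_I
  refine ⟨fun x => I / 2 * (y x - f x), fun x => (y x + f x) / 2, fun x => ⟨?_, ?_⟩, fun x => ?_⟩
  · refine (((hy x).sub (hfd x)).const_mul (I / 2)).congr_deriv ?_
    rw [hf']
    linear_combination (-(q x * (y x + f x)) / 2) * I_mul_I
  · refine (((hy x).add (hfd x)).div_const 2).congr_deriv ?_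
    rw [hf']
    ring
  · linear_combination (-(y x - f x) / 2) * I_mul_I

/-- A solution of the Zakharov-Shabat system yields a solution of the Schrödinger equation with
potential `-iq' - q²`. -/
lemma IsZSSolution.isSchrodingerSolution {q : ℝ → ℝ}
    (hq : ∀ a b : ℝ, AbsolutelyContinuousOnInterval q a b) {ρ : ℂ} {n₁ n₂ : ℝ → ℂ}
    (h : IsZSSolution q ρ n₁ n₂) :
    IsSchrodingerSolution (schrodingerPotential q) ρ (fun x => n₂ x - I * n₁ x) := by
  have hqc := continuous_of_absolutelyContinuous hq
  have hn₁ : Continuous n₁ := continuous_of_hasDerivAt fun x => (h x).1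
  have hn₂ : Continuous n₂ := continuous_of_hasDerivAt fun x => (h x).2
  set y : ℝ → ℂ := fun x => n₂ x - I * n₁ x with hy
  set f : ℝ → ℂ := fun x => n₂ x + I * n₁ x with hf
  have hyc : Continuous y := by fun_prop
  have hfc : Continuous f := by fun_prop
  have hyd : ∀ x, HasDerivAt y (I * ρ * f x - I * q x * y x) x := fun x => by
    refine ((h x).2.sub ((h x).1.const_mul I)).congr_deriv ?_
    simp only [hy, hf]
    linear_combination (-q x * n₁ x) * I_mul_I
  have hfd : ∀ x, HasDerivAt f (I * ρ * y x + I * q x * f x) x := fun x => by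
    refine ((h x).2.add ((h x).1.const_mul I)).congr_deriv ?_
    simp only [hy, hf]
    linear_combination (-q x * n₁ x) * I_mul_I
  -- The right-hand side is `iρf' - i(qy)'`, whose integral is the increment of `y' = iρf - iqy`.
  have hpot : ∀ t, (schrodingerPotential q t - ρ ^ 2) * y t =
      I * ρ * (I * ρ * y t + I * q t * f t) - I * (((deriv q t : ℝ) : ℂ) * y t +
        q t * (I * ρ * f t - I * q t * y t)) := fun t => by
    simp only [schrodingerPotential]
    linear_combination (-(q t ^ 2 * y t) - ρ ^ 2 * y t) * I_mul_I
  refine ⟨_, hyd, fun a b => ?_⟩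
  have h1 : IntervalIntegrable (fun t => I * ρ * (I * ρ * y t + I * q t * f t)) volume a b :=
    Continuous.intervalIntegrable (by fun_prop) a b
  have h2 : IntervalIntegrable (fun t => I * (((deriv q t : ℝ) : ℂ) * y t +
        q t * (I * ρ * f t - I * q t * y t))) volume a b :=
    ((intervalIntegrable_deriv_mul (hq a b) hyc).add
      (Continuous.intervalIntegrable (by fun_prop) a b)).const_mul I
  simp only [hpot]
  refine ⟨h1.sub h2, ?_⟩
  rw [intervalIntegral.integral_sub h1 h2, intervalIntegral.integral_const_mul,
    intervalIntegral.integral_const_mul, integral_deriv_mul_add (hq a b) hqc hyd (by fun_prop),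
    intervalIntegral.integral_eq_sub_of_hasDerivAt (fun x _ => hfd x)
      (Continuous.intervalIntegrable (by fun_prop) a b)]
  ring

/-! ### Half-line transforms under translation and conjugation, and separation of components. -/

lemma setIntegral_Ioi_eq_shift {E : Type*} [NormedAddCommGroup E] [NormedSpace ℝ E] (F : ℝ → E)
    (x : ℝ) : ∫ t in Ioi x, F t = ∫ s in Ioi (0 : ℝ), F (x + s) := by
  rw [← integral_indicator measurableSet_Ioi, ← integral_indicator measurableSet_Ioi,
    ← integral_add_left_eq_self _ x]
  refine integral_congr_ae (Eventually.of_forall fun s => ?_)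
  simp [indicator, mem_Ioi]

lemma setIntegral_mul_exp_eq_halfFourier (A : ℝ → ℂ) (x : ℝ) (ρ : ℂ) :
    ∫ t in Ioi x, A t * exp (I * ρ * t) =
      exp (I * ρ * x) * halfFourier (fun s => A (x + s)) ρ := by
  rw [setIntegral_Ioi_eq_shift, halfFourier, ← integral_const_mul]
  refine integral_congr_ae (Eventually.of_forall fun s => ?_)
  simp only
  rw [show I * ρ * ((x + s : ℝ) : ℂ) = I * ρ * x + I * ρ * s by push_cast; ring, Complex.exp_add]
  ring

lemma conj_halfFourier (α : ℝ → ℂ) (ρ : ℂ) :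
    (starRingEnd ℂ) (halfFourier α (-(starRingEnd ℂ) ρ)) =
      halfFourier (fun s => (starRingEnd ℂ) (α s)) ρ := by
  rw [halfFourier, ← integral_conj, halfFourier]
  refine integral_congr_ae (Eventually.of_forall fun s => ?_)
  simp [← Complex.exp_conj]

lemma halfFourier_add {α β : ℝ → ℂ} (hα : IntegrableOn α (Ioi 0)) (hβ : IntegrableOn β (Ioi 0))
    {ρ : ℂ} (hρ : 0 ≤ ρ.im) :
    halfFourier (fun s => α s + β s) ρ = halfFourier α ρ + halfFourier β ρ := by
  simp only [halfFourier, add_mul]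
  exact integral_add (integrableOn_mul_exp hα hρ) (integrableOn_mul_exp hβ hρ)

lemma halfFourier_const_mul (c : ℂ) (α : ℝ → ℂ) (ρ : ℂ) :
    halfFourier (fun s => c * α s) ρ = c * halfFourier α ρ := by
  simp only [halfFourier, mul_assoc, integral_const_mul]

lemma halfFourier_re_add_im {α : ℝ → ℂ} (hα : IntegrableOn α (Ioi 0)) {ρ : ℂ} (hρ : 0 ≤ ρ.im) :
    halfFourier α ρ = halfFourier (fun s => ((α s).re : ℂ)) ρ +
      I * halfFourier (fun s => ((α s).im : ℂ)) ρ := by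
  rw [← halfFourier_const_mul, ← halfFourier_add (α := fun s => ((α s).re : ℂ))
    (β := fun s => I * ((α s).im : ℂ)) hα.re.ofReal (hα.im.ofReal.const_mul I) hρ]
  congr 1
  ext s
  rw [mul_comm, Complex.re_add_im]

lemma halfFourier_conj_re_sub_im {α : ℝ → ℂ} (hα : IntegrableOn α (Ioi 0)) {ρ : ℂ}
    (hρ : 0 ≤ ρ.im) :
    halfFourier (fun s => (starRingEnd ℂ) (α s)) ρ = halfFourier (fun s => ((α s).re : ℂ)) ρ -
      I * halfFourier (fun s => ((α s).im : ℂ)) ρ := by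
  rw [sub_eq_add_neg, ← neg_mul, ← halfFourier_const_mul,
    ← halfFourier_add (α := fun s => ((α s).re : ℂ)) (β := fun s => -I * ((α s).im : ℂ))
      hα.re.ofReal (hα.im.ofReal.const_mul (-I)) hρ]
  congr 1
  ext s
  refine Complex.ext ?_ ?_ <;> simp

lemma integrableOn_comp_add_iff {E : Type*} [NormedAddCommGroup E] {f : ℝ → E} {x : ℝ} :
    IntegrableOn (fun s => f (x + s)) (Ioi 0) ↔ IntegrableOn f (Ioi x) := by
  have h1 := (measurePreserving_add_left volume x).integrableOn_comp_preimage
    (measurableEmbedding_addLeft x) (f := f) (s := Ioi x)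
  have h2 : (fun s => x + s) ⁻¹' Ioi x = Ioi 0 := by ext s; simp
  rwa [h2] at h1

/-- For `Im ρ > 0` any Levin kernel represents the right Jost solution of the Zakharov-Shabat
system. -/
lemma IsRightJostKernel.representation {q : ℝ → ℝ}
    (hq : ∀ a b : ℝ, AbsolutelyContinuousOnInterval q a b) (hqi : ∀ a, IntegrableOn q (Ioi a))
    {A : ℝ → ℝ → ℂ} (hA : IsRightJostKernel (schrodingerPotential q) A) {ψ₁ ψ₂ : ℂ → ℝ → ℂ}
    (hψ : ∀ ρ : ℂ, 0 ≤ ρ.im → IsZSJostRight q ρ (ψ₁ ρ) (ψ₂ ρ)) {ρ : ℂ} (hρ : 0 < ρ.im) (x : ℝ) :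
    ψ₁ ρ x = -exp (I * ρ * x) * (0 + halfFourier (fun s => ((A x (x + s)).im : ℂ)) ρ) ∧
    ψ₂ ρ x = exp (I * ρ * x) * (1 + halfFourier (fun s => ((A x (x + s)).re : ℂ)) ρ) := by
  have hqc := continuous_of_absolutelyContinuous hq
  obtain ⟨hAi, e, he⟩ := hA
  have hα := integrableOn_comp_add_iff.2 (hAi x).1
  -- The Jost function attached to the kernel is lifted to a solution of the system. Its difference
  -- from `ψ` has a negligible component `n₂ - i n₁`, hence vanishes. The claim is kept general in
  -- `ρ` because it is also used at `-ρ̄`.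
  have key : ∀ ρ : ℂ, 0 < ρ.im → ψ₂ ρ x - I * ψ₁ ρ x =
      exp (I * ρ * x) * (1 + halfFourier (fun s => A x (x + s)) ρ) := by
    intro ρ hρ
    obtain ⟨⟨hsol, hlim⟩, hrep⟩ := he ρ hρ.le
    have hψρ := hψ ρ hρ.le
    obtain ⟨n₁, n₂, hn, hny⟩ := hsol.exists_isZSSolution hq (fun h0 => by simp [h0] at hρ)
    have hlim' : Tendsto (fun x : ℝ => exp (-(I * ρ * x)) *
        ((n₂ x - ψ₂ ρ x) - I * (n₁ x - ψ₁ ρ x))) atTop (𝓝 0) := by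
      have h1 := hlim.sub (hψρ.2.2.sub (hψρ.2.1.const_mul I))
      simp only [mul_zero, sub_zero, sub_self] at h1
      refine h1.congr fun t => ?_
      rw [← hny]
      ring
    have h2 := (hn.sub hψρ.1).eq_zero_of_tendsto_sub hρ hqc hqi hlim' x
    rw [← sub_eq_zero.1 h2.1, ← sub_eq_zero.1 h2.2, hny, hrep, setIntegral_mul_exp_eq_halfFourier]
    ring
  -- Conjugating the identity at `-ρ̄` gives `ψ₂ + iψ₁` at `ρ` in terms of the conjugate kernel;
  -- half-sum and half-difference with the identity at `ρ` isolate the components.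
  have hρ' : 0 < (-(starRingEnd ℂ) ρ).im := by simpa using hρ
  have hconj := (hψ _ hρ.le).conj.unique hρ'.le (hψ _ hρ'.le) x
  have k1 := key ρ hρ
  have k2 := congrArg (starRingEnd ℂ) (key _ hρ')
  rw [← hconj.1, ← hconj.2] at k2
  simp only [map_sub, map_mul, map_add, map_one, Complex.conj_conj, conj_halfFourier,
    ← Complex.exp_conj, Complex.conj_I, map_neg, Complex.conj_ofReal] at k2
  rw [halfFourier_re_add_im hα hρ.le] at k1
  rw [halfFourier_conj_re_sub_im hα hρ.le] at k2
  ring_nf at k1 k2 ⊢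
  constructor
  · linear_combination (-1 / 2 : ℂ) * I * (k2 - k1) +
      (ψ₁ ρ x + exp (I * ρ * x) * halfFourier (fun s => ((A x (x + s)).im : ℂ)) ρ) * I_mul_I
  · linear_combination (1 / 2 : ℂ) * (k1 + k2)

/-! ### A decreasing integrable majorant of the potential -/

/-- `σ` is a positive decreasing continuous majorant of `|q|`, integrable near `+∞`. -/
structure IsMajorant (q σ : ℝ → ℝ) : Prop where
  continuous_left : Continuous q
  continuous_right : Continuous σ
  antitone : Antitone σ
  pos : ∀ x, 0 < σ x
  integrable : ∀ a, IntegrableOn σ (Ioi a)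
  le : ∀ x, |q x| ≤ σ x

/-- The tail integral `∫_x^∞ f`. -/
def tail {E : Type*} [NormedAddCommGroup E] [NormedSpace ℝ E] (f : ℝ → E) (x : ℝ) : E :=
  ∫ t in Ioi x, f t

section tail

lemma intervalIntegrable_of_forall_Ioi {E : Type*} [NormedAddCommGroup E] {f : ℝ → E}
    (hf : ∀ a, IntegrableOn f (Ioi a)) (a b : ℝ) :
    IntervalIntegrable f volume a b := by
  rw [intervalIntegrable_iff]
  exact (hf (min a b)).mono_set fun t ht => ht.1

variable {E : Type*} [NormedAddCommGroup E] [NormedSpace ℝ E] {f : ℝ → E}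

lemma tail_eq_sub (hf : ∀ a, IntegrableOn f (Ioi a)) (x : ℝ) :
    tail f x = tail f 0 - ∫ t in (0 : ℝ)..x, f t := by
  rw [eq_sub_iff_add_eq, add_comm]
  exact intervalIntegral.integral_interval_add_Ioi (hf 0) (hf x)

lemma hasDerivAt_tail [CompleteSpace E] (hf : ∀ a, IntegrableOn f (Ioi a)) (hc : Continuous f)
    (x : ℝ) :
    HasDerivAt (tail f) (-f x) x := by
  rw [show tail f = fun x => tail f 0 - ∫ t in (0 : ℝ)..x, f t from funext (tail_eq_sub hf)]
  exact (hc.integral_hasStrictDerivAt 0 x).hasDerivAt.const_sub _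

lemma continuous_tail (hf : ∀ a, IntegrableOn f (Ioi a)) : Continuous (tail f) := by
  rw [show tail f = fun x => tail f 0 - ∫ t in (0 : ℝ)..x, f t from funext (tail_eq_sub hf)]
  exact continuous_const.sub
    (intervalIntegral.continuous_primitive (intervalIntegrable_of_forall_Ioi hf) 0)

lemma tendsto_tail (hf : ∀ a, IntegrableOn f (Ioi a)) : Tendsto (tail f) atTop (𝓝 0) := by
  rw [show tail f = fun x => tail f 0 - ∫ t in (0 : ℝ)..x, f t from funext (tail_eq_sub hf)]
  rw [← sub_self (tail f 0)]
  exact (intervalIntegral_tendsto_integral_Ioi 0 (hf 0) tendsto_id).const_sub _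

end tail

lemma tail_nonneg {f : ℝ → ℝ} (hf : ∀ x, 0 ≤ f x) (x : ℝ) : 0 ≤ tail f x :=
  integral_nonneg hf

lemma antitone_tail {f : ℝ → ℝ} (hi : ∀ a, IntegrableOn f (Ioi a)) (hf : ∀ x, 0 ≤ f x) :
    Antitone (tail f) := fun x _ hxy =>
  setIntegral_mono_set (hi x) (Eventually.of_forall hf)
    (Eventually.of_forall fun _ ht => lt_of_le_of_lt hxy ht)

/-- The tail of a nonnegative function with a finite first moment is integrable. -/
lemma integrableOn_tail {f : ℝ → ℝ} (hf : ∀ x, 0 ≤ f x)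
    (hi : Integrable f) (hi' : Integrable fun x => |x| * f x) (a : ℝ) :
    IntegrableOn (tail f) (Ioi a) := by
  set μ := (volume : Measure ℝ).restrict (Ioi a) with hμ
  -- Tonelli: integrating in `x` first turns the double integral into `∫ max(t - a, 0) f(t) dt`,
  -- controlled by the first moment.
  set G : ℝ × ℝ → ℝ := fun p => {p : ℝ × ℝ | p.1 < p.2}.indicator (fun p => f p.2) p with hG
  have hset : MeasurableSet {p : ℝ × ℝ | p.1 < p.2} :=
    measurableSet_lt measurable_fst measurable_snd
  have hGm : AEStronglyMeasurable G (μ.prod μ) :=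
    (hi.1.restrict.comp_snd).indicator hset
  have hGeq : ∀ t, (fun x => G (x, t)) = (Iio t).indicator fun _ => f t := fun t => by
    ext x; simp [hG, indicator]
  have hμt : ∀ t, μ.real (Iio t) = max (t - a) 0 := fun t => by
    rw [hμ, measureReal_restrict_apply measurableSet_Iio, Iio_inter_Ioi, Real.volume_real_Ioo]
  have hμfin : ∀ t, μ (Iio t) ≠ ⊤ := fun t => by
    rw [hμ, Measure.restrict_apply measurableSet_Iio, Iio_inter_Ioi, Real.volume_Ioo]
    exact ENNReal.ofReal_ne_top
  have hint : Integrable G (μ.prod μ) := by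
    rw [integrable_prod_iff' hGm]
    constructor
    · refine Eventually.of_forall fun t => ?_
      rw [hGeq t, integrable_indicator_iff measurableSet_Iio]
      exact integrableOn_const (hs := hμfin t)
    · have h1 : ∀ t, ∫ x, ‖G (x, t)‖ ∂μ = max (t - a) 0 * f t := fun t => by
        have h2 : (fun x => ‖G (x, t)‖) = (Iio t).indicator fun _ => f t := by
          ext x
          rw [congrFun (hGeq t) x, norm_indicator_eq_indicator_norm, Real.norm_of_nonneg (hf t)]
        rw [h2, integral_indicator measurableSet_Iio, setIntegral_const, hμt, smul_eq_mul]
      simp only [h1]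
      refine Integrable.mono' ((hi'.add (hi.const_mul |a|)).restrict (s := Ioi a)) ?_ ?_
      · exact (Continuous.aestronglyMeasurable (by fun_prop)).mul hi.1.restrict
      · refine Eventually.of_forall fun t => ?_
        rw [norm_mul, Real.norm_of_nonneg (hf t), Real.norm_of_nonneg (le_max_right _ _)]
        simp only [Pi.add_apply]
        rw [← add_mul]
        refine mul_le_mul_of_nonneg_right (max_le ?_ (by positivity)) (hf t)
        linarith [le_abs_self t, neg_abs_le a]
  refine hint.integral_prod_left.congr ?_
  filter_upwards [ae_restrict_mem measurableSet_Ioi] with x hx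
  have h3 : (fun t => G (x, t)) = (Ioi x).indicator f := by
    ext t; simp [hG, indicator]
  rw [h3, integral_indicator measurableSet_Ioi, hμ, Measure.restrict_restrict measurableSet_Ioi,
    inter_eq_left.2 (Ioi_subset_Ioi (le_of_lt hx)), tail]

/-- Since `q'` is integrable and `q` is square integrable, `q` vanishes at `+∞`, so `|q(x)| ≤ ∫_x^∞
|q'|`. This tail decreases and is integrable near `+∞` by the first moment of `q'`. -/
lemma exists_isMajorant {q : ℝ → ℝ} (hq : ∀ a b : ℝ, AbsolutelyContinuousOnInterval q a b)
    (hq2 : MemL11 (fun x => ((q x ^ 2 : ℝ) : ℂ)))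
    (hq' : MemL11 (fun x => ((deriv q x : ℝ) : ℂ))) : ∃ σ, IsMajorant q σ := by
  have hqc := continuous_of_absolutelyContinuous hq
  have hnorm : ∀ (f : ℝ → ℝ) (x : ℝ), ‖((1 + |x| : ℝ) : ℂ) * (f x : ℂ)‖ = (1 + |x|) * |f x| :=
    fun f x => by
      rw [norm_mul, Complex.norm_real, Complex.norm_real, Real.norm_of_nonneg (by positivity),
        Real.norm_eq_abs]
  have h1 : Integrable fun x => (1 + |x|) * |deriv q x| := hq'.norm.congr
    (Eventually.of_forall fun x => hnorm _ x)
  have h2 : Integrable fun x => (1 + |x|) * |q x ^ 2| := hq2.norm.congr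
    (Eventually.of_forall fun x => hnorm (fun x => q x ^ 2) x)
  have hd : Integrable fun x => |deriv q x| := by
    refine h1.mono' (measurable_deriv q).abs.aestronglyMeasurable (Eventually.of_forall fun x => ?_)
    rw [Real.norm_of_nonneg (abs_nonneg _)]
    exact le_mul_of_one_le_left (abs_nonneg _) (by linarith [abs_nonneg x])
  have hd' : Integrable fun x => |x| * |deriv q x| := by
    refine h1.mono' (measurable_id.abs.mul (measurable_deriv q).abs).aestronglyMeasurable
      (Eventually.of_forall fun x => ?_)
    rw [Real.norm_of_nonneg (by positivity)]
    exact mul_le_mul_of_nonneg_right (by linarith) (abs_nonneg _)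
  have hqq : Integrable fun x => q x ^ 2 := by
    refine h2.mono' (by fun_prop) (Eventually.of_forall fun x => ?_)
    rw [Real.norm_eq_abs]
    exact le_mul_of_one_le_left (abs_nonneg _) (by linarith [abs_nonneg x])
  set f : ℝ → ℝ := fun x => |deriv q x| with hf
  have hf0 : ∀ x, 0 ≤ f x := fun x => abs_nonneg _
  have hfi : ∀ a, IntegrableOn f (Ioi a) := fun a => hd.integrableOn
  have hle : ∀ x, |q x| ≤ tail f x := by
    intro x
    -- An excess `ε` would keep `|q| ≥ ε` on all of `(x, ∞)`, against the integrability of `q²`.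
    by_contra! hlt
    set ε := |q x| - tail f x with hε
    have hε0 : 0 < ε := by linarith
    have hlow : ∀ b ∈ Ioi x, ε ≤ |q b| := fun b hb => by
      have h3 : |q b - q x| ≤ tail f x := by
        rw [← (hq x b).integral_deriv_eq_sub]
        refine (intervalIntegral.abs_integral_le_integral_abs (le_of_lt hb)).trans ?_
        rw [intervalIntegral.integral_of_le (le_of_lt hb)]
        exact setIntegral_mono_set (hfi x) (Eventually.of_forall hf0)
          (Eventually.of_forall fun t ht => ht.1)
      have h4 := abs_sub_abs_le_abs_sub (q x) (q b)
      rw [abs_sub_comm] at h4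
      linarith
    have hconst : IntegrableOn (fun _ : ℝ => ε ^ 2) (Ioi x) := by
      refine Integrable.mono' hqq.integrableOn aestronglyMeasurable_const ?_
      filter_upwards [ae_restrict_mem measurableSet_Ioi] with b hb
      rw [Real.norm_of_nonneg (by positivity), ← sq_abs (q b)]
      exact pow_le_pow_left₀ hε0.le (hlow b hb) 2
    rw [integrableOn_const_iff] at hconst
    rcases hconst with h | h
    · simp [hε0.ne'] at h
    · simp at h
  -- The term `e^{-x}` makes the majorant strictly positive, so that it may serve as a weight to
  -- divide by.
  refine ⟨fun x => tail f x + Real.exp (-x), hqc, (continuous_tail hfi).add (by fun_prop),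
    fun x y hxy => add_le_add (antitone_tail hfi hf0 hxy) (Real.exp_le_exp.2 (by linarith)),
    fun x => add_pos_of_nonneg_of_pos (tail_nonneg hf0 x) (Real.exp_pos _),
    fun a => (integrableOn_tail hf0 hd hd' a).add (integrableOn_exp_neg_Ioi a),
    fun x => (hle x).trans (le_add_of_nonneg_right (Real.exp_pos _).le)⟩

/-! ### The transformation kernels -/

open scoped BoundedContinuousFunction

namespace IsMajorant

variable {q σ : ℝ → ℝ}

lemma nonneg (h : IsMajorant q σ) (x : ℝ) : 0 ≤ σ x := (h.pos x).le

lemma tail_nonneg (h : IsMajorant q σ) (x : ℝ) : 0 ≤ tail σ x :=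
  ZakharovShabat.tail_nonneg h.nonneg x

lemma continuous_tail (h : IsMajorant q σ) : Continuous (tail σ) :=
  ZakharovShabat.continuous_tail h.integrable

lemma antitone_tail (h : IsMajorant q σ) : Antitone (tail σ) :=
  ZakharovShabat.antitone_tail h.integrable h.nonneg

/-- A primitive of `σ` times the weight `e^{2 ∫_x^∞ σ}`. -/
lemma hasDerivAt_exp_tail (h : IsMajorant q σ) (x : ℝ) :
    HasDerivAt (fun x => -(Real.exp (2 * tail σ x) / 2)) (σ x * Real.exp (2 * tail σ x)) x := by
  refine ((((hasDerivAt_tail h.integrable h.continuous_right x).const_mul 2).exp.div_const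
    2).neg).congr_deriv ?_
  ring

lemma tendsto_exp_tail (h : IsMajorant q σ) :
    Tendsto (fun x => -(Real.exp (2 * tail σ x) / 2)) atTop (𝓝 (-(1 / 2))) := by
  have h1 := (((Real.continuous_exp.tendsto _).comp
    ((tendsto_tail h.integrable).const_mul 2)).div_const 2).neg
  simpa [Function.comp_def] using h1

lemma integrableOn_mul_exp_tail (h : IsMajorant q σ) (x : ℝ) :
    IntegrableOn (fun t => σ t * Real.exp (2 * tail σ t)) (Ioi x) :=
  integrableOn_Ioi_deriv_of_nonneg' (fun t _ => h.hasDerivAt_exp_tail t)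
    (fun t _ => mul_nonneg (h.nonneg t) (Real.exp_pos _).le) h.tendsto_exp_tail

/-- The integrand is an exact derivative. The exponent 2 of the weight produces the factor `1/2`,
which becomes the contraction constant. -/
lemma integral_mul_exp_tail_le (h : IsMajorant q σ) (x : ℝ) :
    ∫ t in Ioi x, σ t * Real.exp (2 * tail σ t) ≤ Real.exp (2 * tail σ x) / 2 := by
  rw [integral_Ioi_of_hasDerivAt_of_nonneg' (fun t _ => h.hasDerivAt_exp_tail t)
    (fun t _ => mul_nonneg (h.nonneg t) (Real.exp_pos _).le) h.tendsto_exp_tail]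
  linarith

lemma integrableOn_shift_mul_exp_tail (h : IsMajorant q σ) (x : ℝ) :
    IntegrableOn (fun τ => σ (x + τ) * Real.exp (2 * tail σ (x + τ))) (Ioi 0) := by
  exact (integrableOn_comp_add_iff (f := fun t => σ t * Real.exp (2 * tail σ t))).2
    (h.integrableOn_mul_exp_tail x)

lemma integral_shift_mul_exp_tail_le (h : IsMajorant q σ) (x : ℝ) :
    ∫ τ in Ioi (0 : ℝ), σ (x + τ) * Real.exp (2 * tail σ (x + τ)) ≤
      Real.exp (2 * tail σ x) / 2 := by
  refine le_trans (le_of_eq ?_) (h.integral_mul_exp_tail_le x)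
  rw [setIntegral_Ioi_eq_shift _ x]

/-- The integrand of the first kernel equation. -/
def integrand₁ (q σ : ℝ → ℝ) (k : ℝ × ℝ → ℝ) (p : ℝ × ℝ) (τ : ℝ) : ℝ :=
  -- Here `K(x,s) = σ(x+s/2) e^{2 tail σ x} k(x,s)`. Along `(x+τ, s-2τ)` the argument of `σ` is
  -- constant, so that factor drops out. `max p.2 0` extends the equation to the whole plane, where
  -- a bounded continuous fixed point is sought.
  q (p.1 + τ) * Real.exp (2 * tail σ (p.1 + τ)) * k (p.1 + τ, max p.2 0 - 2 * τ)

/-- The integrand of the second kernel equation. -/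
def integrand₂ (q σ : ℝ → ℝ) (k : ℝ × ℝ → ℝ) (p : ℝ × ℝ) (τ : ℝ) : ℝ :=
  -- With `s` fixed the argument of `σ` does move, but only to the right; monotonicity gives
  -- `σ(x+τ+s/2) ≤ σ(x+s/2)`.
  q (p.1 + τ) * Real.exp (2 * tail σ (p.1 + τ)) *
    (σ (p.1 + τ + max p.2 0 / 2) * k (p.1 + τ, max p.2 0))

/-- The first component of the kernel equation, after division by the weight. -/
def op₁ (q σ : ℝ → ℝ) (k : ℝ × ℝ → ℝ) (p : ℝ × ℝ) : ℝ :=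
  Real.exp (-(2 * tail σ p.1)) * (-(q (p.1 + max p.2 0 / 2) / (2 * σ (p.1 + max p.2 0 / 2))) -
    ∫ τ in (0 : ℝ)..(max p.2 0 / 2), integrand₁ q σ k p τ)

/-- The second component of the kernel equation, after division by the weight. -/
def op₂ (q σ : ℝ → ℝ) (k : ℝ × ℝ → ℝ) (p : ℝ × ℝ) : ℝ :=
  Real.exp (-(2 * tail σ p.1)) / σ (p.1 + max p.2 0 / 2) *
    ∫ τ in Ioi (0 : ℝ), integrand₂ q σ k p τ

lemma abs_integrand₁_le (h : IsMajorant q σ) {k : ℝ × ℝ → ℝ} {M : ℝ} (hM : ∀ p, |k p| ≤ M)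
    (p : ℝ × ℝ) (τ : ℝ) :
    |integrand₁ q σ k p τ| ≤ M * (σ (p.1 + τ) * Real.exp (2 * tail σ (p.1 + τ))) := by
  rw [integrand₁, abs_mul, abs_mul, Real.abs_exp, mul_comm M]
  exact mul_le_mul (mul_le_mul_of_nonneg_right (h.le _) (Real.exp_pos _).le) (hM _) (abs_nonneg _)
    (mul_nonneg (h.nonneg _) (Real.exp_pos _).le)

lemma abs_integrand₂_le (h : IsMajorant q σ) {k : ℝ × ℝ → ℝ} {M : ℝ} (hM : ∀ p, |k p| ≤ M)
    (p : ℝ × ℝ) {τ : ℝ} (hτ : 0 ≤ τ) :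
    |integrand₂ q σ k p τ| ≤ σ (p.1 + max p.2 0 / 2) * M *
      (σ (p.1 + τ) * Real.exp (2 * tail σ (p.1 + τ))) := by
  rw [integrand₂, abs_mul, abs_mul, abs_mul, Real.abs_exp, abs_of_pos (h.pos _), mul_comm (_ * M)]
  have h1 : σ (p.1 + τ + max p.2 0 / 2) ≤ σ (p.1 + max p.2 0 / 2) := h.antitone (by linarith)
  exact mul_le_mul (mul_le_mul_of_nonneg_right (h.le _) (Real.exp_pos _).le)
    (mul_le_mul h1 (hM _) (abs_nonneg _) (h.nonneg _))
    (mul_nonneg (h.nonneg _) (abs_nonneg _)) (mul_nonneg (h.nonneg _) (Real.exp_pos _).le)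

lemma continuous_integrand₁ (h : IsMajorant q σ) {k : ℝ × ℝ → ℝ} (hk : Continuous k) :
    Continuous (Function.uncurry (integrand₁ q σ k)) := by
  have h1 := h.continuous_left
  have h2 := h.continuous_tail
  unfold integrand₁ Function.uncurry
  fun_prop

lemma continuous_integrand₂ (h : IsMajorant q σ) {k : ℝ × ℝ → ℝ} (hk : Continuous k) :
    Continuous (Function.uncurry (integrand₂ q σ k)) := by
  have h1 := h.continuous_left
  have h2 := h.continuous_tail
  have h3 := h.continuous_right
  unfold integrand₂ Function.uncurry
  fun_prop

lemma abs_integral_integrand₁_le (h : IsMajorant q σ) {k : ℝ × ℝ → ℝ} {M : ℝ}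
    (hM : ∀ p, |k p| ≤ M) (p : ℝ × ℝ) :
    |∫ τ in (0 : ℝ)..(max p.2 0 / 2), integrand₁ q σ k p τ| ≤
      M * (Real.exp (2 * tail σ p.1) / 2) := by
  have hM0 : 0 ≤ M := (abs_nonneg _).trans (hM (0, 0))
  have hi := (h.integrableOn_shift_mul_exp_tail p.1).const_mul M
  have h0 : (0 : ℝ) ≤ max p.2 0 / 2 := by positivity
  rw [← Real.norm_eq_abs]
  refine (intervalIntegral.norm_integral_le_of_norm_le
    (g := fun τ => M * (σ (p.1 + τ) * Real.exp (2 * tail σ (p.1 + τ)))) h0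
    (Eventually.of_forall fun τ _ => h.abs_integrand₁_le hM p τ) ?_).trans ?_
  · exact (intervalIntegrable_iff_integrableOn_Ioc_of_le h0).2
      (IntegrableOn.mono_set hi fun t ht => ht.1)
  · rw [intervalIntegral.integral_of_le h0]
    refine (setIntegral_mono_set hi (Eventually.of_forall fun t => ?_)
      (Eventually.of_forall fun t ht => ht.1)).trans ?_
    · exact mul_nonneg hM0 (mul_nonneg (h.nonneg _) (Real.exp_pos _).le)
    · rw [integral_const_mul]
      exact mul_le_mul_of_nonneg_left (h.integral_shift_mul_exp_tail_le p.1) hM0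

lemma abs_integral_integrand₂_le (h : IsMajorant q σ) {k : ℝ × ℝ → ℝ} {M : ℝ}
    (hM : ∀ p, |k p| ≤ M) (p : ℝ × ℝ) :
    |∫ τ in Ioi (0 : ℝ), integrand₂ q σ k p τ| ≤
      σ (p.1 + max p.2 0 / 2) * M * (Real.exp (2 * tail σ p.1) / 2) := by
  have hM0 : 0 ≤ M := (abs_nonneg _).trans (hM (0, 0))
  rw [← Real.norm_eq_abs]
  refine (norm_integral_le_of_norm_le
    ((h.integrableOn_shift_mul_exp_tail p.1).const_mul (σ (p.1 + max p.2 0 / 2) * M)) ?_).trans ?_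
  · filter_upwards [ae_restrict_mem measurableSet_Ioi] with τ hτ
    exact h.abs_integrand₂_le hM p (le_of_lt hτ)
  · rw [integral_const_mul]
    exact mul_le_mul_of_nonneg_left (h.integral_shift_mul_exp_tail_le p.1)
      (mul_nonneg (h.nonneg _) hM0)

lemma integrableOn_integrand₂ (h : IsMajorant q σ) {k : ℝ × ℝ → ℝ} (hk : Continuous k) {M : ℝ}
    (hM : ∀ p, |k p| ≤ M) (p : ℝ × ℝ) : IntegrableOn (integrand₂ q σ k p) (Ioi 0) := by
  refine Integrable.mono'
    ((h.integrableOn_shift_mul_exp_tail p.1).const_mul (σ (p.1 + max p.2 0 / 2) * M)) ?_ ?_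
  · exact ((h.continuous_integrand₂ hk).comp (by fun_prop :
      Continuous fun τ : ℝ => (p, τ))).aestronglyMeasurable
  · filter_upwards [ae_restrict_mem measurableSet_Ioi] with τ hτ
    exact h.abs_integrand₂_le hM p (le_of_lt hτ)

lemma exp_neg_tail_mul (σ : ℝ → ℝ) (x : ℝ) :
    Real.exp (-(2 * tail σ x)) * Real.exp (2 * tail σ x) = 1 := by
  rw [← Real.exp_add, neg_add_cancel, Real.exp_zero]

lemma abs_op₁_sub_le (h : IsMajorant q σ) {k k' : ℝ × ℝ → ℝ} (hk : Continuous k)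
    (hk' : Continuous k') {M : ℝ} (hM : ∀ p, |k p - k' p| ≤ M) (p : ℝ × ℝ) :
    |op₁ q σ k p - op₁ q σ k' p| ≤ M / 2 := by
  have hint : ∀ {k : ℝ × ℝ → ℝ}, Continuous k →
      IntervalIntegrable (integrand₁ q σ k p) volume 0 (max p.2 0 / 2) := fun {k} hk =>
    ((h.continuous_integrand₁ hk).comp (by fun_prop :
      Continuous fun τ : ℝ => (p, τ))).intervalIntegrable _ _
  have h1 : op₁ q σ k p - op₁ q σ k' p = Real.exp (-(2 * tail σ p.1)) *
      -∫ τ in (0 : ℝ)..(max p.2 0 / 2), integrand₁ q σ (fun p => k p - k' p) p τ := by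
    have h2 : ∀ τ, integrand₁ q σ (fun p => k p - k' p) p τ =
        integrand₁ q σ k p τ - integrand₁ q σ k' p τ := fun τ => by
      unfold integrand₁; ring
    simp only [h2]
    rw [intervalIntegral.integral_sub (hint hk) (hint hk'), op₁, op₁]
    ring
  rw [h1, abs_mul, abs_neg, Real.abs_exp]
  refine (mul_le_mul_of_nonneg_left (h.abs_integral_integrand₁_le hM p)
    (Real.exp_pos _).le).trans (le_of_eq ?_)
  linear_combination M / 2 * exp_neg_tail_mul σ p.1

lemma abs_op₂_sub_le (h : IsMajorant q σ) {k k' : ℝ × ℝ → ℝ} (hk : Continuous k)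
    (hk' : Continuous k') {B B' : ℝ} (hB : ∀ p, |k p| ≤ B) (hB' : ∀ p, |k' p| ≤ B')
    {M : ℝ} (hM : ∀ p, |k p - k' p| ≤ M) (p : ℝ × ℝ) :
    |op₂ q σ k p - op₂ q σ k' p| ≤ M / 2 := by
  have h1 : op₂ q σ k p - op₂ q σ k' p = Real.exp (-(2 * tail σ p.1)) /
      σ (p.1 + max p.2 0 / 2) * ∫ τ in Ioi (0 : ℝ), integrand₂ q σ (fun p => k p - k' p) p τ := by
    have h2 : ∀ τ, integrand₂ q σ (fun p => k p - k' p) p τ =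
        integrand₂ q σ k p τ - integrand₂ q σ k' p τ := fun τ => by
      unfold integrand₂; ring
    simp only [h2]
    rw [integral_sub (h.integrableOn_integrand₂ hk hB p) (h.integrableOn_integrand₂ hk' hB' p),
      op₂, op₂]
    ring
  have hpos := h.pos (p.1 + max p.2 0 / 2)
  rw [h1, abs_mul, abs_of_pos (div_pos (Real.exp_pos _) hpos)]
  refine (mul_le_mul_of_nonneg_left (h.abs_integral_integrand₂_le hM p)
    (div_pos (Real.exp_pos _) hpos).le).trans (le_of_eq ?_)
  rw [div_mul_eq_mul_div, div_eq_iff hpos.ne']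
  linear_combination M / 2 * σ (p.1 + max p.2 0 / 2) * exp_neg_tail_mul σ p.1

lemma abs_op₁_zero_le (h : IsMajorant q σ) (p : ℝ × ℝ) : |op₁ q σ 0 p| ≤ 1 / 2 := by
  have h1 : op₁ q σ 0 p = Real.exp (-(2 * tail σ p.1)) *
      -(q (p.1 + max p.2 0 / 2) / (2 * σ (p.1 + max p.2 0 / 2))) := by
    simp [op₁, integrand₁]
  have hpos := h.pos (p.1 + max p.2 0 / 2)
  have hle := h.le (p.1 + max p.2 0 / 2)
  have h2 : Real.exp (-(2 * tail σ p.1)) ≤ 1 := by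
    rw [Real.exp_le_one_iff]; linarith [h.tail_nonneg p.1]
  rw [h1, abs_mul, abs_neg, Real.abs_exp, abs_div, abs_of_pos (mul_pos two_pos hpos)]
  have h3 : |q (p.1 + max p.2 0 / 2)| / (2 * σ (p.1 + max p.2 0 / 2)) ≤ 1 / 2 := by
    rw [div_le_iff₀ (by positivity)]; linarith
  calc _ ≤ 1 * (1 / 2 : ℝ) := mul_le_mul h2 h3 (by positivity) zero_le_one
    _ = 1 / 2 := one_mul _

lemma abs_op₁_le (h : IsMajorant q σ) {k : ℝ × ℝ → ℝ} (hk : Continuous k) {M : ℝ}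
    (hM : ∀ p, |k p| ≤ M) (p : ℝ × ℝ) : |op₁ q σ k p| ≤ M / 2 + 1 / 2 := by
  have h1 := h.abs_op₁_sub_le hk (k' := 0) continuous_zero (by simpa using hM) p
  have h2 := h.abs_op₁_zero_le p
  have h3 := abs_add_le (op₁ q σ k p - op₁ q σ 0 p) (op₁ q σ 0 p)
  rw [sub_add_cancel] at h3
  linarith

lemma abs_op₂_le (h : IsMajorant q σ) {k : ℝ × ℝ → ℝ} (hk : Continuous k) {M : ℝ}
    (hM : ∀ p, |k p| ≤ M) (p : ℝ × ℝ) : |op₂ q σ k p| ≤ M / 2 := by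
  have h1 := h.abs_op₂_sub_le hk (k' := 0) continuous_zero hM (B' := 0) (by simp)
    (by simpa using hM) p
  simpa [op₂, integrand₂] using h1

lemma continuous_op₁ (h : IsMajorant q σ) {k : ℝ × ℝ → ℝ} (hk : Continuous k) :
    Continuous (op₁ q σ k) := by
  have h1 := h.continuous_left
  have h2 := h.continuous_tail
  have h3 := h.continuous_right
  have h4 : Continuous fun p : ℝ × ℝ =>
      ∫ τ in (0 : ℝ)..(max p.2 0 / 2), integrand₁ q σ k p τ :=
    intervalIntegral.continuous_parametric_intervalIntegral_of_continuous
      (h.continuous_integrand₁ hk) (by fun_prop)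
  have h5 : Continuous fun p : ℝ × ℝ =>
      q (p.1 + max p.2 0 / 2) / (2 * σ (p.1 + max p.2 0 / 2)) :=
    Continuous.div (by fun_prop) (by fun_prop) fun p => (mul_pos two_pos (h.pos _)).ne'
  unfold op₁
  fun_prop

lemma continuous_op₂ (h : IsMajorant q σ) {k : ℝ × ℝ → ℝ} (hk : Continuous k) {M : ℝ}
    (hM : ∀ p, |k p| ≤ M) : Continuous (op₂ q σ k) := by
  have h2 := h.continuous_tail
  have h3 := h.continuous_right
  have hM0 : 0 ≤ M := (abs_nonneg _).trans (hM (0, 0))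
  have h4 : Continuous fun p : ℝ × ℝ => ∫ τ in Ioi (0 : ℝ), integrand₂ q σ k p τ := by
    refine continuous_iff_continuousAt.2 fun p₀ => ?_
    -- `σ` and its tail decrease, so values based at a point to the left dominate uniformly near
    -- `p₀`.
    set a := p₀.1 - 1 with ha
    refine continuousAt_of_dominated (bound := fun τ => σ a * M * Real.exp (2 * tail σ a) *
      (σ (a + τ) * Real.exp (2 * tail σ (a + τ)))) ?_ ?_
      ((h.integrableOn_shift_mul_exp_tail a).const_mul _) ?_
    · exact Eventually.of_forall fun p => (h.integrableOn_integrand₂ hk hM p).aestronglyMeasurable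
    · have hnear : ∀ᶠ p : ℝ × ℝ in 𝓝 p₀, a < p.1 :=
        continuous_fst.continuousAt.eventually_const_lt (by simp [ha])
      filter_upwards [hnear] with p hp
      filter_upwards [ae_restrict_mem measurableSet_Ioi] with τ hτ
      refine (h.abs_integrand₂_le hM p (le_of_lt hτ)).trans ?_
      have e1 : σ (p.1 + max p.2 0 / 2) ≤ σ a :=
        h.antitone (by linarith [le_max_right p.2 0])
      have e2 : σ (p.1 + τ) ≤ σ (a + τ) := h.antitone (by linarith)
      have e3 : Real.exp (2 * tail σ (p.1 + τ)) ≤ Real.exp (2 * tail σ (a + τ)) :=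
        Real.exp_le_exp.2 (by linarith [h.antitone_tail (show a + τ ≤ p.1 + τ by linarith)])
      have e4 : 1 ≤ Real.exp (2 * tail σ a) :=
        Real.one_le_exp (by linarith [h.tail_nonneg a])
      have p1 := h.nonneg a
      have p2 := h.nonneg (a + τ)
      refine mul_le_mul ?_ (mul_le_mul e2 e3 (Real.exp_pos _).le p2)
        (mul_nonneg (h.nonneg _) (Real.exp_pos _).le) (by positivity)
      calc σ (p.1 + max p.2 0 / 2) * M ≤ σ a * M := mul_le_mul_of_nonneg_right e1 hM0
        _ ≤ _ := le_mul_of_one_le_right (by positivity) e4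
    · refine Eventually.of_forall fun τ => Continuous.continuousAt ?_
      exact (h.continuous_integrand₂ hk).comp (by fun_prop : Continuous fun p : ℝ × ℝ => (p, τ))
  unfold op₂
  exact (Continuous.div (by fun_prop) (by fun_prop) fun p => (h.pos _).ne').mul h4

lemma abs_apply_le (k : ℝ × ℝ →ᵇ ℝ) (p : ℝ × ℝ) : |k p| ≤ ‖k‖ := k.norm_coe_le_norm p

/-- The contraction whose fixed point gives the kernels. -/
def contraction (h : IsMajorant q σ) (k : (ℝ × ℝ →ᵇ ℝ) × (ℝ × ℝ →ᵇ ℝ)) :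
    (ℝ × ℝ →ᵇ ℝ) × (ℝ × ℝ →ᵇ ℝ) :=
  (BoundedContinuousFunction.ofNormedAddCommGroup (op₁ q σ k.2) (h.continuous_op₁ k.2.continuous)
      (‖k.2‖ / 2 + 1 / 2) (h.abs_op₁_le k.2.continuous (abs_apply_le k.2)),
    BoundedContinuousFunction.ofNormedAddCommGroup (op₂ q σ k.1)
      (h.continuous_op₂ k.1.continuous (abs_apply_le k.1))
      (‖k.1‖ / 2) (h.abs_op₂_le k.1.continuous (abs_apply_le k.1)))

/-- Each component depends only on the other one and is `1/2`-Lipschitz in it, so the maximum metric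
on the product contracts. -/
lemma contractingWith_contraction (h : IsMajorant q σ) :
    ContractingWith (1 / 2) h.contraction := by
  refine ⟨by norm_num [← NNReal.coe_lt_coe], LipschitzWith.of_dist_le_mul fun k k' => ?_⟩
  have hd : ∀ (f g : ℝ × ℝ →ᵇ ℝ) (p : ℝ × ℝ), |f p - g p| ≤ dist f g := fun f g p => by
    rw [← Real.dist_eq]; exact BoundedContinuousFunction.dist_coe_le_dist p
  have h1 : dist k.1 k'.1 ≤ dist k k' := le_max_left _ _
  have h2 : dist k.2 k'.2 ≤ dist k k' := le_max_right _ _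
  have hc : (((1 / 2 : NNReal) : NNReal) : ℝ) = 1 / 2 := by norm_num
  rw [hc]
  refine max_le ?_ ?_
  · refine (BoundedContinuousFunction.dist_le (by positivity)).2 fun p => ?_
    rw [Real.dist_eq]
    refine (h.abs_op₁_sub_le k.2.continuous k'.2.continuous (hd k.2 k'.2) p).trans ?_
    linarith
  · refine (BoundedContinuousFunction.dist_le (by positivity)).2 fun p => ?_
    rw [Real.dist_eq]
    refine (h.abs_op₂_sub_le k.1.continuous k'.1.continuous (abs_apply_le k.1) (abs_apply_le k'.1)
      (hd k.1 k'.1) p).trans ?_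
    linarith

end IsMajorant

/-- `K₁`, `K₂` are the real transformation kernels of the right Jost solution, with the bound
that makes them integrable. -/
structure IsKernelPair (q σ : ℝ → ℝ) (C : ℝ) (K₁ K₂ : ℝ → ℝ → ℝ) : Prop where
  continuous_fst : Continuous (Function.uncurry K₁)
  continuous_snd : Continuous (Function.uncurry K₂)
  nonneg : 0 ≤ C
  bound_fst : ∀ x s, |K₁ x s| ≤ C * Real.exp (2 * tail σ x) * σ (x + s / 2)
  bound_snd : ∀ x s, |K₂ x s| ≤ C * Real.exp (2 * tail σ x) * σ (x + s / 2)
  -- Formally `∂ₓK₁ - 2∂ₛK₁ = qK₂` with `K₁(x,0) = -q(x)/2`, and `∂ₓK₂ = -qK₁` with decay at `+∞`,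
  -- both integrated along characteristics so that no derivative of a kernel is needed.
  eq_fst : ∀ x s, 0 ≤ s → K₁ x s = -(q (x + s / 2) / 2) -
    ∫ τ in (0 : ℝ)..(s / 2), q (x + τ) * K₂ (x + τ) (s - 2 * τ)
  eq_snd : ∀ x s, 0 ≤ s → K₂ x s = ∫ τ in Ioi (0 : ℝ), q (x + τ) * K₁ (x + τ) s

/-- Existence of the transformation kernels, by the contraction principle. -/
lemma IsMajorant.exists_isKernelPair {q σ : ℝ → ℝ} (h : IsMajorant q σ) :
    ∃ C K₁ K₂, IsKernelPair q σ C K₁ K₂ := by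
  obtain ⟨k, hk⟩ : ∃ k, h.contraction k = k :=
    ⟨_, h.contractingWith_contraction.fixedPoint_isFixedPt⟩
  have hk1 : ∀ p, op₁ q σ k.2 p = k.1 p := fun p =>
    congrArg (fun k : (ℝ × ℝ →ᵇ ℝ) × (ℝ × ℝ →ᵇ ℝ) => k.1 p) hk
  have hk2 : ∀ p, op₂ q σ k.1 p = k.2 p := fun p =>
    congrArg (fun k : (ℝ × ℝ →ᵇ ℝ) × (ℝ × ℝ →ᵇ ℝ) => k.2 p) hk
  have hσ := h.continuous_right
  have hS := h.continuous_tail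
  have c1 := k.1.continuous
  have c2 := k.2.continuous
  have hb : ∀ (f : ℝ × ℝ →ᵇ ℝ) (x s : ℝ), ‖f‖ ≤ max ‖k.1‖ ‖k.2‖ →
      |σ (x + s / 2) * Real.exp (2 * tail σ x) * f (x, s)| ≤
        max ‖k.1‖ ‖k.2‖ * Real.exp (2 * tail σ x) * σ (x + s / 2) := fun f x s hf => by
    have h0 := h.nonneg (x + s / 2)
    rw [abs_mul, abs_of_nonneg (by positivity)]
    have := (abs_apply_le f (x, s)).trans hf
    calc _ ≤ σ (x + s / 2) * Real.exp (2 * tail σ x) * max ‖k.1‖ ‖k.2‖ :=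
          mul_le_mul_of_nonneg_left this (by positivity)
      _ = _ := by ring
  -- Restoring the weight turns boundedness of the fixed point into the decay bounds on the kernels.
  refine ⟨max ‖k.1‖ ‖k.2‖, fun x s => σ (x + s / 2) * Real.exp (2 * tail σ x) * k.1 (x, s),
    fun x s => σ (x + s / 2) * Real.exp (2 * tail σ x) * k.2 (x, s), ?_, ?_, by positivity,
    fun x s => hb k.1 x s (le_max_left _ _), fun x s => hb k.2 x s (le_max_right _ _), ?_, ?_⟩
  · unfold Function.uncurry; fun_prop
  · unfold Function.uncurry; fun_prop
  · intro x s hs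
    have hpos := h.pos (x + s / 2)
    rw [← hk1, op₁]
    simp only [max_eq_left hs]
    have hint : ∫ τ in (0 : ℝ)..(s / 2), q (x + τ) * (σ (x + τ + (s - 2 * τ) / 2) *
        Real.exp (2 * tail σ (x + τ)) * k.2 (x + τ, s - 2 * τ)) =
        σ (x + s / 2) * ∫ τ in (0 : ℝ)..(s / 2), integrand₁ q σ k.2 (x, s) τ := by
      rw [← intervalIntegral.integral_const_mul]
      refine intervalIntegral.integral_congr fun τ _ => ?_
      simp only [integrand₁, max_eq_left hs]
      rw [show x + τ + (s - 2 * τ) / 2 = x + s / 2 by ring]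
      ring
    rw [hint]
    have hq : q (x + s / 2) / 2 = σ (x + s / 2) * (q (x + s / 2) / (2 * σ (x + s / 2))) := by
      rw [mul_div_assoc', mul_comm (2 : ℝ), mul_div_mul_left _ _ hpos.ne']
    rw [hq]
    linear_combination (σ (x + s / 2) * (-(q (x + s / 2) / (2 * σ (x + s / 2))) -
      ∫ τ in (0 : ℝ)..(s / 2), integrand₁ q σ k.2 (x, s) τ)) * exp_neg_tail_mul σ x
  · intro x s hs
    have hpos := h.pos (x + s / 2)
    rw [← hk2, op₂]
    simp only [max_eq_left hs]
    have hint : ∀ τ, q (x + τ) * (σ (x + τ + s / 2) * Real.exp (2 * tail σ (x + τ)) *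
        k.1 (x + τ, s)) = integrand₂ q σ k.1 (x, s) τ := fun τ => by
      simp only [integrand₂, max_eq_left hs]; ring
    simp only [hint]
    rw [div_mul_eq_mul_div, mul_div_assoc', div_eq_iff hpos.ne']
    linear_combination (σ (x + s / 2) * ∫ τ in Ioi (0 : ℝ), integrand₂ q σ k.1 (x, s) τ) *
      exp_neg_tail_mul σ x

/-! ### Jost solutions from the transformation kernels -/

/-- Integration over a triangle after a shear. -/
lemma integral_triangle {F : ℝ × ℝ → ℂ}
    (hF : Integrable F ((volume.restrict (Ioi 0)).prod (volume.restrict (Ioi 0)))) :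
    ∫ s in Ioi (0 : ℝ), ∫ τ in (0 : ℝ)..(s / 2), F (τ, s - 2 * τ) =
      ∫ τ in Ioi (0 : ℝ), ∫ s in Ioi (0 : ℝ), F (τ, s) := by
  -- The shear `(τ, s) ↦ (τ, s - 2τ)` preserves area and carries `0 < τ < s/2` onto the open
  -- quadrant.
  have hmp : MeasurePreserving (fun p : ℝ × ℝ => (p.1, p.2 - 2 * p.1))
      ((volume : Measure ℝ).prod volume) (volume.prod volume) :=
    (MeasurePreserving.id volume).skew_product (g := fun a c => c - 2 * a) (by fun_prop)
      (Eventually.of_forall fun a => (measurePreserving_sub_right volume (2 * a)).map_eq)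
  set G : ℝ × ℝ → ℂ := (Ioi (0 : ℝ) ×ˢ Ioi (0 : ℝ)).indicator F with hG
  have hset : MeasurableSet (Ioi (0 : ℝ) ×ˢ Ioi (0 : ℝ)) := measurableSet_Ioi.prod measurableSet_Ioi
  have hGi : Integrable G (volume.prod volume) := by
    rw [hG, integrable_indicator_iff hset, IntegrableOn, ← Measure.prod_restrict]
    exact hF
  have hGs : Integrable (Function.uncurry fun τ s : ℝ => G (τ, s - 2 * τ)) (volume.prod volume) :=
    hmp.integrable_comp_of_integrable hGi
  have hswap := integral_integral_swap hGs
  have hleft : ∀ τ, ∫ s, G (τ, s - 2 * τ) =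
      (Ioi (0 : ℝ)).indicator (fun τ => ∫ s in Ioi (0 : ℝ), F (τ, s)) τ := fun τ => by
    rw [integral_sub_right_eq_self (fun s => G (τ, s)) (2 * τ)]
    by_cases hτ : τ ∈ Ioi (0 : ℝ)
    · rw [indicator_of_mem hτ, ← integral_indicator measurableSet_Ioi]
      refine integral_congr_ae (Eventually.of_forall fun s => ?_)
      simp only [hG, indicator, mem_prod, hτ, true_and]
    · rw [indicator_of_notMem hτ]
      have : (fun s => G (τ, s)) = fun _ => 0 := by
        ext s; simp only [hG, indicator, mem_prod, hτ, false_and, if_false]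
      rw [this, integral_zero]
  have hright : ∀ s, ∫ τ, G (τ, s - 2 * τ) =
      (Ioi (0 : ℝ)).indicator (fun s => ∫ τ in (0 : ℝ)..(s / 2), F (τ, s - 2 * τ)) s := fun s => by
    by_cases hs : s ∈ Ioi (0 : ℝ)
    · have hs' : (0 : ℝ) ≤ s / 2 := by
        have : (0 : ℝ) < s := hs
        positivity
      rw [indicator_of_mem hs, intervalIntegral.integral_of_le hs', integral_Ioc_eq_integral_Ioo,
        ← integral_indicator measurableSet_Ioo]
      refine integral_congr_ae (Eventually.of_forall fun τ => ?_)
      simp only [hG, indicator, mem_prod, mem_Ioi, mem_Ioo]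
      refine if_congr (and_congr_right fun _ => ?_) rfl rfl
      constructor <;> intro h <;> linarith
    · rw [indicator_of_notMem hs]
      have : (fun τ => G (τ, s - 2 * τ)) = fun _ => 0 := by
        ext τ
        rw [hG, indicator_of_notMem]
        rintro ⟨h1, h2⟩
        simp only [mem_Ioi] at h1 h2 hs
        linarith
      rw [this, integral_zero]
  simp only [hleft, hright] at hswap
  rw [integral_indicator measurableSet_Ioi, integral_indicator measurableSet_Ioi] at hswap
  exact hswap.symm

namespace IsMajorant

variable {q σ : ℝ → ℝ}

lemma integrable_left (h : IsMajorant q σ) (a : ℝ) : IntegrableOn q (Ioi a) :=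
  (h.integrable a).mono' h.continuous_left.aestronglyMeasurable (Eventually.of_forall h.le)

lemma integrableOn_comp_half (h : IsMajorant q σ) (x : ℝ) :
    IntegrableOn (fun s => σ (x + s / 2)) (Ioi 0) := by
  have h1 : IntegrableOn (fun s => σ (x + s)) (Ioi 0) :=
    integrableOn_comp_add_iff.2 (h.integrable x)
  have h2 := (integrableOn_Ioi_comp_mul_left_iff (fun s => σ (x + s)) 0
    (a := 1 / 2) (by norm_num)).2 (by simpa using h1)
  refine h2.congr_fun (fun s _ => ?_) measurableSet_Ioi
  simp only
  congr 1; ring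

lemma integral_comp_half (σ : ℝ → ℝ) (x : ℝ) :
    ∫ s in Ioi (0 : ℝ), σ (x + s / 2) = 2 * tail σ x := by
  have h1 := integral_comp_mul_left_Ioi (fun s => σ (x + s)) 0 (b := 1 / 2) (by norm_num)
  have h2 : ∫ s in Ioi (0 : ℝ), σ (x + s) = tail σ x := (setIntegral_Ioi_eq_shift σ x).symm
  rw [mul_zero, h2] at h1
  simp only [one_div, inv_inv, smul_eq_mul] at h1
  rw [← h1]
  refine integral_congr_ae (Eventually.of_forall fun s => ?_)
  simp only
  congr 1; ring

end IsMajorant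

/-- A continuous kernel with the bound of the transformation kernels. -/
structure IsBoundedKernel (σ : ℝ → ℝ) (C : ℝ) (K : ℝ → ℝ → ℝ) : Prop where
  continuous : Continuous (Function.uncurry K)
  nonneg : 0 ≤ C
  bound : ∀ x s, |K x s| ≤ C * Real.exp (2 * tail σ x) * σ (x + s / 2)

lemma IsKernelPair.fst {q σ : ℝ → ℝ} {C : ℝ} {K₁ K₂ : ℝ → ℝ → ℝ}
    (hK : IsKernelPair q σ C K₁ K₂) : IsBoundedKernel σ C K₁ :=
  ⟨hK.continuous_fst, hK.nonneg, hK.bound_fst⟩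

lemma IsKernelPair.snd {q σ : ℝ → ℝ} {C : ℝ} {K₁ K₂ : ℝ → ℝ → ℝ}
    (hK : IsKernelPair q σ C K₁ K₂) : IsBoundedKernel σ C K₂ :=
  ⟨hK.continuous_snd, hK.nonneg, hK.bound_snd⟩

namespace IsBoundedKernel

variable {q σ : ℝ → ℝ} {C : ℝ} {K : ℝ → ℝ → ℝ}

lemma continuous_apply (hK : IsBoundedKernel σ C K) (x : ℝ) : Continuous (K x) :=
  hK.continuous.comp (by fun_prop : Continuous fun s : ℝ => (x, s))

/-- Monotonicity of `σ` and its tail makes the bound uniform on `[a, ∞)`, as dominated convergence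
in `x` requires. -/
lemma bound_of_le (hK : IsBoundedKernel σ C K) (h : IsMajorant q σ) {a x : ℝ} (hx : a ≤ x) (s : ℝ) :
    |K x s| ≤ C * Real.exp (2 * tail σ a) * σ (a + s / 2) := by
  have hC := hK.nonneg
  refine (hK.bound x s).trans ?_
  refine mul_le_mul (mul_le_mul_of_nonneg_left (Real.exp_le_exp.2 ?_) hK.nonneg)
    (h.antitone (by linarith)) (h.nonneg _) (by positivity)
  linarith [h.antitone_tail hx]

lemma integrableOn (hK : IsBoundedKernel σ C K) (h : IsMajorant q σ) (x : ℝ) :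
    IntegrableOn (K x) (Ioi 0) :=
  ((h.integrableOn_comp_half x).const_mul _).mono'
    (hK.continuous_apply x).aestronglyMeasurable (Eventually.of_forall (hK.bound x))

lemma integrableOn_ofReal (hK : IsBoundedKernel σ C K) (h : IsMajorant q σ) (x : ℝ) :
    IntegrableOn (fun s => (K x s : ℂ)) (Ioi 0) := (hK.integrableOn h x).ofReal

/-- The Fourier transform of a kernel, as a function of the space variable. -/
def transform (K : ℝ → ℝ → ℝ) (ρ : ℂ) (x : ℝ) : ℂ := halfFourier (fun s => (K x s : ℂ)) ρ

lemma norm_transform_le_of_le (hK : IsBoundedKernel σ C K) (h : IsMajorant q σ) {ρ : ℂ}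
    (hρ : 0 ≤ ρ.im) {a x : ℝ} (hx : a ≤ x) :
    ‖transform K ρ x‖ ≤ C * Real.exp (2 * tail σ a) * (2 * tail σ a) := by
  refine (norm_halfFourier_le (hK.integrableOn_ofReal h x) hρ).trans ?_
  refine le_trans ?_ (le_of_eq (by rw [integral_const_mul, IsMajorant.integral_comp_half σ a] :
    ∫ s in Ioi (0 : ℝ), C * Real.exp (2 * tail σ a) * σ (a + s / 2) = _))
  refine integral_mono (hK.integrableOn_ofReal h x).norm
    ((h.integrableOn_comp_half a).const_mul _) fun s => ?_
  simp only [Complex.norm_real, Real.norm_eq_abs]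
  exact hK.bound_of_le h hx s

lemma tendsto_transform (hK : IsBoundedKernel σ C K) (h : IsMajorant q σ) {ρ : ℂ}
    (hρ : 0 ≤ ρ.im) : Tendsto (transform K ρ) atTop (𝓝 0) := by
  refine squeeze_zero_norm (fun x => hK.norm_transform_le_of_le h hρ le_rfl) ?_
  have h1 := (tendsto_tail h.integrable).const_mul 2
  have h2 := (((Real.continuous_exp.tendsto _).comp h1).const_mul C).mul h1
  simpa using h2

lemma continuous_transform (hK : IsBoundedKernel σ C K) (h : IsMajorant q σ) {ρ : ℂ}
    (hρ : 0 ≤ ρ.im) : Continuous (transform K ρ) := by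
  refine continuous_iff_continuousAt.2 fun x₀ => ?_
  refine continuousAt_of_dominated (bound := fun s => C * Real.exp (2 * tail σ (x₀ - 1)) *
    σ (x₀ - 1 + s / 2)) ?_ ?_ ((h.integrableOn_comp_half _).const_mul _) ?_
  · exact Eventually.of_forall fun x =>
      (integrableOn_mul_exp (hK.integrableOn_ofReal h x) hρ).aestronglyMeasurable
  · filter_upwards [lt_mem_nhds (show x₀ - 1 < x₀ by linarith)] with x hx
    filter_upwards [norm_mul_exp_le (fun s => (K x s : ℂ)) hρ] with s hs
    refine hs.trans ?_
    rw [Complex.norm_real, Real.norm_eq_abs]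
    exact hK.bound_of_le h hx.le s
  · refine Eventually.of_forall fun s => Continuous.continuousAt ?_
    have : Continuous fun x => K x s := hK.continuous.comp (by fun_prop :
      Continuous fun x : ℝ => (x, s))
    fun_prop

/-- The integrands of the kernel equations are absolutely integrable over the quadrant. -/
lemma integrable_prod (hK : IsBoundedKernel σ C K) (h : IsMajorant q σ) (x : ℝ) {ρ : ℂ}
    (hρ : 0 ≤ ρ.im) {c : ℝ → ℂ} (hc : Continuous c) (hc1 : ∀ τ, 0 ≤ τ → ‖c τ‖ ≤ 1) :
    Integrable (fun p : ℝ × ℝ => c p.1 * (q (x + p.1) * (K (x + p.1) p.2 * exp (I * ρ * p.2))))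
      ((volume.restrict (Ioi (0 : ℝ))).prod (volume.restrict (Ioi (0 : ℝ)))) := by
  have hσ1 : IntegrableOn (fun τ => σ (x + τ)) (Ioi 0) :=
    integrableOn_comp_add_iff.2 (h.integrable x)
  have hb := Integrable.mul_prod hσ1
    ((h.integrableOn_comp_half x).const_mul (C * Real.exp (2 * tail σ x)))
  refine hb.mono' ?_ ?_
  · have hq := h.continuous_left
    have hk : Continuous fun p : ℝ × ℝ => K (x + p.1) p.2 :=
      hK.continuous.comp (by fun_prop : Continuous fun p : ℝ × ℝ => (x + p.1, p.2))
    have hc' : Continuous fun p : ℝ × ℝ => c p.1 := hc.comp continuous_fst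
    have hq' : Continuous fun p : ℝ × ℝ => q (x + p.1) := hq.comp (by fun_prop)
    exact (hc'.mul ((Complex.continuous_ofReal.comp hq').mul
      ((Complex.continuous_ofReal.comp hk).mul (by fun_prop)))).aestronglyMeasurable
  · rw [Measure.prod_restrict]
    filter_upwards [ae_restrict_mem (measurableSet_Ioi.prod measurableSet_Ioi)] with p hp
    have hp1 : (0 : ℝ) ≤ p.1 := le_of_lt hp.1
    have hp2 : (0 : ℝ) ≤ p.2 := le_of_lt hp.2
    rw [norm_mul, norm_mul, norm_mul, Complex.norm_real, Complex.norm_real, Real.norm_eq_abs,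
      Real.norm_eq_abs]
    have e1 := hc1 _ hp1
    have e2 := norm_exp_I_mul_le hρ hp2
    have e3 := hK.bound_of_le h (show x ≤ x + p.1 by linarith) p.2
    have e4 := h.le (x + p.1)
    calc _ ≤ 1 * (σ (x + p.1) * (C * Real.exp (2 * tail σ x) * σ (x + p.2 / 2) * 1)) := by
          refine mul_le_mul e1 (mul_le_mul e4 (mul_le_mul e3 e2 (norm_nonneg _)
            ((abs_nonneg _).trans e3)) (by positivity) (h.nonneg _)) (by positivity) zero_le_one
      _ = _ := by ring

end IsBoundedKernel

open IsBoundedKernel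

namespace IsKernelPair

variable {q σ : ℝ → ℝ} {C : ℝ} {K₁ K₂ : ℝ → ℝ → ℝ} {ρ : ℂ}

/-- The transform of `K₂` as a tail integral of `q` times the transform of `K₁`. -/
lemma transform_snd (hK : IsKernelPair q σ C K₁ K₂) (h : IsMajorant q σ) (hρ : 0 ≤ ρ.im) (x : ℝ) :
    transform K₂ ρ x = tail (fun t => q t * transform K₁ ρ t) x := by
  have hint := hK.fst.integrable_prod h x hρ (c := fun _ => 1) continuous_const (by simp)
  have hswap := integral_integral_swap (f := fun τ s : ℝ =>
    (1 : ℂ) * (q (x + τ) * (K₁ (x + τ) s * exp (I * ρ * s)))) hint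
  simp only [one_mul, integral_const_mul] at hswap
  rw [tail, setIntegral_Ioi_eq_shift]
  simp only [transform, halfFourier]
  rw [hswap]
  refine setIntegral_congr_fun measurableSet_Ioi fun s hs => ?_
  rw [hK.eq_snd x s (le_of_lt hs), ← integral_complex_ofReal, ← integral_mul_const]
  refine integral_congr_ae (Eventually.of_forall fun τ => ?_)
  push_cast
  ring

lemma norm_exp_two_mul_le (hρ : 0 ≤ ρ.im) {τ : ℝ} (hτ : 0 ≤ τ) : ‖exp (2 * I * ρ * τ)‖ ≤ 1 := by
  have := norm_exp_I_mul_le hρ (show (0 : ℝ) ≤ 2 * τ by linarith)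
  rwa [show I * ρ * ((2 * τ : ℝ) : ℂ) = 2 * I * ρ * τ by push_cast; ring] at this

lemma integral_exp_half (q : ℝ → ℝ) (ρ : ℂ) (x : ℝ) :
    ∫ s in Ioi (0 : ℝ), (q (x + s / 2) / 2 : ℂ) * exp (I * ρ * s) =
      ∫ τ in Ioi (0 : ℝ), exp (2 * I * ρ * τ) * q (x + τ) := by
  have h1 := integral_comp_mul_left_Ioi (fun s : ℝ => (q (x + s / 2) / 2 : ℂ) * exp (I * ρ * s)) 0
    (b := 2) two_pos
  rw [mul_zero] at h1
  have h2 : ∫ s in Ioi (0 : ℝ), (q (x + s / 2) / 2 : ℂ) * exp (I * ρ * s) =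
      2 * ∫ τ in Ioi (0 : ℝ), (q (x + 2 * τ / 2) / 2 : ℂ) * exp (I * ρ * ((2 * τ : ℝ) : ℂ)) := by
    rw [h1, Complex.real_smul]
    push_cast
    ring
  rw [h2, ← integral_const_mul]
  refine integral_congr_ae (Eventually.of_forall fun τ => ?_)
  simp only
  rw [mul_div_cancel_left₀ τ two_ne_zero, show I * ρ * ((2 * τ : ℝ) : ℂ) = 2 * I * ρ * τ by
    push_cast; ring]
  ring

/-- The variation-of-constants form of the equation for the first component. Splitting `e^{iρs} =
e^{2iρτ} e^{iρ(s-2τ)}` lets the shear over the triangle turn the kernel integral into the transform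
of `K₂`. -/
lemma transform_fst_eq_integral (hK : IsKernelPair q σ C K₁ K₂) (h : IsMajorant q σ)
    (hρ : 0 ≤ ρ.im) (x : ℝ) :
    transform K₁ ρ x = -∫ τ in Ioi (0 : ℝ),
      exp (2 * I * ρ * τ) * (q (x + τ) * (1 + transform K₂ ρ (x + τ))) := by
  have hint := hK.snd.integrable_prod h x hρ (c := fun τ => exp (2 * I * ρ * τ)) (by fun_prop)
    fun τ hτ => norm_exp_two_mul_le hρ hτ
  have htri := integral_triangle hint
  have hleft := hint.integral_prod_left
  simp only [integral_const_mul] at htri hleft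
  have hqi : IntegrableOn (fun τ : ℝ => exp (2 * I * ρ * τ) * (q (x + τ) : ℂ)) (Ioi 0) := by
    have h1 : IntegrableOn (fun τ => (q (x + τ) : ℂ)) (Ioi 0) :=
      integrableOn_comp_add_iff (f := fun t => (q t : ℂ)) |>.2 (h.integrable_left x).ofReal
    refine Integrable.mono h1 ((Continuous.aestronglyMeasurable (by fun_prop)).mul
      h1.aestronglyMeasurable) ?_
    filter_upwards [ae_restrict_mem measurableSet_Ioi] with τ hτ
    rw [norm_mul]
    exact mul_le_of_le_one_left (norm_nonneg _) (norm_exp_two_mul_le hρ (le_of_lt hτ))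
  have hsplit : ∀ τ : ℝ, exp (2 * I * ρ * τ) * (q (x + τ) * (1 + transform K₂ ρ (x + τ))) =
      exp (2 * I * ρ * τ) * q (x + τ) + exp (2 * I * ρ * τ) * (q (x + τ) *
        ∫ s in Ioi (0 : ℝ), K₂ (x + τ) s * exp (I * ρ * s)) := fun τ => by
    rw [transform, halfFourier]; ring
  simp only [hsplit]
  rw [integral_add hqi hleft, ← htri, ← integral_exp_half, transform, halfFourier]
  have hinner : ∀ s ∈ Ioi (0 : ℝ), (K₁ x s : ℂ) * exp (I * ρ * s) =
      -((q (x + s / 2) / 2 : ℂ) * exp (I * ρ * s)) -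
        ∫ τ in (0 : ℝ)..(s / 2), exp (2 * I * ρ * τ) * (q (x + τ) * (K₂ (x + τ) (s - 2 * τ) *
          exp (I * ρ * ((s - 2 * τ : ℝ) : ℂ)))) := fun s hs => by
    have e1 : ∫ τ in (0 : ℝ)..(s / 2), exp (2 * I * ρ * τ) * (q (x + τ) * (K₂ (x + τ) (s - 2 * τ) *
          exp (I * ρ * ((s - 2 * τ : ℝ) : ℂ)))) =
        (∫ τ in (0 : ℝ)..(s / 2), ((q (x + τ) * K₂ (x + τ) (s - 2 * τ) : ℝ) : ℂ)) *
          exp (I * ρ * s) := by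
      rw [← intervalIntegral.integral_mul_const]
      refine intervalIntegral.integral_congr fun τ _ => ?_
      rw [show I * ρ * (s : ℂ) = 2 * I * ρ * τ + I * ρ * ((s - 2 * τ : ℝ) : ℂ) by push_cast; ring,
        Complex.exp_add]
      push_cast
      ring
    rw [e1, intervalIntegral.integral_ofReal, hK.eq_fst x s (le_of_lt hs)]
    push_cast
    ring
  have i1 : IntegrableOn (fun s : ℝ => (K₁ x s : ℂ) * exp (I * ρ * s)) (Ioi 0) :=
    integrableOn_mul_exp (hK.fst.integrableOn_ofReal h x) hρ
  have i2 : IntegrableOn (fun s : ℝ => (q (x + s / 2) / 2 : ℂ) * exp (I * ρ * s)) (Ioi 0) := by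
    refine integrableOn_mul_exp (α := fun s => (q (x + s / 2) / 2 : ℂ)) ?_ hρ
    have hqc := h.continuous_left
    refine (h.integrableOn_comp_half x).mono' (Continuous.aestronglyMeasurable (by fun_prop))
      (Eventually.of_forall fun s => ?_)
    rw [norm_div, Complex.norm_real, Real.norm_eq_abs, Complex.norm_ofNat]
    linarith [h.le (x + s / 2), abs_nonneg (q (x + s / 2))]
  -- The kernel equation exhibits the triangular part as a difference of two terms already known to
  -- be integrable.
  have i3 : IntegrableOn (fun s : ℝ => ∫ τ in (0 : ℝ)..(s / 2), exp (2 * I * ρ * τ) *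
      (q (x + τ) * (K₂ (x + τ) (s - 2 * τ) * exp (I * ρ * ((s - 2 * τ : ℝ) : ℂ))))) (Ioi 0) := by
    refine (i2.neg.sub i1).congr_fun (fun s hs => ?_) measurableSet_Ioi
    simp only [Pi.sub_apply, Pi.neg_apply]
    rw [hinner s hs]
    ring
  rw [setIntegral_congr_fun measurableSet_Ioi hinner, integral_sub (f := fun s : ℝ =>
    -((q (x + s / 2) / 2 : ℂ) * exp (I * ρ * s))) i2.neg i3, integral_neg]
  ring

end IsKernelPair

/-! ### The right end -/

lemma hasDerivAt_exp_mul {n : ℝ → ℂ} {v : ℂ} {x : ℝ} (c : ℂ) (h : HasDerivAt n v x) :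
    HasDerivAt (fun x : ℝ => exp (c * x) * n x) (exp (c * x) * (c * n x + v)) x := by
  have h1 : HasDerivAt (fun x : ℝ => c * x) c x :=
    ((Complex.ofRealCLM.hasDerivAt (x := x)).const_mul c).congr_deriv (by simp)
  exact (h1.cexp.mul h).congr_deriv (by ring)

lemma IsMajorant.integrableOn_mul {q σ : ℝ → ℝ} (h : IsMajorant q σ) {g : ℝ → ℂ}
    (hg : Continuous g) {a M : ℝ} (hM : ∀ t, a ≤ t → ‖g t‖ ≤ M) :
    IntegrableOn (fun t => (q t : ℂ) * g t) (Ioi a) := by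
  have hq := h.continuous_left
  refine ((h.integrable_left a).norm.mul_const M).mono'
    (Continuous.aestronglyMeasurable (by fun_prop)) ?_
  filter_upwards [ae_restrict_mem measurableSet_Ioi] with t ht
  rw [norm_mul, Complex.norm_real]
  exact mul_le_mul_of_nonneg_left (hM t (le_of_lt ht)) (norm_nonneg _)

open IsBoundedKernel

namespace IsKernelPair

variable {q σ : ℝ → ℝ} {C : ℝ} {K₁ K₂ : ℝ → ℝ → ℝ} {ρ : ℂ}

lemma hasDerivAt_transform_snd (hK : IsKernelPair q σ C K₁ K₂) (h : IsMajorant q σ)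
    (hρ : 0 ≤ ρ.im) (x : ℝ) : HasDerivAt (transform K₂ ρ) (-(q x * transform K₁ ρ x)) x := by
  have hc := hK.fst.continuous_transform h hρ
  have hq := h.continuous_left
  rw [show transform K₂ ρ = tail fun t => q t * transform K₁ ρ t from
    funext (hK.transform_snd h hρ)]
  exact hasDerivAt_tail (fun a => h.integrableOn_mul hc
    fun t ht => hK.fst.norm_transform_le_of_le h hρ ht) (by fun_prop) x

/-- The substitution `t = x + τ` confines `x` to a factor `e^{-2iρx}` and the endpoint of a tail
integral with continuous integrand, so neither `q` nor a kernel has to be differentiated. -/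
lemma hasDerivAt_transform_fst (hK : IsKernelPair q σ C K₁ K₂) (h : IsMajorant q σ)
    (hρ : 0 ≤ ρ.im) (x : ℝ) : HasDerivAt (transform K₁ ρ)
      (-(2 * I * ρ * transform K₁ ρ x) + q x * (1 + transform K₂ ρ x)) x := by
  have hc := hK.snd.continuous_transform h hρ
  have hq := h.continuous_left
  obtain ⟨g, hg⟩ : ∃ g : ℝ → ℂ, ∀ t : ℝ,
      g t = q t * (exp (2 * I * ρ * t) * (1 + transform K₂ ρ t)) := ⟨_, fun _ => rfl⟩
  have hgc : Continuous g := by rw [funext hg]; fun_prop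
  have hgi : ∀ a, IntegrableOn g (Ioi a) := fun a => by
    rw [funext hg]
    refine h.integrableOn_mul (by fun_prop) (M := Real.exp (-(2 * ρ.im * a)) *
      (1 + C * Real.exp (2 * tail σ a) * (2 * tail σ a))) fun t ht => ?_
    rw [norm_mul]
    refine mul_le_mul ?_ ((norm_add_le _ _).trans ?_) (norm_nonneg _) (Real.exp_pos _).le
    · rw [Complex.norm_exp, Real.exp_le_exp]
      have : (2 * I * ρ * (t : ℂ)).re = -(2 * ρ.im * t) := by simp
      rw [this]
      nlinarith
    · rw [norm_one]
      linarith [hK.snd.norm_transform_le_of_le h hρ ht]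
  have hrep : ∀ x : ℝ, transform K₁ ρ x = exp (-(2 * I * ρ) * x) * -tail g x := fun x => by
    rw [hK.transform_fst_eq_integral h hρ, tail, setIntegral_Ioi_eq_shift g x, mul_neg, neg_inj,
      ← integral_const_mul (exp (-(2 * I * ρ) * x))]
    refine integral_congr_ae (Eventually.of_forall fun τ => ?_)
    simp only [hg]
    rw [show 2 * I * ρ * ((x + τ : ℝ) : ℂ) = -(-(2 * I * ρ) * x) + 2 * I * ρ * τ by push_cast; ring,
      Complex.exp_add, Complex.exp_neg]
    have := Complex.exp_ne_zero (-(2 * I * ρ) * x)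
    field_simp
  rw [hrep x, show transform K₁ ρ = fun x : ℝ => exp (-(2 * I * ρ) * x) * -tail g x from
    funext hrep]
  refine (hasDerivAt_exp_mul _ (hasDerivAt_tail hgi hgc x).neg).congr_deriv ?_
  have hexp : exp (-(2 * I * ρ) * x) * exp (2 * I * ρ * x) = 1 := by
    rw [← Complex.exp_add]; simp
  rw [hg, Pi.neg_apply]
  linear_combination (q x * (1 + transform K₂ ρ x)) * hexp

/-- The kernels yield the right Jost solution of the Zakharov-Shabat system. -/
lemma isZSJostRight (hK : IsKernelPair q σ C K₁ K₂) (h : IsMajorant q σ) (hρ : 0 ≤ ρ.im) :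
    IsZSJostRight q ρ (fun x => exp (I * ρ * x) * transform K₁ ρ x)
      (fun x => exp (I * ρ * x) * (1 + transform K₂ ρ x)) := by
  have hexp : ∀ x : ℝ, exp (-(I * ρ * x)) * exp (I * ρ * x) = 1 := fun x => by
    rw [← Complex.exp_add]; simp
  refine ⟨fun x => ⟨?_, ?_⟩, ?_, ?_⟩
  · refine (hasDerivAt_exp_mul (I * ρ) (hK.hasDerivAt_transform_fst h hρ x)).congr_deriv ?_
    ring
  · refine (hasDerivAt_exp_mul (I * ρ)
      ((hK.hasDerivAt_transform_snd h hρ x).const_add 1)).congr_deriv ?_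
    ring
  · simp only [← mul_assoc, hexp, one_mul]
    exact hK.fst.tendsto_transform h hρ
  · simp only [← mul_assoc, hexp, one_mul]
    simpa using (hK.snd.tendsto_transform h hρ).const_add 1

end IsKernelPair

/-- For fixed `x` the kernel is integrable and, `σ` being decreasing, bounded on the half-line,
hence square integrable. -/
lemma IsBoundedKernel.memLp_two {q σ : ℝ → ℝ} {C : ℝ} {K : ℝ → ℝ → ℝ}
    (hK : IsBoundedKernel σ C K) (h : IsMajorant q σ) (x : ℝ) :
    MemLp (K x) 2 (volume.restrict (Ioi 0)) := by
  rw [memLp_two_iff_integrable_sq (hK.continuous_apply x).aestronglyMeasurable]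
  have hC := hK.nonneg
  refine ((hK.integrableOn h x).norm.const_mul (C * Real.exp (2 * tail σ x) * σ x)).mono'
    (((hK.continuous_apply x).pow 2).aestronglyMeasurable) ?_
  filter_upwards [ae_restrict_mem measurableSet_Ioi] with s hs
  have hs' : (0 : ℝ) < s := hs
  rw [norm_pow, pow_two]
  refine mul_le_mul_of_nonneg_right ((hK.bound x s).trans ?_) (norm_nonneg _)
  exact mul_le_mul_of_nonneg_left (h.antitone (by linarith)) (by positivity)

lemma memLp_comp_add_iff {f : ℝ → ℂ} {x : ℝ} :
    MemLp (fun s => f (x + s)) 2 (volume.restrict (Ioi 0)) ↔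
      MemLp f 2 (volume.restrict (Ioi x)) := by
  have h1 := (measurePreserving_add_left volume x).restrict_preimage_emb
    (measurableEmbedding_addLeft x) (Ioi x)
  have h2 : (fun s => x + s) ⁻¹' Ioi x = Ioi 0 := by ext s; simp
  rw [h2] at h1
  exact ⟨fun h => h1.map_eq ▸ ((measurableEmbedding_addLeft x).memLp_map_measure_iff).2 h,
    fun h => h.comp_measurePreserving h1⟩

/-- The Levin kernel for the potential `-iq' - q²` exists. -/
lemma IsKernelPair.isRightJostKernel {q σ : ℝ → ℝ} {C : ℝ} {K₁ K₂ : ℝ → ℝ → ℝ}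
    (hK : IsKernelPair q σ C K₁ K₂) (h : IsMajorant q σ)
    (hq : ∀ a b : ℝ, AbsolutelyContinuousOnInterval q a b) :
    IsRightJostKernel (schrodingerPotential q)
      (fun x t => (K₂ x (t - x) : ℂ) + -I * (K₁ x (t - x) : ℂ)) := by
  refine ⟨fun x => ⟨?_, ?_⟩, fun ρ x => exp (I * ρ * x) * (1 + transform K₂ ρ x) -
    I * (exp (I * ρ * x) * transform K₁ ρ x), fun ρ hρ => ⟨⟨?_, ?_⟩, fun x => ?_⟩⟩
  · rw [← integrableOn_comp_add_iff]
    simp only [add_sub_cancel_left]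
    have m1 := hK.fst.integrableOn_ofReal h x
    have m2 := hK.snd.integrableOn_ofReal h x
    exact Integrable.add m2 (Integrable.const_mul m1 (-I))
  · rw [← memLp_comp_add_iff]
    simp only [add_sub_cancel_left]
    have m1 : MemLp (fun s => (K₁ x s : ℂ)) 2 (volume.restrict (Ioi 0)) :=
      (hK.fst.memLp_two h x).ofReal
    have m2 : MemLp (fun s => (K₂ x s : ℂ)) 2 (volume.restrict (Ioi 0)) :=
      (hK.snd.memLp_two h x).ofReal
    exact m2.add (m1.const_mul (-I))
  · exact (hK.isZSJostRight h hρ).1.isSchrodingerSolution hq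
  · have hj := hK.isZSJostRight h hρ
    have h1 := hj.2.2.sub (hj.2.1.const_mul I)
    simp only [mul_zero, sub_zero] at h1
    refine h1.congr fun x => ?_
    ring
  · rw [setIntegral_mul_exp_eq_halfFourier]
    simp only [add_sub_cancel_left]
    rw [halfFourier_add (α := fun s => (K₂ x s : ℂ)) (β := fun s => -I * (K₁ x s : ℂ))
      (hK.snd.integrableOn_ofReal h x) ((hK.fst.integrableOn_ofReal h x).const_mul (-I)) hρ,
      halfFourier_const_mul, transform, transform]
    ring

/-- The representation of the Jost solution by a Levin kernel extends to real `ρ`. -/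
lemma IsRightJostKernel.representation_of_nonneg {q σ : ℝ → ℝ} (h : IsMajorant q σ)
    (hq : ∀ a b : ℝ, AbsolutelyContinuousOnInterval q a b)
    {A : ℝ → ℝ → ℂ} (hA : IsRightJostKernel (schrodingerPotential q) A) {ψ₁ ψ₂ : ℂ → ℝ → ℂ}
    (hψ : ∀ ρ : ℂ, 0 ≤ ρ.im → IsZSJostRight q ρ (ψ₁ ρ) (ψ₂ ρ)) (x : ℝ) {ρ : ℂ} (hρ : 0 ≤ ρ.im) :
    ψ₁ ρ x = -exp (I * ρ * x) * (0 + halfFourier (fun s => ((A x (x + s)).im : ℂ)) ρ) ∧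
    ψ₂ ρ x = exp (I * ρ * x) * (1 + halfFourier (fun s => ((A x (x + s)).re : ℂ)) ρ) := by
  obtain ⟨C, K₁, K₂, hK⟩ := h.exists_isKernelPair
  have hrep := fun (ρ : ℂ) (hρ : 0 < ρ.im) => hA.representation hq h.integrable_left hψ hρ x
  have hα := integrableOn_comp_add_iff.2 (hA.1 x).1
  -- `ψ` is given pointwise in `ρ`; its continuity up to the real axis is read off from the
  -- constructed kernels, which need not be related to `A`.
  have hψK := fun (ρ : ℂ) (hρ : 0 ≤ ρ.im) => (hψ ρ hρ).unique hρ (hK.isZSJostRight h hρ) x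
  have c1 : ContinuousOn (fun ρ => transform K₁ ρ x) {ρ | 0 ≤ ρ.im} :=
    continuousOn_halfFourier (hK.fst.integrableOn_ofReal h x)
  have c2 : ContinuousOn (fun ρ => transform K₂ ρ x) {ρ | 0 ≤ ρ.im} :=
    continuousOn_halfFourier (hK.snd.integrableOn_ofReal h x)
  have c3 : ContinuousOn (halfFourier fun s => ((A x (x + s)).im : ℂ)) {ρ | 0 ≤ ρ.im} :=
    continuousOn_halfFourier hα.im.ofReal
  have c4 : ContinuousOn (halfFourier fun s => ((A x (x + s)).re : ℂ)) {ρ | 0 ≤ ρ.im} :=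
    continuousOn_halfFourier hα.re.ofReal
  have c0 : ContinuousOn (fun ρ : ℂ => exp (I * ρ * x)) {ρ | 0 ≤ ρ.im} := by fun_prop
  have hsub : {ρ : ℂ | 0 < ρ.im} ⊆ {ρ | 0 ≤ ρ.im} := fun ρ (hρ : 0 < ρ.im) => hρ.le
  have hcl : {ρ : ℂ | 0 ≤ ρ.im} ⊆ closure {ρ | 0 < ρ.im} := by
    rw [Complex.closure_setOfPred_lt_im]
  rw [(hψK ρ hρ).1, (hψK ρ hρ).2]
  constructor
  · have heq : EqOn (fun ρ => exp (I * ρ * x) * transform K₁ ρ x)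
        (fun ρ => -exp (I * ρ * x) * (0 + halfFourier (fun s => ((A x (x + s)).im : ℂ)) ρ))
        {ρ | 0 < ρ.im} := fun ρ hρ => by
      simp only
      rw [← (hψK ρ (le_of_lt hρ)).1, (hrep ρ hρ).1]
    exact heq.of_subset_closure (c0.mul c1) (c0.neg.mul (continuousOn_const.add c3)) hsub hcl hρ
  · have heq : EqOn (fun ρ => exp (I * ρ * x) * (1 + transform K₂ ρ x))
        (fun ρ => exp (I * ρ * x) * (1 + halfFourier (fun s => ((A x (x + s)).re : ℂ)) ρ))
        {ρ | 0 < ρ.im} := fun ρ hρ => by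
      simp only
      rw [← (hψK ρ (le_of_lt hρ)).2, (hrep ρ hρ).2]
    exact heq.of_subset_closure (c0.mul (continuousOn_const.add c2))
      (c0.mul (continuousOn_const.add c4)) hsub hcl hρ

lemma coeffA_eq_laguerreCoeff {A : ℝ → ℝ → ℂ} {x : ℝ}
    (hA : MemLp (fun s => A x (x + s)) 2 (volume.restrict (Ioi 0))) (n : ℕ) :
    (coeffA A n x).re = laguerreCoeff (fun s => (A x (x + s)).re) n ∧
    (coeffA A n x).im = laguerreCoeff (fun s => (A x (x + s)).im) n := by
  have h1 : coeffA A n x = ∫ s in Ioi (0 : ℝ), A x (x + s) * (laguerreFun n s : ℂ) := by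
    rw [coeffA, setIntegral_Ioi_eq_shift]
    simp only [add_sub_cancel_left]
    rfl
  have hint : Integrable (fun s => A x (x + s) * (laguerreFun n s : ℂ))
      (volume.restrict (Ioi 0)) := hA.integrable_mul (memLp_laguerreFun n).ofReal
  rw [h1, laguerreCoeff, laguerreCoeff]
  constructor
  · rw [← Complex.reCLM_apply, ← Complex.reCLM.integral_comp_comm hint]
    simp
  · rw [← Complex.imCLM_apply, ← Complex.imCLM.integral_comp_comm hint]
    simp

/-- Existence and uniqueness of the right Jost solution. -/
lemma existsUnique_isZSJostRight {q σ : ℝ → ℝ} (h : IsMajorant q σ) {ρ : ℂ} (hρ : 0 ≤ ρ.im) :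
    ∃! p : (ℝ → ℂ) × (ℝ → ℂ), IsZSJostRight q ρ p.1 p.2 := by
  obtain ⟨C, K₁, K₂, hK⟩ := h.exists_isKernelPair
  have hj := hK.isZSJostRight h hρ
  refine ⟨⟨_, _⟩, hj, fun p hp => Prod.ext (funext fun x => ?_) (funext fun x => ?_)⟩
  · exact (hp.unique hρ hj x).1
  · exact (hp.unique hρ hj x).2

/-- The conclusions of the theorem at the right end. -/
lemma right_representation {q σ : ℝ → ℝ} (h : IsMajorant q σ)
    (hq : ∀ a b : ℝ, AbsolutelyContinuousOnInterval q a b)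
    {A : ℝ → ℝ → ℂ} (hA : IsRightJostKernel (schrodingerPotential q) A) {ψ₁ ψ₂ : ℂ → ℝ → ℂ}
    (hψ : ∀ ρ : ℂ, 0 ≤ ρ.im → IsZSJostRight q ρ (ψ₁ ρ) (ψ₂ ρ)) (x : ℝ) :
    (Summable (fun n => (coeffA A n x).re ^ 2) ∧ Summable (fun n => (coeffA A n x).im ^ 2)) ∧
    (∀ z : ℂ, ‖z‖ < 1 → Summable (seriesTerm (fun n => (coeffA A n x).re) z) ∧
      Summable (seriesTerm (fun n => (coeffA A n x).im) z)) ∧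
    HasSPPS (fun ρ => ψ₁ ρ x) (fun ρ => -exp (I * ρ * x)) 0 (fun n => (coeffA A n x).im) ∧
    HasSPPS (fun ρ => ψ₂ ρ x) (fun ρ => exp (I * ρ * x)) 1 (fun n => (coeffA A n x).re) ∧
    MemHardy2 (fun z => exp (-(I * rhoOf z * x)) * ψ₁ (rhoOf z) x) ∧
    MemHardy2 (fun z => exp (-(I * rhoOf z * x)) * ψ₂ (rhoOf z) x) := by
  have hα := memLp_comp_add_iff.2 (hA.1 x).2
  have hα1 := integrableOn_comp_add_iff.2 (hA.1 x).1
  have hrep := fun (ρ : ℂ) (hρ : 0 ≤ ρ.im) => hA.representation_of_nonneg h hq hψ x hρ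
  have hre : (fun n => (coeffA A n x).re) = laguerreCoeff fun s => (A x (x + s)).re :=
    funext fun n => (coeffA_eq_laguerreCoeff hα n).1
  have him : (fun n => (coeffA A n x).im) = laguerreCoeff fun s => (A x (x + s)).im :=
    funext fun n => (coeffA_eq_laguerreCoeff hα n).2
  have hexp : ∀ ρ : ℂ, exp (-(I * ρ * x)) * exp (I * ρ * x) = 1 := fun ρ => by
    rw [← Complex.exp_add]; simp
  refine ⟨⟨?_, ?_⟩, fun z hz => ⟨?_, ?_⟩, ?_, ?_, ?_, ?_⟩
  · rw [show (fun n => (coeffA A n x).re ^ 2) = fun n =>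
      (fun n => (coeffA A n x).re) n ^ 2 from rfl,
      hre]
    exact summable_sq_laguerreCoeff hα.re
  · rw [show (fun n => (coeffA A n x).im ^ 2) = fun n =>
      (fun n => (coeffA A n x).im) n ^ 2 from rfl,
      him]
    exact summable_sq_laguerreCoeff hα.im
  · rw [hre]
    exact summable_seriesTerm (norm_laguerreCoeff_le hα.re) hz
  · rw [him]
    exact summable_seriesTerm (norm_laguerreCoeff_le hα.im) hz
  · rw [him]
    exact hasSPPS_of_halfFourier hα1.im hα.im fun ρ hρ => (hrep ρ hρ).1
  · rw [hre]
    exact hasSPPS_of_halfFourier hα1.re hα.re fun ρ hρ => (hrep ρ hρ).2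
  -- The minus sign in front of `ψ₁` is moved into the density.
  · refine memHardy2_of_halfFourier (α := fun s => -(A x (x + s)).im) (c := 0) hα1.im.neg hα.im.neg
      fun z hz => ?_
    rw [(hrep _ (rhoOf_im_pos hz).le).1]
    have h2 := halfFourier_const_mul (-1) (fun s => ((A x (x + s)).im : ℂ)) (rhoOf z)
    simp only [neg_one_mul] at h2
    simp only [Complex.ofReal_neg]
    rw [h2]
    linear_combination (-halfFourier (fun s => ((A x (x + s)).im : ℂ)) (rhoOf z)) * hexp (rhoOf z)
  · refine memHardy2_of_halfFourier (α := fun s => (A x (x + s)).re) (c := 1) hα1.re hα.re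
      fun z hz => ?_
    rw [(hrep _ (rhoOf_im_pos hz).le).2, ← mul_assoc, hexp, one_mul]

/-! ### Reflection -/

/-- `q(-x)` is a constant plus the integral of the locally integrable function `-q'(-t)`. -/
lemma absolutelyContinuous_comp_neg {q : ℝ → ℝ}
    (hq : ∀ a b : ℝ, AbsolutelyContinuousOnInterval q a b) (a b : ℝ) :
    AbsolutelyContinuousOnInterval (fun x => q (-x)) a b := by
  have hint : IntervalIntegrable (fun t => -deriv q (-t)) volume a b := by
    have h1 := (hq (-a) (-b)).intervalIntegrable_deriv
    rw [IntervalIntegrable.iff_comp_neg, neg_neg, neg_neg] at h1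
    exact h1.neg
  have h2 : (fun x => q (-x)) = (fun _ => q (-a)) + fun x => ∫ t in a..x, -deriv q (-t) := by
    ext x
    rw [Pi.add_apply, intervalIntegral.integral_neg,
      intervalIntegral.integral_comp_neg (fun t => deriv q t), (hq (-x) (-a)).integral_deriv_eq_sub]
    ring
  rw [h2]
  exact (contDiff_const.contDiffOn.absolutelyContinuousOnInterval).add
    (hint.absolutelyContinuousOnInterval_intervalIntegral left_mem_uIcc)

lemma memL11_comp_neg {f : ℝ → ℂ} (hf : MemL11 f) : MemL11 fun x => f (-x) := by
  refine (Integrable.comp_neg hf).congr (Eventually.of_forall fun x => ?_)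
  simp

lemma deriv_reflect (q : ℝ → ℝ) (x : ℝ) : deriv (fun x => q (-x)) x = -deriv q (-x) :=
  deriv_comp_neg q x

/-- Reflection changes the sign of `q'`, which for `-iq' - q²` amounts to conjugation. Reflecting
Schrödinger solutions must therefore be paired with conjugation and `ρ ↦ -ρ̄`. -/
lemma schrodingerPotential_reflect (q : ℝ → ℝ) :
    schrodingerPotential (fun x => q (-x)) =
      fun x => (starRingEnd ℂ) (schrodingerPotential q (-x)) := by
  ext x
  simp [schrodingerPotential, deriv_reflect]

lemma hasDerivAt_reflect {n : ℝ → ℂ} {v : ℂ} {x : ℝ} (h : HasDerivAt n v (-x)) :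
    HasDerivAt (fun x => n (-x)) (-v) x := by
  exact (h.scomp x (hasDerivAt_neg x)).congr_deriv (by simp)

/-- Reversing `x` flips the sign of both equations, and exchanging the components undoes this; `ρ`
stays the same, without conjugation. -/
lemma IsZSSolution.reflect {q : ℝ → ℝ} {ρ : ℂ} {n₁ n₂ : ℝ → ℂ} (h : IsZSSolution q ρ n₁ n₂) :
    IsZSSolution (fun x => q (-x)) ρ (fun x => n₂ (-x)) (fun x => n₁ (-x)) := fun x =>
  ⟨(hasDerivAt_reflect (h (-x)).2).congr_deriv (by ring),
    (hasDerivAt_reflect (h (-x)).1).congr_deriv (by ring)⟩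

lemma IsZSJostLeft.reflect {q : ℝ → ℝ} {ρ : ℂ} {n₁ n₂ : ℝ → ℂ} (h : IsZSJostLeft q ρ n₁ n₂) :
    IsZSJostRight (fun x => q (-x)) ρ (fun x => n₂ (-x)) (fun x => n₁ (-x)) := by
  refine ⟨h.1.reflect, ?_, ?_⟩
  · exact (h.2.2.comp tendsto_neg_atTop_atBot).congr fun x => by simp
  · exact (h.2.1.comp tendsto_neg_atTop_atBot).congr fun x => by simp

lemma IsZSJostRight.reflect {q : ℝ → ℝ} {ρ : ℂ} {n₁ n₂ : ℝ → ℂ} (h : IsZSJostRight q ρ n₁ n₂) :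
    IsZSJostLeft (fun x => q (-x)) ρ (fun x => n₂ (-x)) (fun x => n₁ (-x)) := by
  refine ⟨h.1.reflect, ?_, ?_⟩
  · exact (h.2.2.comp tendsto_neg_atBot_atTop).congr fun x => by simp
  · exact (h.2.1.comp tendsto_neg_atBot_atTop).congr fun x => by simp

lemma intervalIntegral_conj (f : ℝ → ℂ) (a b : ℝ) :
    ∫ t in a..b, (starRingEnd ℂ) (f t) = (starRingEnd ℂ) (∫ t in a..b, f t) := by
  simp only [intervalIntegral, integral_conj, map_sub]

lemma IsSchrodingerSolution.reflect {Q : ℝ → ℂ} {ρ : ℂ} {y : ℝ → ℂ}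
    (h : IsSchrodingerSolution Q ρ y) :
    IsSchrodingerSolution (fun x => (starRingEnd ℂ) (Q (-x))) (-(starRingEnd ℂ) ρ)
      (fun x => (starRingEnd ℂ) (y (-x))) := by
  obtain ⟨y', hy, hint⟩ := h
  refine ⟨fun x => (starRingEnd ℂ) (-y' (-x)),
    fun x => hasDerivAt_conj (hasDerivAt_reflect (hy (-x))), fun a b => ?_⟩
  have heq : ∀ t, ((starRingEnd ℂ) (Q (-t)) - (-(starRingEnd ℂ) ρ) ^ 2) *
      (starRingEnd ℂ) (y (-t)) = (starRingEnd ℂ) ((Q (-t) - ρ ^ 2) * y (-t)) := fun t => by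
    simp
  simp only [heq]
  constructor
  · have h1 := (hint (-a) (-b)).1
    rw [IntervalIntegrable.iff_comp_neg, neg_neg, neg_neg] at h1
    exact ⟨Complex.conjCLE.toContinuousLinearMap.integrable_comp h1.1,
      Complex.conjCLE.toContinuousLinearMap.integrable_comp h1.2⟩
  · rw [intervalIntegral_conj, intervalIntegral.integral_comp_neg (fun t => (Q t - ρ ^ 2) * y t),
      ← (hint (-b) (-a)).2]
    simp only [map_neg, map_sub]
    ring

lemma tendsto_conj_reflect {y : ℝ → ℂ} {ρ : ℂ} {l l' : Filter ℝ}
    (h : Tendsto (fun x : ℝ => exp (I * ρ * x) * y x) l (𝓝 1))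
    (hl : Tendsto (fun x : ℝ => -x) l' l) :
    Tendsto (fun x : ℝ => exp (-(I * (-(starRingEnd ℂ) ρ) * x)) * (starRingEnd ℂ) (y (-x))) l'
      (𝓝 1) := by
  have h1 := (Complex.continuous_conj.tendsto 1).comp (h.comp hl)
  rw [map_one] at h1
  refine h1.congr fun x => ?_
  rw [Function.comp_apply, Function.comp_apply, map_mul, ← Complex.exp_conj]
  simp

lemma IsSchrodingerJostLeft.reflect {Q : ℝ → ℂ} {ρ : ℂ} {y : ℝ → ℂ}
    (h : IsSchrodingerJostLeft Q ρ y) :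
    IsSchrodingerJostRight (fun x => (starRingEnd ℂ) (Q (-x))) (-(starRingEnd ℂ) ρ)
      (fun x => (starRingEnd ℂ) (y (-x))) :=
  ⟨h.1.reflect, tendsto_conj_reflect h.2 tendsto_neg_atTop_atBot⟩

lemma IsSchrodingerJostRight.reflect {Q : ℝ → ℂ} {ρ : ℂ} {y : ℝ → ℂ}
    (h : IsSchrodingerJostRight Q ρ y) :
    IsSchrodingerJostLeft (fun x => (starRingEnd ℂ) (Q (-x))) (-(starRingEnd ℂ) ρ)
      (fun x => (starRingEnd ℂ) (y (-x))) := by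
  refine ⟨h.1.reflect, ?_⟩
  have h1 : Tendsto (fun x : ℝ => exp (I * -ρ * x) * y x) atTop (𝓝 1) := by simpa using h.2
  simpa using tendsto_conj_reflect h1 tendsto_neg_atBot_atTop

lemma setIntegral_Iio_eq_reflect (F : ℝ → ℂ) (x : ℝ) :
    ∫ t in Iio (-x), F t = ∫ t in Ioi x, F (-t) := by
  rw [integral_comp_neg_Ioi, integral_Iic_eq_integral_Iio]

lemma setIntegral_Ioi_eq_reflect (F : ℝ → ℂ) (x : ℝ) :
    ∫ t in Ioi (-x), F t = ∫ t in Iio x, F (-t) := by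
  rw [← integral_Iic_eq_integral_Iio, integral_comp_neg_Iic]

lemma measurePreserving_neg_Ioi (x : ℝ) : MeasurePreserving (fun t : ℝ => -t)
    (volume.restrict (Ioi x)) (volume.restrict (Iio (-x))) := by
  have h := (Measure.measurePreserving_neg (volume : Measure ℝ)).restrict_preimage
    (measurableSet_Iio (a := -x))
  have h2 : Neg.neg ⁻¹' Iio (-x) = Ioi x := by ext t; simp
  rwa [h2] at h

lemma measurePreserving_neg_Iio (x : ℝ) : MeasurePreserving (fun t : ℝ => -t)
    (volume.restrict (Iio x)) (volume.restrict (Ioi (-x))) := by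
  have h := (Measure.measurePreserving_neg (volume : Measure ℝ)).restrict_preimage
    (measurableSet_Ioi (a := -x))
  have h2 : Neg.neg ⁻¹' Ioi (-x) = Iio x := by ext t; simp
  rwa [h2] at h

lemma memLp_conj_comp {f : ℝ → ℂ} {p : ENNReal} {μ ν : Measure ℝ} {g : ℝ → ℝ}
    (hf : MemLp f p ν) (hg : MeasurePreserving g μ ν) :
    MemLp (fun t => (starRingEnd ℂ) (f (g t))) p μ :=
  Complex.conjCLE.toContinuousLinearMap.comp_memLp' (hf.comp_measurePreserving hg)

/-- The reflected kernel. -/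
def reflectKernel (B : ℝ → ℝ → ℂ) (x t : ℝ) : ℂ := (starRingEnd ℂ) (B (-x) (-t))

lemma neg_conj_im {ρ : ℂ} (hρ : 0 ≤ ρ.im) : 0 ≤ (-(starRingEnd ℂ) ρ).im := by simpa using hρ

lemma neg_conj_neg_conj (ρ : ℂ) : -(starRingEnd ℂ) (-(starRingEnd ℂ) ρ) = ρ := by simp

lemma IsLeftJostKernel.reflect {Q : ℝ → ℂ} {B : ℝ → ℝ → ℂ} (h : IsLeftJostKernel Q B) :
    IsRightJostKernel (fun x => (starRingEnd ℂ) (Q (-x))) (reflectKernel B) := by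
  obtain ⟨hB, g, hg⟩ := h
  refine ⟨fun x => ⟨?_, ?_⟩, fun ρ x => (starRingEnd ℂ) (g (-(starRingEnd ℂ) ρ) (-x)),
    fun ρ hρ => ⟨?_, fun x => ?_⟩⟩
  · rw [IntegrableOn, ← memLp_one_iff_integrable]
    exact memLp_conj_comp (memLp_one_iff_integrable.2 (hB (-x)).1) (measurePreserving_neg_Ioi x)
  · exact memLp_conj_comp (hB (-x)).2 (measurePreserving_neg_Ioi x)
  · have := (hg _ (neg_conj_im hρ)).1.reflect
    rwa [neg_conj_neg_conj] at this
  · beta_reduce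
    rw [(hg _ (neg_conj_im hρ)).2, map_add, setIntegral_Iio_eq_reflect, ← integral_conj]
    congr 1
    · rw [← Complex.exp_conj]; simp
    · refine integral_congr_ae (Eventually.of_forall fun t => ?_)
      simp [reflectKernel, ← Complex.exp_conj]

lemma IsRightJostKernel.reflect {Q : ℝ → ℂ} {A : ℝ → ℝ → ℂ} (h : IsRightJostKernel Q A) :
    IsLeftJostKernel (fun x => (starRingEnd ℂ) (Q (-x))) (reflectKernel A) := by
  obtain ⟨hA, e, he⟩ := h
  refine ⟨fun x => ⟨?_, ?_⟩, fun ρ x => (starRingEnd ℂ) (e (-(starRingEnd ℂ) ρ) (-x)),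
    fun ρ hρ => ⟨?_, fun x => ?_⟩⟩
  · rw [IntegrableOn, ← memLp_one_iff_integrable]
    exact memLp_conj_comp (memLp_one_iff_integrable.2 (hA (-x)).1) (measurePreserving_neg_Iio x)
  · exact memLp_conj_comp (hA (-x)).2 (measurePreserving_neg_Iio x)
  · have := (he _ (neg_conj_im hρ)).1.reflect
    rwa [neg_conj_neg_conj] at this
  · beta_reduce
    rw [(he _ (neg_conj_im hρ)).2, map_add, setIntegral_Ioi_eq_reflect, ← integral_conj]
    congr 1
    · rw [← Complex.exp_conj]; simp
    · refine integral_congr_ae (Eventually.of_forall fun t => ?_)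
      simp [reflectKernel, ← Complex.exp_conj]

lemma coeffA_reflectKernel (B : ℝ → ℝ → ℂ) (n : ℕ) (x : ℝ) :
    coeffA (reflectKernel B) n (-x) = (starRingEnd ℂ) (coeffB B n x) := by
  rw [coeffA, coeffB, setIntegral_Ioi_eq_reflect, ← integral_conj]
  refine integral_congr_ae (Eventually.of_forall fun t => ?_)
  simp only [reflectKernel, neg_neg, map_mul, Complex.conj_ofReal]
  rw [show -t - -x = x - t by ring]

lemma seriesTerm_neg (c : ℕ → ℝ) (z : ℂ) :
    seriesTerm (fun n => -c n) z = fun n => -seriesTerm c z n := by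
  ext n
  simp [seriesTerm]

/-- The conjugation in the reflected kernel negates the imaginary parts of the coefficients; this
cancels the minus sign of the `ψ₁` formula, so `φ₂` carries none. -/
lemma HasSPPS.neg {f E : ℂ → ℂ} {c : ℕ → ℝ} (h : HasSPPS f (fun ρ => -E ρ) 0 fun n => -c n) :
    HasSPPS f E 0 c := by
  simp only [HasSPPS, seriesTerm_neg, tsum_neg, zero_add, mul_neg, neg_mul, neg_neg] at h ⊢
  exact h

/-- The conclusions of the theorem at the left end. -/
lemma left_representation {q σ : ℝ → ℝ} (h : IsMajorant (fun x => q (-x)) σ)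
    (hq : ∀ a b : ℝ, AbsolutelyContinuousOnInterval q a b)
    {B : ℝ → ℝ → ℂ} (hB : IsLeftJostKernel (schrodingerPotential q) B) {φ₁ φ₂ : ℂ → ℝ → ℂ}
    (hφ : ∀ ρ : ℂ, 0 ≤ ρ.im → IsZSJostLeft q ρ (φ₁ ρ) (φ₂ ρ)) (x : ℝ) :
    (Summable (fun n => (coeffB B n x).re ^ 2) ∧ Summable (fun n => (coeffB B n x).im ^ 2)) ∧
    (∀ z : ℂ, ‖z‖ < 1 → Summable (seriesTerm (fun n => (coeffB B n x).re) z) ∧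
      Summable (seriesTerm (fun n => (coeffB B n x).im) z)) ∧
    HasSPPS (fun ρ => φ₁ ρ x) (fun ρ => exp (-(I * ρ * x))) 1 (fun n => (coeffB B n x).re) ∧
    HasSPPS (fun ρ => φ₂ ρ x) (fun ρ => exp (-(I * ρ * x))) 0 (fun n => (coeffB B n x).im) ∧
    MemHardy2 (fun z => exp (I * rhoOf z * x) * φ₁ (rhoOf z) x) ∧
    MemHardy2 (fun z => exp (I * rhoOf z * x) * φ₂ (rhoOf z) x) := by
  have hA := hB.reflect
  rw [← schrodingerPotential_reflect] at hA
  obtain ⟨⟨s1, s2⟩, hz, p1, p2, m1, m2⟩ := right_representation h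
    (absolutelyContinuous_comp_neg hq) hA
    (ψ₁ := fun ρ x => φ₂ ρ (-x)) (ψ₂ := fun ρ x => φ₁ ρ (-x)) (fun ρ hρ => (hφ ρ hρ).reflect) (-x)
  simp only [coeffA_reflectKernel, Complex.conj_re, Complex.conj_im, neg_neg, Complex.ofReal_neg,
    mul_neg, even_two.neg_pow] at s1 s2 hz p1 p2 m1 m2
  refine ⟨⟨s1, s2⟩, fun z hz1 => ⟨(hz z hz1).1, ?_⟩, p2, p1.neg, m2, m1⟩
  have := (hz z hz1).2
  rw [seriesTerm_neg] at this
  simpa using this.neg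

lemma exists_isMajorant_reflect {q : ℝ → ℝ}
    (hq : ∀ a b : ℝ, AbsolutelyContinuousOnInterval q a b)
    (hq2 : MemL11 (fun x => ((q x ^ 2 : ℝ) : ℂ)))
    (hq' : MemL11 (fun x => ((deriv q x : ℝ) : ℂ))) : ∃ σ, IsMajorant (fun x => q (-x)) σ := by
  refine exists_isMajorant (absolutelyContinuous_comp_neg hq) (memL11_comp_neg hq2) ?_
  refine (memL11_comp_neg hq').neg.congr (Eventually.of_forall fun x => ?_)
  simp [deriv_reflect]

lemma existsUnique_isZSJostLeft {q σ : ℝ → ℝ} (h : IsMajorant (fun x => q (-x)) σ) {ρ : ℂ}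
    (hρ : 0 ≤ ρ.im) : ∃! p : (ℝ → ℂ) × (ℝ → ℂ), IsZSJostLeft q ρ p.1 p.2 := by
  obtain ⟨p, hp, huniq⟩ := existsUnique_isZSJostRight h hρ
  have h1 : IsZSJostLeft q ρ (fun x => p.2 (-x)) (fun x => p.1 (-x)) := by
    simpa only [neg_neg] using hp.reflect
  refine ⟨⟨_, _⟩, h1, fun r hr => ?_⟩
  have h2 := huniq (fun x => r.2 (-x), fun x => r.1 (-x)) hr.reflect
  rw [← h2]
  simp

end ZakharovShabat

end

/-! ### Assembly of the two ends. -/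

theorem theorem2 (q : ℝ → ℝ)
    (hq : ∀ a b : ℝ, AbsolutelyContinuousOnInterval q a b)
    (hq2 : ZakharovShabat.MemL11 (fun x => ((q x ^ 2 : ℝ) : ℂ)))
    (hq' : ZakharovShabat.MemL11 (fun x => ((deriv q x : ℝ) : ℂ))) :
    -- the Jost solutions exist and are unique
    (∀ ρ : ℂ, 0 ≤ ρ.im →
      (∃! p : (ℝ → ℂ) × (ℝ → ℂ), ZakharovShabat.IsZSJostLeft q ρ p.1 p.2) ∧
      (∃! p : (ℝ → ℂ) × (ℝ → ℂ), ZakharovShabat.IsZSJostRight q ρ p.1 p.2)) ∧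
    -- the kernels for the potential `q₁` exist
    (∃ A : ℝ → ℝ → ℂ,
      ZakharovShabat.IsRightJostKernel (ZakharovShabat.schrodingerPotential q) A) ∧
    (∃ B : ℝ → ℝ → ℂ,
      ZakharovShabat.IsLeftJostKernel (ZakharovShabat.schrodingerPotential q) B) ∧
    -- the representations, for all of these objects
    ∀ (φ₁ φ₂ ψ₁ ψ₂ : ℂ → ℝ → ℂ) (A B : ℝ → ℝ → ℂ),
      (∀ ρ : ℂ, 0 ≤ ρ.im → ZakharovShabat.IsZSJostLeft q ρ (φ₁ ρ) (φ₂ ρ)) →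
      (∀ ρ : ℂ, 0 ≤ ρ.im → ZakharovShabat.IsZSJostRight q ρ (ψ₁ ρ) (ψ₂ ρ)) →
      ZakharovShabat.IsRightJostKernel (ZakharovShabat.schrodingerPotential q) A →
      ZakharovShabat.IsLeftJostKernel (ZakharovShabat.schrodingerPotential q) B →
      ∀ x : ℝ,
        -- square summability of the coefficients
        (Summable (fun n => (ZakharovShabat.coeffA A n x).re ^ 2) ∧
          Summable (fun n => (ZakharovShabat.coeffA A n x).im ^ 2) ∧
          Summable (fun n => (ZakharovShabat.coeffB B n x).re ^ 2) ∧
          Summable (fun n => (ZakharovShabat.coeffB B n x).im ^ 2)) ∧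
        -- convergence of the power series in the unit disk
        (∀ z : ℂ, ‖z‖ < 1 →
          Summable (ZakharovShabat.seriesTerm (fun n => (ZakharovShabat.coeffA A n x).re) z) ∧
          Summable (ZakharovShabat.seriesTerm (fun n => (ZakharovShabat.coeffA A n x).im) z) ∧
          Summable (ZakharovShabat.seriesTerm (fun n => (ZakharovShabat.coeffB B n x).re) z) ∧
          Summable (ZakharovShabat.seriesTerm (fun n => (ZakharovShabat.coeffB B n x).im) z)) ∧
        -- the series representations
        ZakharovShabat.HasSPPS (fun ρ => φ₁ ρ x) (fun ρ => Complex.exp (-(Complex.I * ρ * x))) 1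
          (fun n => (ZakharovShabat.coeffB B n x).re) ∧
        ZakharovShabat.HasSPPS (fun ρ => φ₂ ρ x) (fun ρ => Complex.exp (-(Complex.I * ρ * x))) 0
          (fun n => (ZakharovShabat.coeffB B n x).im) ∧
        ZakharovShabat.HasSPPS (fun ρ => ψ₁ ρ x) (fun ρ => -Complex.exp (Complex.I * ρ * x)) 0
          (fun n => (ZakharovShabat.coeffA A n x).im) ∧
        ZakharovShabat.HasSPPS (fun ρ => ψ₂ ρ x) (fun ρ => Complex.exp (Complex.I * ρ * x)) 1
          (fun n => (ZakharovShabat.coeffA A n x).re) ∧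
        -- membership in the Hardy space, as functions of `z`
        ZakharovShabat.MemHardy2 (fun z =>
          Complex.exp (Complex.I * ZakharovShabat.rhoOf z * x) *
            φ₁ (ZakharovShabat.rhoOf z) x) ∧
        ZakharovShabat.MemHardy2 (fun z =>
          Complex.exp (Complex.I * ZakharovShabat.rhoOf z * x) *
            φ₂ (ZakharovShabat.rhoOf z) x) ∧
        ZakharovShabat.MemHardy2 (fun z =>
          Complex.exp (-(Complex.I * ZakharovShabat.rhoOf z * x)) *
            ψ₁ (ZakharovShabat.rhoOf z) x) ∧
        ZakharovShabat.MemHardy2 (fun z =>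
          Complex.exp (-(Complex.I * ZakharovShabat.rhoOf z * x)) *
            ψ₂ (ZakharovShabat.rhoOf z) x) := by
  obtain ⟨σ, hσ⟩ := ZakharovShabat.exists_isMajorant hq hq2 hq'
  obtain ⟨τ, hτ⟩ := ZakharovShabat.exists_isMajorant_reflect hq hq2 hq'
  refine ⟨fun ρ hρ => ⟨ZakharovShabat.existsUnique_isZSJostLeft hτ hρ,
    ZakharovShabat.existsUnique_isZSJostRight hσ hρ⟩, ?_, ?_, ?_⟩
  · obtain ⟨C, K₁, K₂, hK⟩ := hσ.exists_isKernelPair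
    exact ⟨_, hK.isRightJostKernel hσ hq⟩
  · obtain ⟨C, K₁, K₂, hK⟩ := hτ.exists_isKernelPair
    -- The left kernel is the reflection of a right kernel built for `q(-x)`; reflecting the
    -- potential twice restores it.
    have h := (hK.isRightJostKernel hτ
      (ZakharovShabat.absolutelyContinuous_comp_neg hq)).reflect
    rw [← ZakharovShabat.schrodingerPotential_reflect] at h
    simp only [neg_neg] at h
    exact ⟨_, h⟩
  · intro φ₁ φ₂ ψ₁ ψ₂ A B hφ hψ hA hB x
    obtain ⟨⟨s1, s2⟩, hz, p1, p2, m1, m2⟩ := ZakharovShabat.right_representation hσ hq hA hψ x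
    obtain ⟨⟨s1', s2'⟩, hz', p1', p2', m1', m2'⟩ :=
      ZakharovShabat.left_representation hτ hq hB hφ x
    exact ⟨⟨s1, s2, s1', s2'⟩,
      fun z h => ⟨(hz z h).1, (hz z h).2, (hz' z h).1, (hz' z h).2⟩,
      p1', p2', p1, p2, m1', m2', m1, m2⟩
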